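/- Let $n\ge 1$ be an integer and let $q\in\mathbb{C}^{\times}$ not be a root of unity. Let $\mathcal{O}_q(M_n)$ be the unital associative $\mathbb{C}$-algebra generated by $x_{ij}$ ($1\le i,j\le n$) subject to the relations \[ \begin{aligned} x_{ij}x_{kl}&=x_{kl}x_{ij}+(q-q^{-1})\,x_{il}x_{kj} &&\text{if } i<k,\ j<l,\\ x_{ij}x_{il}&=q\,x_{il}x_{ij} &&\text{if } j<l,\\ x_{ij}x_{kj}&=q\,x_{kj}x_{ij} &&\text{if } i<k,\\ x_{ij}x_{kl}&=x_{kl}x_{ij} &&\text{if } i<k,\ j>l. \end{aligned} \] For subsets $I=\{i_1<\dots<i_t\}$ and $J=\{j_1<\dots<j_t\}$ of $\{1,\dots,n\}$ let \[ [I\,|\,J]=\sum_{s\in S_t}(-q)^{\ell(s)}\,x_{i_1,j_{s(1)}}\cdots x_{i_t,j_{s(t)}}, \] where $\ell(s)$ is the number of inversions of $s$. Put $\sigma_k=\sum_{|I|=k}[I\,|\,I]$ for $1\le k\le n$, so that $\sigma_1=x_{11}+\dots+x_{nn}$ and $\sigma_n=\det_q$ is the quantum determinant. Let $\mathcal{O}_q(GL_n)=\mathcal{O}_q(M_n)[\det_q^{-1}]$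 and $\mathcal{O}_q(SL_n)=\mathcal{O}_q(M_n)/(\det_q-1)$; write again $\sigma_k$ for the image of $\sigma_k$ in $\mathcal{O}_q(GL_n)$ and $\overline{\sigma}_k$ for its image in $\mathcal{O}_q(SL_n)$. Then: \begin{itemize} \item the centralizer of $\sigma_1$ in $\mathcal{O}_q(M_n)$ is the unital $\mathbb{C}$-subalgebra generated by $\sigma_1,\dots,\sigma_n$; \item the centralizer of $\sigma_1$ in $\mathcal{O}_q(GL_n)$ is the unital $\mathbb{C}$-subalgebra generated by $\sigma_1,\dots,\sigma_n,\sigma_n^{-1}$; \item the centralizer of $\overline{\sigma}_1$ in $\mathcal{O}_q(SL_n)$ is the unital $\mathbb{C}$-subalgebra generated by $\overline{\sigma}_1,\dots,\overline{\sigma}_{n-1}$. \end{itemize} -/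

import Mathlib

open scoped BigOperators

noncomputable section

namespace QuantumMatrices

/-- The Coxeter length of a permutation of `{0, …, t-1}`: its number of inversions. -/
def permLength {t : ℕ} (s : Equiv.Perm (Fin t)) : ℕ :=
  (Finset.univ.filter fun p : Fin t × Fin t => p.1 < p.2 ∧ s p.2 < s p.1).card

section Generic

variable {A : Type*} [Ring A] [Algebra ℂ A]

/-- `∑_{s ∈ S_t} (-q)^{ℓ(s)} y_{1,s(1)} y_{2,s(2)} ⋯ y_{t,s(t)}`, with the factors in this order. -/
def qDet (q : ℂ) {t : ℕ} (y : Fin t → Fin t → A) : A :=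
  ∑ s : Equiv.Perm (Fin t), (-q) ^ permLength s • (List.ofFn fun a => y a (s a)).prod

/-- The quantum minor `[I | J]` of `y`, with the elements of `I` and of `J` listed increasingly. -/
def qMinor (q : ℂ) {n t : ℕ} (y : Fin n → Fin n → A)
    (I J : {I : Finset (Fin n) // I.card = t}) : A :=
  qDet q fun a b => y (I.1.orderEmbOfFin I.2 a) (J.1.orderEmbOfFin J.2 b)

/-- The sum of all principal `k × k` quantum minors `[I | I]` of `y`. -/
def qSigma (q : ℂ) {n : ℕ} (y : Fin n → Fin n → A) (k : ℕ) : A :=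
  ∑ I : {I : Finset (Fin n) // I.card = k}, qMinor q y I I

end Generic

/-- The free algebra on the letters `x_{i,j}`. -/
abbrev FreeMat (n : ℕ) : Type := FreeAlgebra ℂ (Fin n × Fin n)

/-- The letter `x_{i,j}` of the free algebra. -/
def freeX {n : ℕ} (i j : Fin n) : FreeMat n := FreeAlgebra.ι ℂ (i, j)

/-- The defining relations of the quantized coordinate ring of `n × n` matrices. -/
inductive MatRel (n : ℕ) (q : ℂ) : FreeMat n → FreeMat n → Prop
  | diag {i j k l : Fin n} (hik : i < k) (hjl : j < l) :
      MatRel n q (freeX i j * freeX k l)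
        (freeX k l * freeX i j + (q - q⁻¹) • (freeX i l * freeX k j))
  | row {i j l : Fin n} (hjl : j < l) :
      MatRel n q (freeX i j * freeX i l) (q • (freeX i l * freeX i j))
  | col {i j k : Fin n} (hik : i < k) :
      MatRel n q (freeX i j * freeX k j) (q • (freeX k j * freeX i j))
  | anti {i j k l : Fin n} (hik : i < k) (hlj : l < j) :
      MatRel n q (freeX i j * freeX k l) (freeX k l * freeX i j)

/-- `O_q(M_n(ℂ))`. -/
abbrev OqM (n : ℕ) (q : ℂ) : Type := RingQuot (MatRel n q)

/-- The generator `x_{i,j}` of `O_q(M_n(ℂ))`. -/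
def OqM.x {n : ℕ} (q : ℂ) (i j : Fin n) : OqM n q :=
  RingQuot.mkAlgHom ℂ (MatRel n q) (freeX i j)

/-- The quantum determinant in `O_q(M_n(ℂ))`. -/
def OqM.det (n : ℕ) (q : ℂ) : OqM n q := qDet q (OqM.x q)

/-- `σ_k ∈ O_q(M_n(ℂ))`. -/
def OqM.sigma (n : ℕ) (q : ℂ) (k : ℕ) : OqM n q := qSigma q (OqM.x q) k

/-- The single relation `det_q = 1`. -/
inductive SLRel (n : ℕ) (q : ℂ) : OqM n q → OqM n q → Prop
  | det_eq_one : SLRel n q (OqM.det n q) 1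

/-- `O_q(SL_n(ℂ)) = O_q(M_n(ℂ)) / (det_q - 1)`. -/
abbrev OqSL (n : ℕ) (q : ℂ) : Type := RingQuot (SLRel n q)

/-- The quotient map `O_q(M_n(ℂ)) → O_q(SL_n(ℂ))`. -/
def OqSL.mk (n : ℕ) (q : ℂ) : OqM n q →ₐ[ℂ] OqSL n q := RingQuot.mkAlgHom ℂ (SLRel n q)

/-- `σ̄_k ∈ O_q(SL_n(ℂ))`, the class of `σ_k`. -/
def OqSL.sigma (n : ℕ) (q : ℂ) (k : ℕ) : OqSL n q := OqSL.mk n q (OqM.sigma n q k)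

/-- The free algebra on the letters `x_{i,j}` and one more letter. -/
abbrev FreeGL (n : ℕ) : Type := FreeAlgebra ℂ (Option (Fin n × Fin n))

/-- The inclusion of the free algebra on the `x_{i,j}` into that with one more letter. -/
def freeIncl (n : ℕ) : FreeMat n →ₐ[ℂ] FreeGL n :=
  FreeAlgebra.lift ℂ fun p => FreeAlgebra.ι ℂ (some p)

/-- The relations of `O_q(M_n(ℂ))`, and those making the extra letter a two-sided inverse of
the quantum determinant. -/
inductive GLRel (n : ℕ) (q : ℂ) : FreeGL n → FreeGL n → Prop
  | mat {a b : FreeMat n} (h : MatRel n q a b) : GLRel n q (freeIncl n a) (freeIncl n b)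
  | det_mul_inv :
      GLRel n q (freeIncl n (qDet q freeX) * FreeAlgebra.ι ℂ none) 1
  | inv_mul_det :
      GLRel n q (FreeAlgebra.ι ℂ none * freeIncl n (qDet q freeX)) 1

/-- `O_q(GL_n(ℂ)) = O_q(M_n(ℂ))[det_q⁻¹]`: the algebra obtained from `O_q(M_n(ℂ))` by
universally adjoining a two-sided inverse of `det_q`. -/
abbrev OqGL (n : ℕ) (q : ℂ) : Type := RingQuot (GLRel n q)

/-- The localization map `O_q(M_n(ℂ)) → O_q(GL_n(ℂ))`. -/
def OqGL.mk (n : ℕ) (q : ℂ) : OqM n q →ₐ[ℂ] OqGL n q :=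
  RingQuot.liftAlgHom ℂ ⟨(RingQuot.mkAlgHom ℂ (GLRel n q)).comp (freeIncl n),
    fun _ _ h => by
      simpa only [AlgHom.comp_apply] using RingQuot.mkAlgHom_rel ℂ (GLRel.mat h)⟩

/-- `σ_k ∈ O_q(GL_n(ℂ))`, the image of `σ_k ∈ O_q(M_n(ℂ))`. -/
def OqGL.sigma (n : ℕ) (q : ℂ) (k : ℕ) : OqGL n q := OqGL.mk n q (OqM.sigma n q k)

/-- `det_q⁻¹ ∈ O_q(GL_n(ℂ))`. -/
def OqGL.detInv (n : ℕ) (q : ℂ) : OqGL n q :=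
  RingQuot.mkAlgHom ℂ (GLRel n q) (FreeAlgebra.ι ℂ none)

theorem map_qDet {A B : Type*} [Ring A] [Algebra ℂ A] [Ring B] [Algebra ℂ B] (f : A →ₐ[ℂ] B)
    (q : ℂ) {t : ℕ} (y : Fin t → Fin t → A) : f (qDet q y) = qDet q fun a b => f (y a b) := by
  simp only [qDet, map_sum, map_smul, map_list_prod, List.map_ofFn]
  rfl

/-- `σ_1` is the trace. -/
theorem OqM.sigma_one (n : ℕ) (q : ℂ) : OqM.sigma n q 1 = ∑ i, OqM.x q i i := by
  symm
  refine Fintype.sum_bijective (fun i : Fin n => (⟨{i}, Finset.card_singleton i⟩ :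
    {I : Finset (Fin n) // I.card = 1})) ⟨fun i j h => ?_, fun I => ?_⟩ _ _ fun i => ?_
  · simpa using h
  · obtain ⟨i, hi⟩ := Finset.card_eq_one.1 I.2
    exact ⟨i, Subtype.ext hi.symm⟩
  · have h : permLength (1 : Equiv.Perm (Fin 1)) = 0 := by decide
    simp [qMinor, qDet, h]

/-- `σ_n` is the quantum determinant. -/
theorem OqM.sigma_self (n : ℕ) (q : ℂ) : OqM.sigma n q n = OqM.det n q := by
  have huniq : ∀ I : {I : Finset (Fin n) // I.card = n}, I = ⟨Finset.univ, by simp⟩ := fun I =>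
    Subtype.ext (Finset.eq_univ_of_card _ (by simpa using I.2))
  have hid : ∀ (h : (Finset.univ : Finset (Fin n)).card = n) (a : Fin n),
      Finset.univ.orderEmbOfFin h a = a := fun h a => by
    have := Finset.orderEmbOfFin_unique (f := id) h (fun _ => Finset.mem_univ _) strictMono_id
    exact (congrFun this a).symm
  rw [OqM.sigma, qSigma, Fintype.sum_eq_single ⟨Finset.univ, by simp⟩
    fun I hI => absurd (huniq I) hI]
  simp only [qMinor, hid]
  rfl

theorem OqGL.mk_det (n : ℕ) (q : ℂ) : OqGL.mk n q (OqM.det n q) =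
    RingQuot.mkAlgHom ℂ (GLRel n q) (freeIncl n (qDet q freeX)) := by
  have h : OqM.det n q = RingQuot.mkAlgHom ℂ (MatRel n q) (qDet q freeX) := by
    rw [map_qDet]; rfl
  rw [h, OqGL.mk, RingQuot.liftAlgHom_mkAlgHom_apply]
  rfl

theorem OqGL.sigma_mul_detInv (n : ℕ) (q : ℂ) : OqGL.sigma n q n * OqGL.detInv n q = 1 := by
  rw [OqGL.sigma, OqM.sigma_self, OqGL.mk_det, OqGL.detInv, ← map_mul,
    RingQuot.mkAlgHom_rel ℂ GLRel.det_mul_inv, map_one]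

theorem OqGL.detInv_mul_sigma (n : ℕ) (q : ℂ) : OqGL.detInv n q * OqGL.sigma n q n = 1 := by
  rw [OqGL.sigma, OqM.sigma_self, OqGL.mk_det, OqGL.detInv, ← map_mul,
    RingQuot.mkAlgHom_rel ℂ GLRel.inv_mul_det, map_one]

/-- `σ_n` as a unit of `O_q(GL_n(ℂ))`. -/
def OqGL.sigmaUnit (n : ℕ) (q : ℂ) : (OqGL n q)ˣ where
  val := OqGL.sigma n q n
  inv := OqGL.detInv n q
  val_inv := OqGL.sigma_mul_detInv n q
  inv_val := OqGL.detInv_mul_sigma n q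

end QuantumMatrices

end

/-! The centralizer in `O_q(M_n)` is pinned down by restriction to the diagonal torus,
`diagRestrict`, which sends `x_{ij}` to `δ_{ij} t_i` and `σ_k` to the elementary symmetric
polynomial `e_k` (`diagRestrict_sigma`). Three facts suffice. The `σ_k` commute with `σ_1`; the
restriction of any element commuting with `σ_1` is symmetric; restriction is injective on the
centralizer of `σ_1`. Given these, write the restriction of `f` as a polynomial in the `e_k`; the
same polynomial in the `σ_k` has the same restriction, hence equals `f`.

Symmetry (`diagRestrict_isSymmetric`). For neighbouring indices `r, s`, let the 2 × 2 block act on a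
q-oscillator Fock space and the remaining diagonal entries by scalars. Up to a scalar the trace acts
by a tridiagonal operator `S` with cyclic vector `e_0`, so `f` acts as a polynomial `P(S)`. Matrix
coefficients, paired with `e_k ↦ x^k`, are polynomials in `q^k`; since `q` is not a root of unity
these have a well-defined value at `0`, which is the restriction of `f` at the point with entries
`θ/x, x`. It therefore equals `P(θ/x + x)` and is unchanged when the two entries are swapped.

Injectivity (`eq_zero_of_diagRestrict_eq_zero`). By induction on the size. Elements of
`O_q(M_{n+1})` have a normal form `∑ b_k x_{00}^k`, with `b_k` in the algebra of the other entries,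
and `x_{00} b = τ(b) x_{00} + D(b)`. Grade the `b_k` by degree in the first row and column: `τ`
scales degree `m` by `q^m` and `D` raises the degree by two. Commutation with the trace then forces
the lowest component to vanish unless its degree is `0`, because `q^m ≠ 1`. The degree `0` part
lives in `O_q(M_n)[x_{00}]`, where the induction hypothesis applies.

Commutation (`IsQMat.commute_trace_qSigma`). Minors are the coefficients of products of linear forms
in a quantum exterior algebra. Moving the matrix `x` past such products gives `U M = M V`, where `U`
and `V` hold the products entry·minor and minor·entry and `M` is an invertible matrix of scalars.
Taking traces gives the claim. For the full minor `M` is scalar, so `det_q` is central.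

The other two algebras are reduced to `O_q(M_n)` through this centrality: for `GL_n` by clearing
denominators, up to `det_q`-torsion; for `SL_n` by lifting an element, splitting it by degree modulo
`n`, and homogenizing each piece with powers of `det_q` (`exists_commute_sum_coeff`). -/

noncomputable section

namespace QuantumMatrices

/-! ### Induction along generators. -/

section Induction

variable {A : Type*} [Ring A] [Algebra ℂ A]

/-- A subspace containing `1` and stable under left multiplication by generators is everything. -/
theorem mem_of_left_mul_mem {s : Set A} (hs : Algebra.adjoin ℂ s = ⊤) (p : Submodule ℂ A)
    (h1 : (1 : A) ∈ p) (hmul : ∀ x ∈ s, ∀ a ∈ p, x * a ∈ p) (a : A) : a ∈ p := by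
  let S : Subalgebra ℂ A :=
    { carrier := {a | ∀ b ∈ p, a * b ∈ p}
      mul_mem' := fun {x y} hx hy b hb => by rw [mul_assoc]; exact hx _ (hy _ hb)
      add_mem' := fun {x y} hx hy b hb => by rw [add_mul]; exact p.add_mem (hx _ hb) (hy _ hb)
      algebraMap_mem' := fun c b hb => by
        rw [← Algebra.smul_def]; exact p.smul_mem _ hb }
  have hS : Algebra.adjoin ℂ s ≤ S := Algebra.adjoin_le fun x hx => hmul x hx
  have : a ∈ S := hS (hs ▸ Algebra.mem_top)
  simpa using this 1 h1

/-- A subspace containing `1` and stable under right multiplication by generators is everything. -/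
theorem mem_of_right_mul_mem {s : Set A} (hs : Algebra.adjoin ℂ s = ⊤) (p : Submodule ℂ A)
    (h1 : (1 : A) ∈ p) (hmul : ∀ x ∈ s, ∀ a ∈ p, a * x ∈ p) (a : A) : a ∈ p := by
  let S : Subalgebra ℂ A :=
    { carrier := {a | ∀ b ∈ p, b * a ∈ p}
      mul_mem' := fun {x y} hx hy b hb => by rw [← mul_assoc]; exact hy _ (hx _ hb)
      add_mem' := fun {x y} hx hy b hb => by rw [mul_add]; exact p.add_mem (hx _ hb) (hy _ hb)
      algebraMap_mem' := fun c b hb => by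
        rw [← Algebra.commutes, ← Algebra.smul_def]; exact p.smul_mem _ hb }
  have hS : Algebra.adjoin ℂ s ≤ S := Algebra.adjoin_le fun x hx => hmul x hx
  have : a ∈ S := hS (hs ▸ Algebra.mem_top)
  simpa using this 1 h1

/-- A quotient of a free algebra is generated by the classes of the letters. -/
theorem adjoin_ringQuot_eq_top {X : Type*} (r : FreeAlgebra ℂ X → FreeAlgebra ℂ X → Prop) :
    Algebra.adjoin ℂ (Set.range fun p => RingQuot.mkAlgHom ℂ r (FreeAlgebra.ι ℂ p)) = ⊤ := by
  have h : (Set.range fun p => RingQuot.mkAlgHom ℂ r (FreeAlgebra.ι ℂ p)) =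
      RingQuot.mkAlgHom ℂ r '' Set.range (FreeAlgebra.ι ℂ) := by
    rw [← Set.range_comp]; rfl
  rw [h, ← AlgHom.map_adjoin, FreeAlgebra.adjoin_range_ι, Algebra.map_top, AlgHom.range_eq_top]
  exact RingQuot.mkAlgHom_surjective _ _

end Induction

/-! ### Quantum matrices, the diagonal torus and embedded 2 × 2 blocks. -/

/-- The entries of `x` satisfy the relations of quantum matrices. -/
structure IsQMat (q : ℂ) {n : ℕ} {A : Type*} [Ring A] [Algebra ℂ A] (x : Fin n → Fin n → A) :
    Prop where
  diag : ∀ {i j k l : Fin n}, i < k → j < l →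
    x i j * x k l = x k l * x i j + (q - q⁻¹) • (x i l * x k j)
  row : ∀ {i j l : Fin n}, j < l → x i j * x i l = q • (x i l * x i j)
  col : ∀ {i j k : Fin n}, i < k → x i j * x k j = q • (x k j * x i j)
  anti : ∀ {i j k l : Fin n}, i < k → l < j → x i j * x k l = x k l * x i j

namespace OqM

variable {n : ℕ} {q : ℂ} {A : Type*} [Ring A] [Algebra ℂ A]

theorem isQMat (n : ℕ) (q : ℂ) : IsQMat q (OqM.x (n := n) q) where
  diag h₁ h₂ := by
    simpa [OqM.x] using RingQuot.mkAlgHom_rel ℂ (MatRel.diag (q := q) h₁ h₂)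
  row h := by simpa [OqM.x] using RingQuot.mkAlgHom_rel ℂ (MatRel.row (q := q) h)
  col h := by simpa [OqM.x] using RingQuot.mkAlgHom_rel ℂ (MatRel.col (q := q) h)
  anti h₁ h₂ := by
    simpa [OqM.x] using RingQuot.mkAlgHom_rel ℂ (MatRel.anti (q := q) h₁ h₂)

/-- The universal property of `O_q(M_n)`. -/
def lift (y : Fin n → Fin n → A) (h : IsQMat q y) : OqM n q →ₐ[ℂ] A :=
  RingQuot.liftAlgHom ℂ ⟨FreeAlgebra.lift ℂ fun p => y p.1 p.2, fun a b hab => by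
    cases hab with
    | diag h₁ h₂ => simpa [freeX] using h.diag h₁ h₂
    | row h₁ => simpa [freeX] using h.row h₁
    | col h₁ => simpa [freeX] using h.col h₁
    | anti h₁ h₂ => simpa [freeX] using h.anti h₁ h₂⟩

@[simp]
theorem lift_x (y : Fin n → Fin n → A) (h : IsQMat q y) (i j : Fin n) :
    lift y h (OqM.x q i j) = y i j := by
  simp [lift, OqM.x, freeX, RingQuot.liftAlgHom_mkAlgHom_apply]

theorem adjoin_x_eq_top (n : ℕ) (q : ℂ) :
    Algebra.adjoin ℂ (Set.range fun p : Fin n × Fin n => OqM.x q p.1 p.2) = ⊤ :=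
  adjoin_ringQuot_eq_top _

theorem algHom_ext {f g : OqM n q →ₐ[ℂ] A} (h : ∀ i j, f (OqM.x q i j) = g (OqM.x q i j)) :
    f = g := by
  refine AlgHom.ext_of_adjoin_eq_top (adjoin_x_eq_top n q) ?_
  rintro _ ⟨p, rfl⟩
  exact h _ _

end OqM

/-- A diagonal matrix with commuting entries is a quantum matrix. -/
theorem isQMat_diagonal (q : ℂ) {n : ℕ} {A : Type*} [CommRing A] [Algebra ℂ A] (t : Fin n → A) :
    IsQMat q fun i j => if i = j then t i else 0 where
  diag {i j k l} h₁ h₂ := by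
    have : ¬ (i = l ∧ k = j) := by rintro ⟨rfl, rfl⟩; exact lt_asymm h₁ h₂
    have h3 : (if i = l then t i else 0) * (if k = j then t k else 0) = 0 := by
      grind
    rw [h3, mul_comm, smul_zero, add_zero]
  row {i j l} h := by
    have : ¬ (i = l ∧ i = j) := by rintro ⟨rfl, rfl⟩; exact lt_irrefl _ h
    have h3 : (if i = l then t i else 0) * (if i = j then t i else 0) = 0 := by
      grind
    rw [mul_comm, h3, smul_zero]
  col {i j k} h := by
    have : ¬ (i = j ∧ k = j) := by rintro ⟨rfl, rfl⟩; exact lt_irrefl _ h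
    have h3 : (if k = j then t k else 0) * (if i = j then t i else 0) = 0 := by
      grind
    rw [mul_comm, h3, smul_zero]
  anti _ _ := mul_comm _ _

/-- Restriction to the diagonal torus: `x_{i,j} ↦ δ_{i,j} t_i`. -/
def diagRestrict (n : ℕ) (q : ℂ) : OqM n q →ₐ[ℂ] MvPolynomial (Fin n) ℂ :=
  OqM.lift _ (isQMat_diagonal q MvPolynomial.X)

@[simp]
theorem diagRestrict_x {n : ℕ} (q : ℂ) (i j : Fin n) :
    diagRestrict n q (OqM.x q i j) = if i = j then MvPolynomial.X i else 0 := by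
  simp [diagRestrict]

/-- The matrix with the `2 × 2` block `(a, b; c, d)` in rows and columns `r, s` and central
entries `t i` elsewhere on the diagonal. -/
def blockMat {n : ℕ} {A : Type*} [Ring A] [Algebra ℂ A] (r s : Fin n) (t : Fin n → ℂ)
    (a b c d : A) (i j : Fin n) : A :=
  if i = r ∧ j = r then a else if i = r ∧ j = s then b else if i = s ∧ j = r then c
  else if i = s ∧ j = s then d else if i = j then algebraMap ℂ A (t i) else 0

/-- Adjacency of `r` and `s` is essential: for an index `m` strictly between them, the relation
between `x_{rm} = 0` and `x_{ms} = 0` would demand `(q - q⁻¹) t_m b = 0`. -/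
theorem isQMat_blockMat (q : ℂ) {n : ℕ} {A : Type*} [Ring A] [Algebra ℂ A] {r s : Fin n}
    (hrs : r.val + 1 = s.val) (t : Fin n → ℂ) {a b c d : A} (hab : a * b = q • (b * a))
    (hac : a * c = q • (c * a)) (hbd : b * d = q • (d * b)) (hcd : c * d = q • (d * c))
    (hbc : b * c = c * b) (had : a * d = d * a + (q - q⁻¹) • (b * c)) :
    IsQMat q (blockMat r s t a b c d) := by
  have hne : r ≠ s := by rintro rfl; omega
  have hrr : blockMat r s t a b c d r r = a := by simp [blockMat]
  have hrs' : blockMat r s t a b c d r s = b := by simp [blockMat, hne.symm]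
  have hsr : blockMat r s t a b c d s r = c := by simp [blockMat, hne, hne.symm]
  have hss : blockMat r s t a b c d s s = d := by simp [blockMat, hne.symm]
  have key : ∀ i j, ((i = r ∨ i = s) ∧ (j = r ∨ j = s)) ∨
      (i = j ∧ blockMat r s t a b c d i j = algebraMap ℂ A (t i)) ∨
      (i ≠ j ∧ blockMat r s t a b c d i j = 0) := by
    intro i j
    by_cases hb : (i = r ∨ i = s) ∧ (j = r ∨ j = s)
    · exact Or.inl hb
    · have h1 : ¬ (i = r ∧ j = r) := by grind
      have h2 : ¬ (i = r ∧ j = s) := by grind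
      have h3 : ¬ (i = s ∧ j = r) := by grind
      have h4 : ¬ (i = s ∧ j = s) := by grind
      by_cases hij : i = j
      · exact Or.inr (Or.inl ⟨hij, by
          rw [blockMat, if_neg h1, if_neg h2, if_neg h3, if_neg h4, if_pos hij]⟩)
      · exact Or.inr (Or.inr ⟨hij, by
          rw [blockMat, if_neg h1, if_neg h2, if_neg h3, if_neg h4, if_neg hij]⟩)
  have comm : ∀ i j k l, ¬ ((i = r ∨ i = s) ∧ (j = r ∨ j = s) ∧ (k = r ∨ k = s) ∧
      (l = r ∨ l = s)) → blockMat r s t a b c d i j * blockMat r s t a b c d k l =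
        blockMat r s t a b c d k l * blockMat r s t a b c d i j := by
    intro i j k l hn
    rcases key i j with h | ⟨-, h⟩ | ⟨-, h⟩
    · rcases key k l with h' | ⟨-, h'⟩ | ⟨-, h'⟩
      · exact absurd ⟨h.1, h.2, h'.1, h'.2⟩ hn
      · rw [h', Algebra.commutes]
      · rw [h', mul_zero, zero_mul]
    · rw [h, Algebra.commutes]
    · rw [h, mul_zero, zero_mul]
  constructor
  · intro i j k l h₁ h₂
    by_cases hb : (i = r ∨ i = s) ∧ (j = r ∨ j = s) ∧ (k = r ∨ k = s) ∧ (l = r ∨ l = s)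
    · obtain ⟨rfl, rfl, rfl, rfl⟩ : i = r ∧ j = r ∧ k = s ∧ l = s := by omega
      rw [hrr, hss, hrs', hsr, had]
    · rw [comm i j k l hb]
      have : blockMat r s t a b c d i l * blockMat r s t a b c d k j = 0 := by
        rcases key i l with h | ⟨e, -⟩ | ⟨-, h⟩
        · rcases key k j with h' | ⟨e', -⟩ | ⟨-, h'⟩
          · exact absurd ⟨h.1, h'.2, h'.1, h.2⟩ hb
          · exfalso; omega
          · rw [h', mul_zero]
        · rcases key k j with h' | ⟨e', -⟩ | ⟨-, h'⟩
          · exfalso; omega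
          · exfalso; omega
          · rw [h', mul_zero]
        · rw [h, zero_mul]
      rw [this, smul_zero, add_zero]
  · intro i j l h₁
    by_cases hb : (i = r ∨ i = s) ∧ (j = r ∨ j = s) ∧ (i = r ∨ i = s) ∧ (l = r ∨ l = s)
    · obtain ⟨rfl, rfl⟩ : j = r ∧ l = s := by omega
      rcases hb.1 with rfl | rfl
      · rw [hrr, hrs', hab]
      · rw [hsr, hss, hcd]
    · rcases key i j with h | ⟨e, -⟩ | ⟨-, h⟩
      · rcases key i l with h' | ⟨e', -⟩ | ⟨-, h'⟩
        · exact absurd ⟨h.1, h.2, h'.1, h'.2⟩ hb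
        · exfalso; omega
        · rw [h', mul_zero, zero_mul, smul_zero]
      · rcases key i l with h' | ⟨e', -⟩ | ⟨-, h'⟩
        · exfalso; omega
        · exfalso; omega
        · rw [h', mul_zero, zero_mul, smul_zero]
      · rw [h, mul_zero, zero_mul, smul_zero]
  · intro i j k h₁
    by_cases hb : (i = r ∨ i = s) ∧ (j = r ∨ j = s) ∧ (k = r ∨ k = s) ∧ (j = r ∨ j = s)
    · obtain ⟨rfl, rfl⟩ : i = r ∧ k = s := by omega
      rcases hb.2.1 with rfl | rfl
      · rw [hrr, hsr, hac]
      · rw [hrs', hss, hbd]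
    · rcases key i j with h | ⟨e, -⟩ | ⟨-, h⟩
      · rcases key k j with h' | ⟨e', -⟩ | ⟨-, h'⟩
        · exact absurd ⟨h.1, h.2, h'.1, h'.2⟩ hb
        · exfalso; omega
        · rw [h', mul_zero, zero_mul, smul_zero]
      · rcases key k j with h' | ⟨e', -⟩ | ⟨-, h'⟩
        · exfalso; omega
        · exfalso; omega
        · rw [h', mul_zero, zero_mul, smul_zero]
      · rw [h, mul_zero, zero_mul, smul_zero]
  · intro i j k l h₁ h₂
    by_cases hb : (i = r ∨ i = s) ∧ (j = r ∨ j = s) ∧ (k = r ∨ k = s) ∧ (l = r ∨ l = s)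
    · obtain ⟨rfl, rfl, rfl, rfl⟩ : i = r ∧ j = s ∧ k = s ∧ l = r := by omega
      rw [hrs', hsr, hbc]
    · exact comm i j k l hb

/-! ### The Fock representations and symmetry of the diagonal restriction. -/

section Fock

/-- The raising operator `e_k ↦ e_{k+1}`. -/
def fockRaise : Module.End ℂ (ℕ →₀ ℂ) :=
  Finsupp.linearCombination ℂ fun k => Finsupp.single (k + 1) 1

/-- The lowering operator `e_k ↦ θ (1 - q^{2k}) e_{k-1}`. -/
def fockLower (q θ : ℂ) : Module.End ℂ (ℕ →₀ ℂ) :=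
  Finsupp.linearCombination ℂ fun k => (θ * (1 - q ^ (2 * k))) • Finsupp.single (k - 1) 1

/-- The diagonal operator `e_k ↦ c q^k e_k`. -/
def fockDiag (q c : ℂ) : Module.End ℂ (ℕ →₀ ℂ) :=
  Finsupp.linearCombination ℂ fun k => (c * q ^ k) • Finsupp.single k 1

@[simp]
theorem fockRaise_single (k : ℕ) :
    fockRaise (Finsupp.single k 1) = Finsupp.single (k + 1) 1 := by
  simp [fockRaise]

@[simp]
theorem fockLower_single (q θ : ℂ) (k : ℕ) : fockLower q θ (Finsupp.single k 1) =
    (θ * (1 - q ^ (2 * k))) • Finsupp.single (k - 1) 1 := by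
  simp [fockLower]

@[simp]
theorem fockDiag_single (q c : ℂ) (k : ℕ) :
    fockDiag q c (Finsupp.single k 1) = (c * q ^ k) • Finsupp.single k 1 := by
  simp [fockDiag]

theorem fock_ext {S T : Module.End ℂ (ℕ →₀ ℂ)}
    (h : ∀ k, S (Finsupp.single k 1) = T (Finsupp.single k 1)) : S = T :=
  Finsupp.lhom_ext' fun k => LinearMap.ext_ring (h k)

/-- The q-oscillator representation of `O_q(M_2)`. The factor `-qθ` is dictated by `ad - da = (q -
q⁻¹) bc`; the parameter `θ` is the scalar by which the block determinant `ad - q bc` acts. -/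
theorem isQMat_fock {q : ℂ} (hq₀ : q ≠ 0) {n : ℕ} {r s : Fin n} (hrs : r.val + 1 = s.val)
    (t : Fin n → ℂ) (θ : ℂ) : IsQMat q
      (blockMat r s t (fockLower q θ) (fockDiag q (-q * θ)) (fockDiag q 1) fockRaise) := by
  have hlow : ∀ c, fockLower q θ * fockDiag q c = q • (fockDiag q c * fockLower q θ) := fun c =>
    fock_ext fun k => by
      simp only [Module.End.mul_apply, LinearMap.smul_apply, fockLower_single, fockDiag_single,
        map_smul, smul_smul]
      congr 1
      cases k with
      | zero => simp
      | succ k => rw [Nat.add_sub_cancel]; ring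
  have hraise : ∀ c, fockDiag q c * fockRaise = q • (fockRaise * fockDiag q c) := fun c =>
    fock_ext fun k => by
      simp only [Module.End.mul_apply, LinearMap.smul_apply, fockRaise_single, fockDiag_single,
        map_smul, smul_smul]
      congr 1
      ring
  refine isQMat_blockMat q hrs t (hlow _) (hlow _) (hraise _) (hraise _) ?_ ?_
  · refine fock_ext fun k => ?_
    simp only [Module.End.mul_apply, fockDiag_single, map_smul, smul_smul]
    congr 1
    ring
  · refine fock_ext fun k => ?_
    simp only [Module.End.mul_apply, LinearMap.smul_apply, LinearMap.add_apply, fockLower_single,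
      fockRaise_single, fockDiag_single, map_smul, smul_smul, Nat.add_sub_cancel]
    cases k with
    | zero =>
      simp only [mul_zero, pow_zero, sub_self, zero_smul, zero_add]
      congr 1
      field_simp
      ring
    | succ k =>
      rw [Nat.add_sub_cancel, ← add_smul]
      congr 1
      field_simp
      ring

/-- The action of `O_q(M_n)` on the Fock space attached to two neighbouring indices. -/
def fockRep {q : ℂ} (hq₀ : q ≠ 0) {n : ℕ} {r s : Fin n} (hrs : r.val + 1 = s.val)
    (t : Fin n → ℂ) (θ : ℂ) : OqM n q →ₐ[ℂ] Module.End ℂ (ℕ →₀ ℂ) :=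
  OqM.lift _ (isQMat_fock hq₀ hrs t θ)

/-- The operator is tridiagonal with ones below the diagonal, so it produces `e_{k+1}` from `e_k` up
to vectors already reached. -/
theorem fock_cyclic (q θ : ℂ) (w : ℕ →₀ ℂ) : ∃ P : Polynomial ℂ,
    Polynomial.aeval (fockLower q θ + fockRaise) P (Finsupp.single 0 1) = w := by
  let ev : Polynomial ℂ →ₗ[ℂ] (ℕ →₀ ℂ) :=
    (LinearMap.applyₗ (Finsupp.single 0 1)).comp
      (Polynomial.aeval (fockLower q θ + fockRaise)).toLinearMap
  have hmul : ∀ w ∈ LinearMap.range ev, (fockLower q θ + fockRaise) w ∈ LinearMap.range ev := by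
    rintro _ ⟨P, rfl⟩
    refine ⟨Polynomial.X * P, ?_⟩
    simp [ev]
  have hb : ∀ k, Finsupp.single k (1 : ℂ) ∈ LinearMap.range ev := by
    intro k
    induction k using Nat.strong_induction_on with
    | _ k ih =>
      cases k with
      | zero => exact ⟨1, by simp [ev]⟩
      | succ k =>
        have h1 := hmul _ (ih k (Nat.lt_succ_self k))
        -- For `k = 0` the truncated index `k - 1` is harmless, since its coefficient `1 - q^0`
        -- vanishes.
        have h2 : (θ * (1 - q ^ (2 * k))) • Finsupp.single (k - 1) (1 : ℂ) ∈
            LinearMap.range ev :=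
          Submodule.smul_mem _ _ (ih (k - 1) (by omega))
        have h3 := Submodule.sub_mem _ h1 h2
        simpa using h3
  have : w ∈ LinearMap.range ev := by
    induction w using Finsupp.induction_linear with
    | zero => exact Submodule.zero_mem _
    | add f g hf hg => exact Submodule.add_mem _ hf hg
    | single k c =>
      have := Submodule.smul_mem _ c (hb k)
      simpa using this
  obtain ⟨P, hP⟩ := this
  exact ⟨P, hP⟩

variable {q : ℂ} (hq₀ : q ≠ 0) {n : ℕ} {r s : Fin n} (hrs : r.val + 1 = s.val) (t : Fin n → ℂ)

/-- The point `(…, θ/x, x, …)` with `θ/x` and `x` at positions `r` and `s`. -/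
def fockPoint (r s : Fin n) (t : Fin n → ℂ) (θ x : ℂ) (i : Fin n) : ℂ :=
  if i = r then θ / x else if i = s then x else t i

theorem sum_two_ite {M : Type*} [AddCommMonoid M] {r s : Fin n} (hne : r ≠ s) (u v : M)
    (h : Fin n → M) : ∑ i, (if i = r then u else if i = s then v else h i) =
      u + v + ∑ i, (if i = r ∨ i = s then 0 else h i) := by
  have : ∀ i, (if i = r then u else if i = s then v else h i) =
      (if i = r then u else 0) + (if i = s then v else 0) +
        (if i = r ∨ i = s then 0 else h i) := by
    intro i
    by_cases h1 : i = r
    · have : i ≠ s := fun h2 => hne (h1.symm.trans h2)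
      simp [h1, hne]
    · by_cases h2 : i = s <;> simp [h1, h2, hne.symm]
  simp_rw [this, Finset.sum_add_distrib]
  simp

/-- The matrix coefficients of `f` on the Fock space are polynomials in `q^k` whose value at `0`
is given by the restriction of `f` to the diagonal. -/
theorem fockRep_symbol (θ : ℂ) {x : ℂ} (hx : x ≠ 0) (f : OqM n q) : ∃ Q : Polynomial ℂ,
    Q.eval 0 = MvPolynomial.eval (fockPoint r s t θ x) (diagRestrict n q f) ∧
    ∀ k : ℕ, Finsupp.linearCombination ℂ (fun k => x ^ k)
      (fockRep hq₀ hrs t θ f (Finsupp.single k 1)) = x ^ k * Q.eval (q ^ k) := by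
  have hne : r ≠ s := by rintro rfl; omega
  let p : Submodule ℂ (OqM n q) :=
    { carrier := {f | ∃ Q : Polynomial ℂ,
        Q.eval 0 = MvPolynomial.eval (fockPoint r s t θ x) (diagRestrict n q f) ∧
        ∀ k : ℕ, Finsupp.linearCombination ℂ (fun k => x ^ k)
          (fockRep hq₀ hrs t θ f (Finsupp.single k 1)) = x ^ k * Q.eval (q ^ k)}
      zero_mem' := ⟨0, by simp, by simp⟩
      add_mem' := by
        rintro f g ⟨Q, h1, h2⟩ ⟨R, h3, h4⟩
        exact ⟨Q + R, by simp [h1, h3], fun k => by simp [h2, h4, mul_add]⟩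
      smul_mem' := by
        rintro c f ⟨Q, h1, h2⟩
        refine ⟨c • Q, by simp [h1, MvPolynomial.smul_eval], fun k => ?_⟩
        simp [h2]
        ring }
  -- Right multiplication lets the new generator act first, on a basis vector; the known symbol of
  -- `f` is then evaluated at `k`, `k + 1` or `k - 1`.
  refine mem_of_right_mul_mem (OqM.adjoin_x_eq_top n q) p ⟨1, by simp, fun k => by simp⟩ ?_ f
  rintro _ ⟨⟨i, j⟩, rfl⟩ f ⟨Q, h1, h2⟩
  have hx' : fockRep hq₀ hrs t θ (OqM.x q i j) = blockMat r s t (fockLower q θ)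
    (fockDiag q (-q * θ)) (fockDiag q 1) fockRaise i j := OqM.lift_x _ _ _ _
  simp only [p, Submodule.mem_mk, AddSubmonoid.mem_mk, AddSubsemigroup.mem_mk, Set.mem_ofPred_eq,
    map_mul, diagRestrict_x, hx', ← h1, Module.End.mul_apply]
  by_cases hrr : i = r ∧ j = r
  · obtain ⟨rfl, rfl⟩ := hrr
    -- Lowering `k` substitutes `q⁻¹ X` for `X`. The factor `1 - X²` vanishes at `q^0`, which covers
    -- the missing `e_{-1}`; at `X = 0` only `θ/x` survives.
    refine ⟨Polynomial.C (θ / x) * (1 - Polynomial.X ^ 2) *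
      Q.comp (Polynomial.C q⁻¹ * Polynomial.X), by simp [fockPoint]; ring, fun k => ?_⟩
    simp only [blockMat, and_self, if_true, fockLower_single, map_smul, h2]
    cases k with
    | zero => simp
    | succ k =>
      have : q⁻¹ * q ^ (k + 1) = q ^ k := by rw [pow_succ']; field_simp
      simp [this]
      field_simp
      ring
  by_cases hrs' : i = r ∧ j = s
  · obtain ⟨rfl, rfl⟩ := hrs'
    -- The off-diagonal entries contribute a factor `X`, so their symbols vanish at `0`, as their
    -- diagonal restrictions do.
    refine ⟨Polynomial.C (-q * θ) * Polynomial.X * Q, by simp [hne], fun k => ?_⟩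
    simp only [blockMat, hne.symm, and_false, if_true, if_false, and_self, fockDiag_single,
      map_smul, h2]
    simp
    ring
  by_cases hsr : i = s ∧ j = r
  · obtain ⟨rfl, rfl⟩ := hsr
    refine ⟨Polynomial.X * Q, by simp [hne.symm], fun k => ?_⟩
    simp only [blockMat, hne.symm, hne, false_and, if_true, if_false, and_self, fockDiag_single,
      map_smul, h2]
    simp
    ring
  by_cases hss : i = s ∧ j = s
  · obtain ⟨rfl, rfl⟩ := hss
    refine ⟨Polynomial.C x * Q.comp (Polynomial.C q * Polynomial.X),
      by simp [fockPoint, hne.symm]; ring, fun k => ?_⟩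
    simp only [blockMat, hne.symm, false_and, and_false, if_true, if_false, and_self,
      fockRaise_single, h2]
    simp
    ring_nf
  by_cases hij : i = j
  · subst hij
    have h3 : i ≠ r := fun h => hrr ⟨h, h⟩
    have h4 : i ≠ s := fun h => hss ⟨h, h⟩
    refine ⟨Polynomial.C (t i) * Q, by simp [fockPoint, h3, h4]; ring, fun k => ?_⟩
    have hb : blockMat r s t (fockLower q θ) (fockDiag q (-q * θ)) (fockDiag q 1) fockRaise i i =
        algebraMap ℂ _ (t i) := by simp [blockMat, h3, h4]
    simp only [hb, Module.algebraMap_end_apply, map_smul, h2, smul_eq_mul, Polynomial.eval_mul,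
      Polynomial.eval_C]
    ring
  · refine ⟨0, by simp [hij], fun k => ?_⟩
    simp [blockMat, hrr, hrs', hsr, hss, hij]

/-- On a space with a cyclic vector for `S`, an operator commuting with `S` is a polynomial `P(S)`.
Comparing symbols at `0` transfers this to the diagonal, where `S` restricts to `θ/x + x`. -/
theorem eval_fockPoint_of_commute (hq₀ : q ≠ 0) (hrs : r.val + 1 = s.val) (t : Fin n → ℂ)
    (hq : ∀ m : ℕ, 1 ≤ m → q ^ m ≠ 1) {f : OqM n q}
    (hf : Commute f (OqM.sigma n q 1)) (θ : ℂ) : ∃ P : Polynomial ℂ, ∀ x : ℂ, x ≠ 0 →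
      MvPolynomial.eval (fockPoint r s t θ x) (diagRestrict n q f) = P.eval (θ / x + x) := by
  have hne : r ≠ s := by rintro rfl; omega
  -- The scalar contribution of the indices outside the block; removing it leaves lowering plus
  -- raising.
  set c : ℂ := ∑ i, (if i = r ∨ i = s then 0 else t i) with hc
  set S : OqM n q := OqM.sigma n q 1 - algebraMap ℂ _ c with hS
  set ρ := fockRep hq₀ hrs t θ with hρ
  have hρS : ρ S = fockLower q θ + fockRaise := by
    have hx' : ∀ i, ρ (OqM.x q i i) = if i = r then fockLower q θ else if i = s then
        fockRaise else algebraMap ℂ _ (t i) := by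
      intro i
      rw [hρ, fockRep, OqM.lift_x]
      by_cases h1 : i = r
      · simp [h1, blockMat]
      · by_cases h2 : i = s <;> simp [h1, h2, blockMat, hne.symm]
    have hcmap : algebraMap ℂ (Module.End ℂ (ℕ →₀ ℂ)) c =
        ∑ i, if i = r ∨ i = s then 0 else algebraMap ℂ _ (t i) := by
      rw [hc, map_sum]
      exact Finset.sum_congr rfl fun i _ => by split_ifs <;> simp
    rw [hS, map_sub, OqM.sigma_one, map_sum, Finset.sum_congr rfl fun i _ => hx' i,
      sum_two_ite hne, AlgHom.commutes, hcmap]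
    exact add_sub_cancel_right (fockLower q θ + fockRaise) _
  obtain ⟨P, hP⟩ := fock_cyclic q θ (ρ f (Finsupp.single 0 1))
  have hfS : Commute f S := hf.sub_right (Algebra.commute_algebraMap_right _ _)
  have hae : ∀ R : Polynomial ℂ, ρ (Polynomial.aeval S R) =
      Polynomial.aeval (fockLower q θ + fockRaise) R := fun R => by
    rw [← hρS, Polynomial.aeval_algHom_apply]
  -- `P` is chosen so that both operators agree on `e_0`; both commute with polynomials in `S`, and
  -- these carry `e_0` to every vector.
  have hact : ∀ w, ρ f w = ρ (Polynomial.aeval S P) w := by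
    intro w
    obtain ⟨R, rfl⟩ := fock_cyclic q θ w
    have h1 : Commute f (Polynomial.aeval S R) := by
      have hle : Algebra.adjoin ℂ {S} ≤ Subalgebra.centralizer ℂ {f} := by
        refine Algebra.adjoin_le ?_
        rintro _ rfl _ rfl
        exact hfS
      exact hle (Polynomial.aeval_mem_adjoin_singleton ℂ S) f rfl
    rw [← hae, ← Module.End.mul_apply, ← map_mul, h1.eq, map_mul, Module.End.mul_apply, ← hP,
      ← hae, ← Module.End.mul_apply, ← Module.End.mul_apply, ← map_mul, ← map_mul, ← map_mul,
      ← map_mul, mul_comm]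
  refine ⟨P, fun x hx => ?_⟩
  obtain ⟨Q, h1, h2⟩ := fockRep_symbol hq₀ hrs t θ hx f
  obtain ⟨Q', h1', h2'⟩ := fockRep_symbol hq₀ hrs t θ hx (Polynomial.aeval S P)
  -- The two polynomials agree at all `q^k`, which are pairwise distinct since `q` is not a root of
  -- unity.
  have hQ : Q = Q' := by
    refine Polynomial.eq_of_infinite_eval_eq _ _ (Set.Infinite.mono ?_
      (Set.infinite_range_of_injective (f := fun k : ℕ => q ^ k) ?_))
    · rintro _ ⟨k, rfl⟩
      have h3 := h2 k
      rw [← hρ, hact, hρ, h2'] at h3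
      exact (mul_left_cancel₀ (pow_ne_zero k hx) h3).symm
    · intro a b hab
      by_contra hne'
      wlog hlt : a < b generalizing a b
      · exact this hab.symm (Ne.symm hne') (by omega)
      · refine hq (b - a) (by omega) ?_
        have : q ^ a * q ^ (b - a) = q ^ a * 1 := by
          rw [← pow_add, mul_one, Nat.add_sub_cancel' hlt.le]; exact hab.symm
        exact mul_left_cancel₀ (pow_ne_zero a hq₀) this
  have hδ : MvPolynomial.eval (fockPoint r s t θ x) (diagRestrict n q S) = θ / x + x := by
    rw [hS, map_sub, OqM.sigma_one, map_sum, AlgHom.commutes, map_sub, map_sum]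
    simp only [diagRestrict_x, if_true, MvPolynomial.eval_X, fockPoint]
    rw [sum_two_ite hne, ← hc, MvPolynomial.algebraMap_eq, MvPolynomial.eval_C]
    ring
  rw [← h1, hQ, h1', ← hδ, ← Polynomial.aeval_algHom_apply, ← MvPolynomial.coe_aeval_eq_eval]
  simp only [RingHom.coe_coe]
  rw [← Polynomial.aeval_algHom_apply, Polynomial.coe_aeval_eq_eval]

end Fock

/-- The restriction to the diagonal of an element commuting with the trace is symmetric. -/
theorem diagRestrict_isSymmetric {q : ℂ} (hq₀ : q ≠ 0) (hq : ∀ m : ℕ, 1 ≤ m → q ^ m ≠ 1) {n : ℕ}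
    {f : OqM n q} (hf : Commute f (OqM.sigma n q 1)) :
    (diagRestrict n q f).IsSymmetric := by
  set p := diagRestrict n q f with hp
  have hadj : ∀ r s : Fin n, r.val + 1 = s.val →
      MvPolynomial.rename (Equiv.swap r s) p = p := by
    intro r s hrs
    have hne : r ≠ s := by rintro rfl; omega
    -- Multiplying by all the variables reduces the identity to points with nonzero coordinates,
    -- where `θ/x` makes sense.
    have hprod : (∏ i, MvPolynomial.X i : MvPolynomial (Fin n) ℂ) ≠ 0 :=
      Finset.prod_ne_zero_iff.2 fun i _ => MvPolynomial.X_ne_zero i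
    refine mul_left_cancel₀ hprod (MvPolynomial.funext fun t => ?_)
    simp only [map_mul, map_prod, MvPolynomial.eval_X, MvPolynomial.eval_rename]
    by_cases ht : ∏ i, t i = 0
    · simp [ht]
    have ht' : ∀ i, t i ≠ 0 := fun i => Finset.prod_ne_zero_iff.1 ht i (Finset.mem_univ i)
    congr 1
    -- With `θ = t_r t_s`, the choices `x = t_s` and `x = t_r` give `t` and its transposed point,
    -- and `θ/x + x` is `t_r + t_s` for both.
    obtain ⟨P, hP⟩ := eval_fockPoint_of_commute hq₀ hrs t hq hf (t r * t s)
    have e1 : fockPoint r s t (t r * t s) (t s) = t := by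
      funext i
      by_cases h1 : i = r
      · simp [fockPoint, h1, ht']
      · by_cases h2 : i = s <;> simp [fockPoint, h1, h2, hne.symm]
    have e2 : fockPoint r s t (t r * t s) (t r) = t ∘ Equiv.swap r s := by
      funext i
      by_cases h1 : i = r
      · simp [fockPoint, h1, ht']
      · by_cases h2 : i = s
        · simp [fockPoint, h2, hne.symm]
        · simp [fockPoint, h1, h2, Equiv.swap_apply_of_ne_of_ne h1 h2]
    have h1 := hP (t s) (ht' s)
    have h2 := hP (t r) (ht' r)
    rw [e1] at h1
    rw [e2] at h2
    rw [h2, h1]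
    congr 1
    field_simp [ht']
    ring
  cases n with
  | zero => exact fun e => by rw [Subsingleton.elim e (Equiv.refl _)]; simp
  | succ m =>
    intro e
    have he : e ∈ Submonoid.closure (Set.range fun i : Fin m => Equiv.swap i.castSucc i.succ) := by
      rw [Equiv.Perm.mclosure_swap_castSucc_succ]; trivial
    induction he using Submonoid.closure_induction with
    | mem _ h =>
      obtain ⟨i, rfl⟩ := h
      exact hadj _ _ (by simp)
    | one => simp
    | mul a b _ _ ha hb =>
      rw [Equiv.Perm.coe_mul, ← MvPolynomial.rename_rename, hb, ha]

/-! ### Bordered matrices and the skew derivation. -/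

/-- The relations among the entries of an `(n+1) × (n+1)` quantum matrix other than the upper left
one: `v` is the rest of the first row, `u` the rest of the first column, `Y` the other entries. -/
structure IsBordered (q : ℂ) {n : ℕ} {A : Type*} [Ring A] [Algebra ℂ A] (v u : Fin n → A)
    (Y : Fin n → Fin n → A) : Prop where
  mat : IsQMat q Y
  vv : ∀ {j l}, j < l → v j * v l = q • (v l * v j)
  uu : ∀ {i k}, i < k → u i * u k = q • (u k * u i)
  vu : ∀ j i, v j * u i = u i * v j
  vY_lt : ∀ {j l} (k), j < l → v j * Y k l = Y k l * v j + (q - q⁻¹) • (v l * Y k j)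
  vY_eq : ∀ j k, v j * Y k j = q • (Y k j * v j)
  vY_gt : ∀ {j l} (k), l < j → v j * Y k l = Y k l * v j
  uY_lt : ∀ {i k} (l), i < k → u i * Y k l = Y k l * u i + (q - q⁻¹) • (Y i l * u k)
  uY_eq : ∀ i l, u i * Y i l = q • (Y i l * u i)
  uY_gt : ∀ {i k} (l), k < i → u i * Y k l = Y k l * u i

section Bordered

variable {q : ℂ} {n : ℕ} {A : Type*} [Ring A] [Algebra ℂ A]

theorem IsQMat.map {x : Fin n → Fin n → A} (h : IsQMat q x) {C : Type*} [Ring C] [Algebra ℂ C]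
    (f : A →ₐ[ℂ] C) : IsQMat q fun i j => f (x i j) where
  diag h₁ h₂ := by simp only [← map_mul, h.diag h₁ h₂, map_add, map_smul]
  row h₁ := by simp only [← map_mul, h.row h₁, map_smul]
  col h₁ := by simp only [← map_mul, h.col h₁, map_smul]
  anti h₁ h₂ := by simp only [← map_mul, h.anti h₁ h₂]

theorem IsBordered.map {v u : Fin n → A} {Y : Fin n → Fin n → A} (h : IsBordered q v u Y)
    {C : Type*} [Ring C] [Algebra ℂ C] (f : A →ₐ[ℂ] C) :
    IsBordered q (fun j => f (v j)) (fun i => f (u i)) (fun i j => f (Y i j)) where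
  mat := h.mat.map f
  vv h₁ := by simp only [← map_mul, h.vv h₁, map_smul]
  uu h₁ := by simp only [← map_mul, h.uu h₁, map_smul]
  vu j i := by simp only [← map_mul, h.vu]
  vY_lt k h₁ := by simp only [← map_mul, h.vY_lt k h₁, map_add, map_smul]
  vY_eq j k := by simp only [← map_mul, h.vY_eq, map_smul]
  vY_gt k h₁ := by simp only [← map_mul, h.vY_gt k h₁]
  uY_lt l h₁ := by simp only [← map_mul, h.uY_lt l h₁, map_add, map_smul]
  uY_eq i l := by simp only [← map_mul, h.uY_eq, map_smul]
  uY_gt l h₁ := by simp only [← map_mul, h.uY_gt l h₁]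

theorem IsQMat.isBordered {x : Fin (n + 1) → Fin (n + 1) → A} (h : IsQMat q x) :
    IsBordered q (fun j => x 0 j.succ) (fun i => x i.succ 0) (fun i j => x i.succ j.succ) where
  mat := ⟨fun h₁ h₂ => h.diag (Fin.succ_lt_succ_iff.2 h₁) (Fin.succ_lt_succ_iff.2 h₂),
    fun h₁ => h.row (Fin.succ_lt_succ_iff.2 h₁), fun h₁ => h.col (Fin.succ_lt_succ_iff.2 h₁),
    fun h₁ h₂ => h.anti (Fin.succ_lt_succ_iff.2 h₁) (Fin.succ_lt_succ_iff.2 h₂)⟩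
  vv h₁ := h.row (Fin.succ_lt_succ_iff.2 h₁)
  uu h₁ := h.col (Fin.succ_lt_succ_iff.2 h₁)
  vu _ _ := h.anti (Fin.succ_pos _) (Fin.succ_pos _)
  vY_lt _ h₁ := h.diag (Fin.succ_pos _) (Fin.succ_lt_succ_iff.2 h₁)
  vY_eq _ _ := h.col (Fin.succ_pos _)
  vY_gt _ h₁ := h.anti (Fin.succ_pos _) (Fin.succ_lt_succ_iff.2 h₁)
  uY_lt _ h₁ := h.diag (Fin.succ_lt_succ_iff.2 h₁) (Fin.succ_pos _)
  uY_eq _ _ := h.row (Fin.succ_pos _)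
  uY_gt _ h₁ := (h.anti (Fin.succ_lt_succ_iff.2 h₁) (Fin.succ_pos _)).symm

/-- The matrix with upper left entry `a` bordered by `v` and `u`. -/
def borderMat (a : A) (v u : Fin n → A) (Y : Fin n → Fin n → A) (i j : Fin (n + 1)) : A :=
  Fin.cases (Fin.cases a v j) (fun i => Fin.cases (u i) (Y i) j) i

@[simp] theorem borderMat_zero_zero (a : A) (v u : Fin n → A) (Y : Fin n → Fin n → A) :
    borderMat a v u Y 0 0 = a := rfl

@[simp] theorem borderMat_zero_succ (a : A) (v u : Fin n → A) (Y : Fin n → Fin n → A) (j : Fin n) :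
    borderMat a v u Y 0 j.succ = v j := rfl

@[simp] theorem borderMat_succ_zero (a : A) (v u : Fin n → A) (Y : Fin n → Fin n → A) (i : Fin n) :
    borderMat a v u Y i.succ 0 = u i := rfl

@[simp] theorem borderMat_succ_succ (a : A) (v u : Fin n → A) (Y : Fin n → Fin n → A)
    (i j : Fin n) : borderMat a v u Y i.succ j.succ = Y i j := rfl

theorem IsBordered.isQMat {v u : Fin n → A} {Y : Fin n → Fin n → A} (h : IsBordered q v u Y)
    {a : A} (hv : ∀ j, a * v j = q • (v j * a)) (hu : ∀ i, a * u i = q • (u i * a))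
    (hY : ∀ k l, a * Y k l = Y k l * a + (q - q⁻¹) • (v l * u k)) :
    IsQMat q (borderMat a v u Y) where
  diag {i j k l} h₁ h₂ := by
    obtain ⟨k, rfl⟩ := Fin.exists_succ_eq.2 (Fin.ne_zero_of_lt h₁)
    obtain ⟨l, rfl⟩ := Fin.exists_succ_eq.2 (Fin.ne_zero_of_lt h₂)
    cases i using Fin.cases with
    | zero =>
      cases j using Fin.cases with
      | zero => exact hY k l
      | succ j => exact h.vY_lt k (Fin.succ_lt_succ_iff.1 h₂)
    | succ i =>
      cases j using Fin.cases with
      | zero => exact h.uY_lt l (Fin.succ_lt_succ_iff.1 h₁)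
      | succ j => exact h.mat.diag (Fin.succ_lt_succ_iff.1 h₁) (Fin.succ_lt_succ_iff.1 h₂)
  row {i j l} h₁ := by
    obtain ⟨l, rfl⟩ := Fin.exists_succ_eq.2 (Fin.ne_zero_of_lt h₁)
    cases i using Fin.cases with
    | zero =>
      cases j using Fin.cases with
      | zero => exact hv l
      | succ j => exact h.vv (Fin.succ_lt_succ_iff.1 h₁)
    | succ i =>
      cases j using Fin.cases with
      | zero => exact h.uY_eq i l
      | succ j => exact h.mat.row (Fin.succ_lt_succ_iff.1 h₁)
  col {i j k} h₁ := by
    obtain ⟨k, rfl⟩ := Fin.exists_succ_eq.2 (Fin.ne_zero_of_lt h₁)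
    cases i using Fin.cases with
    | zero =>
      cases j using Fin.cases with
      | zero => exact hu k
      | succ j => exact h.vY_eq j k
    | succ i =>
      cases j using Fin.cases with
      | zero => exact h.uu (Fin.succ_lt_succ_iff.1 h₁)
      | succ j => exact h.mat.col (Fin.succ_lt_succ_iff.1 h₁)
  anti {i j k l} h₁ h₂ := by
    obtain ⟨k, rfl⟩ := Fin.exists_succ_eq.2 (Fin.ne_zero_of_lt h₁)
    obtain ⟨j, rfl⟩ := Fin.exists_succ_eq.2 (Fin.ne_zero_of_lt h₂)
    cases i using Fin.cases with
    | zero =>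
      cases l using Fin.cases with
      | zero => exact h.vu j k
      | succ l => exact h.vY_gt k (Fin.succ_lt_succ_iff.1 h₂)
    | succ i =>
      cases l using Fin.cases with
      | zero => exact (h.uY_gt j (Fin.succ_lt_succ_iff.1 h₁)).symm
      | succ l => exact h.mat.anti (Fin.succ_lt_succ_iff.1 h₁) (Fin.succ_lt_succ_iff.1 h₂)

/-- Rescaling the border. -/
theorem IsBordered.smul {v u : Fin n → A} {Y : Fin n → Fin n → A} (h : IsBordered q v u Y)
    (c : ℂ) : IsBordered q (fun j => c • v j) (fun i => c • u i) Y where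
  mat := h.mat
  vv h₁ := by simp only [smul_mul_assoc, mul_smul_comm, h.vv h₁, smul_comm q]
  uu h₁ := by simp only [smul_mul_assoc, mul_smul_comm, h.uu h₁, smul_comm q]
  vu j i := by simp only [smul_mul_assoc, mul_smul_comm, h.vu]
  vY_lt k h₁ := by
    simp only [smul_mul_assoc, mul_smul_comm, h.vY_lt k h₁, smul_add, smul_comm (q - q⁻¹)]
  vY_eq j k := by simp only [smul_mul_assoc, mul_smul_comm, h.vY_eq, smul_comm q]
  vY_gt k h₁ := by simp only [smul_mul_assoc, mul_smul_comm, h.vY_gt k h₁]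
  uY_lt l h₁ := by
    simp only [smul_mul_assoc, mul_smul_comm, h.uY_lt l h₁, smul_add, smul_comm (q - q⁻¹)]
  uY_eq i l := by simp only [smul_mul_assoc, mul_smul_comm, h.uY_eq, smul_comm q]
  uY_gt l h₁ := by simp only [smul_mul_assoc, mul_smul_comm, h.uY_gt l h₁]

/-- Rescaling a quantum matrix by a central element. -/
theorem IsQMat.scale {x : Fin n → Fin n → A} (h : IsQMat q x) {z : A}
    (hz : ∀ a, z * a = a * z) : IsQMat q fun i j => x i j * z := by
  have e : ∀ a b : A, a * z * (b * z) = a * b * (z * z) := fun a b => by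
    rw [mul_assoc a, ← mul_assoc z, hz b, mul_assoc b, mul_assoc]
  constructor <;> intros <;> simp only [e]
  · rw [h.diag ‹_› ‹_›, add_mul, smul_mul_assoc]
  · rw [h.row ‹_›, smul_mul_assoc]
  · rw [h.col ‹_›, smul_mul_assoc]
  · rw [h.anti ‹_› ‹_›]

/-- Rescaling the border by a central element. -/
theorem IsBordered.scale {v u : Fin n → A} {Y : Fin n → Fin n → A} (h : IsBordered q v u Y)
    {z : A} (hz : ∀ a, z * a = a * z) :
    IsBordered q (fun j => v j * z) (fun i => u i * z) Y := by
  have e : ∀ a b : A, a * z * (b * z) = a * b * (z * z) := fun a b => by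
    rw [mul_assoc a, ← mul_assoc z, hz b, mul_assoc b, mul_assoc]
  have e' : ∀ a b : A, a * z * b = a * b * z := fun a b => by
    rw [mul_assoc, hz b, mul_assoc]
  refine ⟨h.mat, ?_, ?_, ?_, ?_, ?_, ?_, ?_, ?_, ?_⟩ <;> intros <;>
    simp only [e, e', ← mul_assoc]
  · rw [h.vv ‹_›, smul_mul_assoc, smul_mul_assoc]
  · rw [h.uu ‹_›, smul_mul_assoc, smul_mul_assoc]
  · rw [h.vu]
  · rw [h.vY_lt _ ‹_›, add_mul, smul_mul_assoc]
  · rw [h.vY_eq, smul_mul_assoc]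
  · rw [h.vY_gt _ ‹_›]
  · rw [h.uY_lt _ ‹_›, add_mul, smul_mul_assoc]
  · rw [h.uY_eq, smul_mul_assoc]
  · rw [h.uY_gt _ ‹_›]

/-- The upper triangular matrix with diagonal entries `a`, `b` and corner `d`. -/
def tri (a d b : A) : Matrix (Fin 2) (Fin 2) A := !![a, d; 0, b]

theorem tri_mul (a d b a' d' b' : A) :
    tri a d b * tri a' d' b' = tri (a * a') (a * d' + d * b') (b * b') := by
  simp [tri]

theorem tri_add (a d b a' d' b' : A) :
    tri a d b + tri a' d' b' = tri (a + a') (d + d') (b + b') := by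
  ext i j; fin_cases i <;> fin_cases j <;> simp [tri]

theorem smul_tri (c : ℂ) (a d b : A) : c • tri a d b = tri (c • a) (c • d) (c • b) := by
  ext i j; fin_cases i <;> fin_cases j <;> simp [tri]

/-- The skew derivation `D` with `D(Y_{k,l}) = (q - q⁻¹) v_l u_k`, in matrix form. -/
theorem IsBordered.tri (hq₀ : q ≠ 0) {v u : Fin n → A} {Y : Fin n → Fin n → A}
    (h : IsBordered q v u Y) :
    IsBordered q (fun j => tri (q • v j) 0 (v j)) (fun i => tri (q • u i) 0 (u i))
      (fun k l => tri (Y k l) ((q - q⁻¹) • (v l * u k)) (Y k l)) := by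
  -- The product rule for `tri (τ b) (D b) b` is the twisted Leibniz rule `D(ab) = τ(a) D(b) + D(a)
  -- b`. The relations between such matrices thus say that `D` is well defined; only the corner
  -- entries need work, as `hs` and `h` settle the diagonal.
  have hs := h.smul q
  have re : ∀ {a b c : A} (w : A), a * b = c → a * (b * w) = c * w := fun w h => by
    rw [← mul_assoc, h]
  -- The correction term is rewritten with `Y` on the left, so that corner entries can be brought to
  -- one common order of factors.
  have vY : ∀ {j l} (k), j < l → v j * Y k l = Y k l * v j + (q - q⁻¹) • (Y k j * v l) :=
    fun k h₁ => by rw [h.vY_lt k h₁, h.vY_gt k h₁]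
  constructor
  · constructor
    · intro i j k l h₁ h₂
      simp only [tri_mul, smul_tri, tri_add]
      congr 1
      · exact h.mat.diag h₁ h₂
      · simp only [smul_mul_assoc, mul_smul_comm, mul_assoc, h.uY_lt _ h₁, h.uY_gt _ h₁, mul_add,
          add_mul, re _ (vY _ h₂), re _ (h.vY_gt _ h₂), smul_add, smul_smul]
        module
      · exact h.mat.diag h₁ h₂
    · intro i j l h₂
      simp only [tri_mul, smul_tri]
      congr 1
      · exact h.mat.row h₂
      · simp only [smul_mul_assoc, mul_smul_comm, mul_assoc, h.uY_eq, mul_add,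
          add_mul, re _ (vY _ h₂), re _ (h.vY_gt _ h₂), smul_add, smul_smul]
        match_scalars <;> field_simp <;> ring
      · exact h.mat.row h₂
    · intro i j k h₁
      simp only [tri_mul, smul_tri]
      congr 1
      · exact h.mat.col h₁
      · simp only [smul_mul_assoc, mul_smul_comm, mul_assoc, h.uY_lt _ h₁, h.uY_gt _ h₁, mul_add,
          add_mul, re _ (h.vY_eq _ _), smul_add, smul_smul]
        match_scalars <;> field_simp <;> ring
      · exact h.mat.col h₁
    · intro i j k l h₁ h₂
      simp only [tri_mul]
      congr 1
      · exact h.mat.anti h₁ h₂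
      · simp only [smul_mul_assoc, mul_smul_comm, mul_assoc, h.uY_lt _ h₁, h.uY_gt _ h₁, mul_add,
          add_mul, re _ (vY _ h₂), re _ (h.vY_gt _ h₂), smul_add, smul_smul]
        module
      · exact h.mat.anti h₁ h₂
  · intro j l h₁
    simp only [tri_mul, smul_tri]
    congr 1
    · exact hs.vv h₁
    · simp
    · exact h.vv h₁
  · intro i k h₁
    simp only [tri_mul, smul_tri]
    congr 1
    · exact hs.uu h₁
    · simp
    · exact h.uu h₁
  · intro j i
    simp only [tri_mul]
    congr 1
    · exact hs.vu j i
    · simp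
    · exact h.vu j i
  · intro j l k h₁
    simp only [tri_mul, smul_tri, tri_add]
    congr 1
    · exact hs.vY_lt k h₁
    · simp only [zero_mul, mul_zero, add_zero, zero_add, smul_mul_assoc, mul_smul_comm, mul_assoc,
        re _ (h.vv h₁), ← h.vu, smul_smul]
      match_scalars <;> field_simp <;> ring
    · exact h.vY_lt k h₁
  · intro j k
    simp only [tri_mul, smul_tri]
    congr 1
    · exact hs.vY_eq j k
    · simp only [zero_mul, mul_zero, add_zero, zero_add, smul_mul_assoc, mul_smul_comm, mul_assoc,
        ← h.vu, smul_smul, mul_comm q]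
    · exact h.vY_eq j k
  · intro j l k h₁
    simp only [tri_mul]
    congr 1
    · exact hs.vY_gt k h₁
    · simp only [zero_mul, mul_zero, add_zero, zero_add, smul_mul_assoc, mul_smul_comm, mul_assoc,
        ← h.vu, re _ (h.vv h₁), smul_smul, mul_comm q]
    · exact h.vY_gt k h₁
  · intro i k l h₁
    simp only [tri_mul, smul_tri, tri_add]
    congr 1
    · exact hs.uY_lt l h₁
    · simp only [zero_mul, mul_zero, add_zero, zero_add, smul_mul_assoc, mul_smul_comm, mul_assoc,
        re _ (h.vu _ _).symm, h.uu h₁, smul_smul]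
      match_scalars <;> field_simp <;> ring
    · exact h.uY_lt l h₁
  · intro i l
    simp only [tri_mul, smul_tri]
    congr 1
    · exact hs.uY_eq i l
    · simp only [zero_mul, mul_zero, add_zero, zero_add, smul_mul_assoc, mul_smul_comm, mul_assoc,
        re _ (h.vu _ _).symm, smul_smul, mul_comm q]
    · exact h.uY_eq i l
  · intro i k l h₁
    simp only [tri_mul]
    congr 1
    · exact hs.uY_gt l h₁
    · simp only [zero_mul, mul_zero, add_zero, zero_add, smul_mul_assoc, mul_smul_comm, mul_assoc,
        re _ (h.vu _ _).symm, h.uu h₁, smul_smul, mul_comm q]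
    · exact h.uY_gt l h₁

end Bordered

/-! ### The bordered algebra, its grading and its twisted derivation. -/

/-- The letters of the bordered algebra: first row, first column, and the other entries. -/
inductive BorderLetter (n : ℕ) : Type
  | v (j : Fin n)
  | u (i : Fin n)
  | Y (i j : Fin n)

/-- The relations of the bordered algebra. -/
inductive BorderRel (n : ℕ) (q : ℂ) :
    FreeAlgebra ℂ (BorderLetter n) → FreeAlgebra ℂ (BorderLetter n) → Prop
  | mat {a b : FreeMat n} (h : MatRel n q a b) : BorderRel n q
      (FreeAlgebra.lift ℂ (fun p => FreeAlgebra.ι ℂ (.Y p.1 p.2)) a)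
      (FreeAlgebra.lift ℂ (fun p => FreeAlgebra.ι ℂ (.Y p.1 p.2)) b)
  | vv {j l : Fin n} (h : j < l) : BorderRel n q (.ι ℂ (.v j) * .ι ℂ (.v l))
      (q • (.ι ℂ (.v l) * .ι ℂ (.v j)))
  | uu {i k : Fin n} (h : i < k) : BorderRel n q (.ι ℂ (.u i) * .ι ℂ (.u k))
      (q • (.ι ℂ (.u k) * .ι ℂ (.u i)))
  | vu (j i : Fin n) : BorderRel n q (.ι ℂ (.v j) * .ι ℂ (.u i)) (.ι ℂ (.u i) * .ι ℂ (.v j))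
  | vY_lt {j l : Fin n} (k : Fin n) (h : j < l) : BorderRel n q (.ι ℂ (.v j) * .ι ℂ (.Y k l))
      (.ι ℂ (.Y k l) * .ι ℂ (.v j) + (q - q⁻¹) • (.ι ℂ (.v l) * .ι ℂ (.Y k j)))
  | vY_eq (j k : Fin n) : BorderRel n q (.ι ℂ (.v j) * .ι ℂ (.Y k j))
      (q • (.ι ℂ (.Y k j) * .ι ℂ (.v j)))
  | vY_gt {j l : Fin n} (k : Fin n) (h : l < j) : BorderRel n q (.ι ℂ (.v j) * .ι ℂ (.Y k l))
      (.ι ℂ (.Y k l) * .ι ℂ (.v j))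
  | uY_lt {i k : Fin n} (l : Fin n) (h : i < k) : BorderRel n q (.ι ℂ (.u i) * .ι ℂ (.Y k l))
      (.ι ℂ (.Y k l) * .ι ℂ (.u i) + (q - q⁻¹) • (.ι ℂ (.Y i l) * .ι ℂ (.u k)))
  | uY_eq (i l : Fin n) : BorderRel n q (.ι ℂ (.u i) * .ι ℂ (.Y i l))
      (q • (.ι ℂ (.Y i l) * .ι ℂ (.u i)))
  | uY_gt {i k : Fin n} (l : Fin n) (h : k < i) : BorderRel n q (.ι ℂ (.u i) * .ι ℂ (.Y k l))
      (.ι ℂ (.Y k l) * .ι ℂ (.u i))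

/-- The algebra generated by all entries of an `(n+1) × (n+1)` quantum matrix but the upper left
one. -/
abbrev BorderAlg (n : ℕ) (q : ℂ) : Type := RingQuot (BorderRel n q)

namespace BorderAlg

variable {n : ℕ} {q : ℂ} {A : Type*} [Ring A] [Algebra ℂ A]

/-- The entries of the first row. -/
def v (q : ℂ) (j : Fin n) : BorderAlg n q := RingQuot.mkAlgHom ℂ (BorderRel n q) (.ι ℂ (.v j))

/-- The entries of the first column. -/
def u (q : ℂ) (i : Fin n) : BorderAlg n q := RingQuot.mkAlgHom ℂ (BorderRel n q) (.ι ℂ (.u i))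

/-- The entries outside the first row and column. -/
def Y (q : ℂ) (i j : Fin n) : BorderAlg n q :=
  RingQuot.mkAlgHom ℂ (BorderRel n q) (.ι ℂ (.Y i j))

theorem isBordered (n : ℕ) (q : ℂ) :
    IsBordered q (v (n := n) q) (u (n := n) q) (Y (n := n) q) where
  mat := by
    constructor
    · intro i j k l h₁ h₂
      simpa [freeX, Y] using RingQuot.mkAlgHom_rel ℂ (BorderRel.mat (MatRel.diag (q := q) h₁ h₂))
    · intro i j l h₁
      simpa [freeX, Y] using RingQuot.mkAlgHom_rel ℂ (BorderRel.mat (MatRel.row (q := q) (i := i) h₁))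
    · intro i j k h₁
      simpa [freeX, Y] using RingQuot.mkAlgHom_rel ℂ (BorderRel.mat (MatRel.col (q := q) (j := j) h₁))
    · intro i j k l h₁ h₂
      simpa [freeX, Y] using RingQuot.mkAlgHom_rel ℂ (BorderRel.mat (MatRel.anti (q := q) h₁ h₂))
  vv h := by simpa [v, u, Y] using RingQuot.mkAlgHom_rel ℂ (BorderRel.vv (q := q) h)
  uu h := by simpa [v, u, Y] using RingQuot.mkAlgHom_rel ℂ (BorderRel.uu (q := q) h)
  vu j i := by simpa [v, u, Y] using RingQuot.mkAlgHom_rel ℂ (BorderRel.vu (q := q) j i)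
  vY_lt k h := by simpa [v, u, Y] using RingQuot.mkAlgHom_rel ℂ (BorderRel.vY_lt (q := q) k h)
  vY_eq j k := by simpa [v, u, Y] using RingQuot.mkAlgHom_rel ℂ (BorderRel.vY_eq (q := q) j k)
  vY_gt k h := by simpa [v, u, Y] using RingQuot.mkAlgHom_rel ℂ (BorderRel.vY_gt (q := q) k h)
  uY_lt l h := by simpa [v, u, Y] using RingQuot.mkAlgHom_rel ℂ (BorderRel.uY_lt (q := q) l h)
  uY_eq i l := by simpa [v, u, Y] using RingQuot.mkAlgHom_rel ℂ (BorderRel.uY_eq (q := q) i l)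
  uY_gt l h := by simpa [v, u, Y] using RingQuot.mkAlgHom_rel ℂ (BorderRel.uY_gt (q := q) l h)

/-- The images of the letters. -/
def letterMap (v u : Fin n → A) (Y : Fin n → Fin n → A) : BorderLetter n → A
  | .v j => v j
  | .u i => u i
  | .Y i j => Y i j

/-- The universal property of the bordered algebra. -/
def lift (v u : Fin n → A) (Y : Fin n → Fin n → A) (h : IsBordered q v u Y) :
    BorderAlg n q →ₐ[ℂ] A :=
  RingQuot.liftAlgHom ℂ ⟨FreeAlgebra.lift ℂ (letterMap v u Y), fun a b hab => by
    cases hab with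
    | mat h' =>
      cases h' with
      | diag h₁ h₂ => simpa [freeX, letterMap] using h.mat.diag h₁ h₂
      | row h₁ => simpa [freeX, letterMap] using h.mat.row h₁
      | col h₁ => simpa [freeX, letterMap] using h.mat.col h₁
      | anti h₁ h₂ => simpa [freeX, letterMap] using h.mat.anti h₁ h₂
    | vv h₁ => simpa [letterMap] using h.vv h₁
    | uu h₁ => simpa [letterMap] using h.uu h₁
    | vu j i => simpa [letterMap] using h.vu j i
    | vY_lt k h₁ => simpa [letterMap] using h.vY_lt k h₁
    | vY_eq j k => simpa [letterMap] using h.vY_eq j k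
    | vY_gt k h₁ => simpa [letterMap] using h.vY_gt k h₁
    | uY_lt l h₁ => simpa [letterMap] using h.uY_lt l h₁
    | uY_eq i l => simpa [letterMap] using h.uY_eq i l
    | uY_gt l h₁ => simpa [letterMap] using h.uY_gt l h₁⟩

variable {v' u' : Fin n → A} {Y' : Fin n → Fin n → A} (h : IsBordered q v' u' Y')

@[simp]
theorem lift_v (j : Fin n) : lift v' u' Y' h (v q j) = v' j := by
  simp [lift, v, letterMap, RingQuot.liftAlgHom_mkAlgHom_apply]

@[simp]
theorem lift_u (i : Fin n) : lift v' u' Y' h (u q i) = u' i := by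
  simp [lift, u, letterMap, RingQuot.liftAlgHom_mkAlgHom_apply]

@[simp]
theorem lift_Y (i j : Fin n) : lift v' u' Y' h (Y q i j) = Y' i j := by
  simp [lift, Y, letterMap, RingQuot.liftAlgHom_mkAlgHom_apply]

theorem mem_of_mul_mem (p : Submodule ℂ (BorderAlg n q)) (h1 : 1 ∈ p)
    (hv : ∀ j, ∀ a ∈ p, v q j * a ∈ p) (hu : ∀ i, ∀ a ∈ p, u q i * a ∈ p)
    (hY : ∀ i j, ∀ a ∈ p, Y q i j * a ∈ p) (a : BorderAlg n q) : a ∈ p := by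
  refine mem_of_left_mul_mem (adjoin_ringQuot_eq_top (BorderRel n q)) p h1 ?_ a
  rintro _ ⟨l, rfl⟩
  cases l with
  | v j => exact hv j
  | u i => exact hu i
  | Y i j => exact hY i j

/-- Two linear maps agree if they agree at `1` and agreement passes to multiples by generators. -/
theorem linearMap_ext {M : Type*} [AddCommMonoid M] [Module ℂ M] {S T : BorderAlg n q →ₗ[ℂ] M}
    (h1 : S 1 = T 1) (hv : ∀ j a, S a = T a → S (v q j * a) = T (v q j * a))
    (hu : ∀ i a, S a = T a → S (u q i * a) = T (u q i * a))
    (hY : ∀ i j a, S a = T a → S (Y q i j * a) = T (Y q i j * a)) : S = T :=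
  LinearMap.ext fun a => mem_of_mul_mem (LinearMap.eqLocus S T) h1 hv hu hY a

/-- The automorphism scaling the border by `q`. -/
def tau (n : ℕ) (q : ℂ) : BorderAlg n q →ₐ[ℂ] BorderAlg n q :=
  lift _ _ _ ((isBordered n q).smul q)

variable (hq₀ : q ≠ 0)

/-- The homomorphism encoding the skew derivation. -/
def triHom : BorderAlg n q →ₐ[ℂ] Matrix (Fin 2) (Fin 2) (BorderAlg n q) :=
  lift _ _ _ ((isBordered n q).tri hq₀)

/-- The skew derivation `[x_{00}, ·]`. -/
def skewD : BorderAlg n q →ₗ[ℂ] BorderAlg n q where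
  toFun b := triHom hq₀ b 0 1
  map_add' a b := by simp
  map_smul' c a := by simp

/-- Upper triangular matrices with diagonal `τ b, b` are closed under products and every letter has
such an image. The corner entry is therefore a `τ`-twisted derivation. -/
theorem triHom_apply (b : BorderAlg n q) :
    triHom hq₀ b = tri (tau n q b) (skewD hq₀ b) b := by
  let p : Submodule ℂ (BorderAlg n q) :=
    { carrier := {b | triHom hq₀ b = tri (tau n q b) (skewD hq₀ b) b}
      zero_mem' := by
        ext i j; fin_cases i <;> fin_cases j <;> simp [tri]
      add_mem' := fun {a b} ha hb => by
        simp only [Set.mem_ofPred_eq] at ha hb ⊢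
        rw [map_add, ha, hb, tri_add, map_add, map_add]
      smul_mem' := fun c a ha => by
        simp only [Set.mem_ofPred_eq] at ha ⊢
        rw [map_smul, ha, smul_tri, map_smul, map_smul] }
  have key : ∀ g a, (∃ d, triHom hq₀ g = tri (tau n q g) d g) → a ∈ p → g * a ∈ p := by
    rintro g a ⟨d, hd⟩ ha
    simp only [p, Submodule.mem_mk, AddSubmonoid.mem_mk, AddSubsemigroup.mem_mk,
      Set.mem_ofPred_eq] at ha ⊢
    have : triHom hq₀ (g * a) = tri (tau n q (g * a)) (tau n q g * skewD hq₀ a + d * a) (g * a) := by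
      rw [map_mul, hd, ha, tri_mul, map_mul]
    have h2 : skewD hq₀ (g * a) = tau n q g * skewD hq₀ a + d * a := by
      change triHom hq₀ (g * a) 0 1 = _
      rw [this]; rfl
    rw [this, h2]
  refine mem_of_mul_mem p ?_ (fun j a => key _ _ ⟨0, by simp [triHom, tau]⟩)
    (fun i a => key _ _ ⟨0, by simp [triHom, tau]⟩)
    (fun i j a => key _ _ ⟨_, by rw [triHom, lift_Y, tau, lift_Y]⟩) b
  simp only [p, Submodule.mem_mk, AddSubmonoid.mem_mk, AddSubsemigroup.mem_mk,
      Set.mem_ofPred_eq]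
  have : skewD hq₀ (1 : BorderAlg n q) = 0 := by
    change triHom hq₀ 1 0 1 = 0
    simp
  rw [this, map_one, map_one]
  ext i j; fin_cases i <;> fin_cases j <;> simp [tri]

@[simp] theorem tau_v (j : Fin n) : tau n q (v q j) = q • v q j := by simp [tau]
@[simp] theorem tau_u (i : Fin n) : tau n q (u q i) = q • u q i := by simp [tau]
@[simp] theorem tau_Y (i j : Fin n) : tau n q (Y q i j) = Y q i j := by simp [tau]

@[simp] theorem skewD_v (j : Fin n) : skewD hq₀ (v q j) = 0 := by
  change triHom hq₀ (v q j) 0 1 = 0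
  simp [triHom, tri]

@[simp] theorem skewD_u (j : Fin n) : skewD hq₀ (u q j) = 0 := by
  change triHom hq₀ (u q j) 0 1 = 0
  simp [triHom, tri]

@[simp] theorem skewD_Y (k l : Fin n) :
    skewD hq₀ (Y q k l) = (q - q⁻¹) • (v q l * u q k) := by
  change triHom hq₀ (Y q k l) 0 1 = _
  simp [triHom, tri]

theorem skewD_mul (a b : BorderAlg n q) :
    skewD hq₀ (a * b) = tau n q a * skewD hq₀ b + skewD hq₀ a * b := by
  change triHom hq₀ (a * b) 0 1 = _
  rw [map_mul, triHom_apply, triHom_apply, tri_mul]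
  rfl

@[simp] theorem skewD_one : skewD hq₀ (1 : BorderAlg n q) = 0 := by
  change triHom hq₀ 1 0 1 = 0
  simp

/-- The grading of the bordered algebra by the degree in the border. -/
def grade (n : ℕ) (q : ℂ) : BorderAlg n q →ₐ[ℂ] Polynomial (BorderAlg n q) :=
  lift _ _ _ (((isBordered n q).map Polynomial.CAlgHom).scale fun _ => Polynomial.X_mul)

theorem grade_v_mul (j : Fin n) (b : BorderAlg n q) :
    grade n q (v q j * b) = Polynomial.C (v q j) * (grade n q b * Polynomial.X) := by
  rw [map_mul, grade, lift_v, mul_assoc, Polynomial.X_mul]; rfl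

theorem grade_u_mul (i : Fin n) (b : BorderAlg n q) :
    grade n q (u q i * b) = Polynomial.C (u q i) * (grade n q b * Polynomial.X) := by
  rw [map_mul, grade, lift_u, mul_assoc, Polynomial.X_mul]; rfl

theorem grade_Y_mul (i j : Fin n) (b : BorderAlg n q) :
    grade n q (Y q i j * b) = Polynomial.C (Y q i j) * grade n q b := by
  rw [map_mul, grade, lift_Y]; rfl

/-- Setting the grading variable to `1` adds up the homogeneous components, so an element is
determined by them. -/
theorem eval_grade (b : BorderAlg n q) : (grade n q b).eval 1 = b := by
  have : (Polynomial.leval (1 : BorderAlg n q)).restrictScalars ℂ ∘ₗ (grade n q).toLinearMap =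
      LinearMap.id := by
    refine linearMap_ext (by simp) (fun j a h => ?_) (fun j a h => ?_) (fun i j a h => ?_)
    · simp [Polynomial.leval] at h
      simp [Polynomial.leval, grade_v_mul, h]
    · simp [Polynomial.leval] at h
      simp [Polynomial.leval, grade_u_mul, h]
    · simp [Polynomial.leval] at h
      simp [Polynomial.leval, grade_Y_mul, h]
  exact LinearMap.congr_fun this b

/-- The component of degree `m` in the border. -/
def comp (n : ℕ) (q : ℂ) (m : ℕ) : BorderAlg n q →ₗ[ℂ] BorderAlg n q :=
  (Polynomial.lcoeff (BorderAlg n q) m).restrictScalars ℂ ∘ₗ (grade n q).toLinearMap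

theorem comp_apply (m : ℕ) (b : BorderAlg n q) : comp n q m b = (grade n q b).coeff m := rfl

theorem eq_zero_of_comp_eq_zero {b : BorderAlg n q} (h : ∀ m, comp n q m b = 0) : b = 0 := by
  have : grade n q b = 0 := Polynomial.ext fun m => by simpa [comp_apply] using h m
  rw [← eval_grade b, this, Polynomial.eval_zero]

@[simp] theorem comp_zero_one : comp n q 0 1 = 1 := by simp [comp_apply]

theorem comp_succ_one (m : ℕ) : comp n q (m + 1) 1 = 0 := by
  simp [comp_apply, Polynomial.coeff_one]

@[simp] theorem comp_zero_v_mul (j : Fin n) (b : BorderAlg n q) :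
    comp n q 0 (v q j * b) = 0 := by
  simp [comp_apply, grade_v_mul]

@[simp] theorem comp_succ_v_mul (m : ℕ) (j : Fin n) (b : BorderAlg n q) :
    comp n q (m + 1) (v q j * b) = v q j * comp n q m b := by
  simp [comp_apply, grade_v_mul]

@[simp] theorem comp_zero_u_mul (j : Fin n) (b : BorderAlg n q) :
    comp n q 0 (u q j * b) = 0 := by
  simp [comp_apply, grade_u_mul]

@[simp] theorem comp_succ_u_mul (m : ℕ) (j : Fin n) (b : BorderAlg n q) :
    comp n q (m + 1) (u q j * b) = u q j * comp n q m b := by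
  simp [comp_apply, grade_u_mul]

@[simp] theorem comp_Y_mul (m : ℕ) (i j : Fin n) (b : BorderAlg n q) :
    comp n q m (Y q i j * b) = Y q i j * comp n q m b := by
  simp [comp_apply, grade_Y_mul]

/-- If all components of `b` below `m` vanish, the component of degree `m` of `b c` is the product
of the components of degree `m` and `0`. -/
theorem comp_mul_of_lt {m : ℕ} {b : BorderAlg n q} (hb : ∀ j < m, comp n q j b = 0)
    (c : BorderAlg n q) : comp n q m (b * c) = comp n q m b * comp n q 0 c := by
  rw [comp_apply, map_mul, Polynomial.coeff_mul, Finset.sum_eq_single (m, 0)]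
  · rfl
  · rintro ⟨i, j⟩ hij hne
    rw [Finset.HasAntidiagonal.mem_antidiagonal] at hij
    have : i < m := by
      rcases Nat.lt_or_ge i m with h | h
      · exact h
      · exact absurd (Prod.ext (by simp at hij ⊢; omega) (by simp at hij ⊢; omega)) hne
    rw [show (grade n q b).coeff i = 0 from hb i this, zero_mul]
  · simp

theorem comp_tau (m : ℕ) (b : BorderAlg n q) :
    comp n q m (tau n q b) = q ^ m • comp n q m b := by
  revert m
  have key : ∀ b ∈ (⊤ : Submodule ℂ (BorderAlg n q)), ∀ m,
      comp n q m (tau n q b) = q ^ m • comp n q m b := by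
    intro b _
    let p : Submodule ℂ (BorderAlg n q) := ⨅ m, LinearMap.eqLocus
      (comp n q m ∘ₗ (tau n q).toLinearMap) (q ^ m • comp n q m)
    have hp : ∀ b, b ∈ p ↔ ∀ m, comp n q m (tau n q b) = q ^ m • comp n q m b := fun b => by
      simp [p, Submodule.mem_iInf, LinearMap.mem_eqLocus]
    rw [← hp]
    refine mem_of_mul_mem p ?_ (fun j a h => ?_) (fun j a h => ?_) (fun i j a h => ?_) b
    · rw [hp]
      rintro (_ | m)
      · simp
      · rw [map_one, comp_succ_one, smul_zero]
    · rw [hp] at h ⊢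
      rintro (_ | m)
      · simp
      · rw [map_mul, tau_v, smul_mul_assoc, map_smul, comp_succ_v_mul, comp_succ_v_mul, h,
          mul_smul_comm, smul_smul, pow_succ']
    · rw [hp] at h ⊢
      rintro (_ | m)
      · simp
      · rw [map_mul, tau_u, smul_mul_assoc, map_smul, comp_succ_u_mul, comp_succ_u_mul, h,
          mul_smul_comm, smul_smul, pow_succ']
    · rw [hp] at h ⊢
      intro m
      rw [map_mul, tau_Y, comp_Y_mul, comp_Y_mul, h, mul_smul_comm]
  exact key b trivial

/-- `D` kills the border and replaces a letter `Y_{kl}` by a multiple of `v_l u_k`, so it raises the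
border degree by exactly two. -/
theorem comp_skewD (b : BorderAlg n q) : comp n q 0 (skewD hq₀ b) = 0 ∧
    comp n q 1 (skewD hq₀ b) = 0 ∧
    ∀ m, comp n q (m + 2) (skewD hq₀ b) = skewD hq₀ (comp n q m b) := by
  let p : Submodule ℂ (BorderAlg n q) := LinearMap.ker (comp n q 0 ∘ₗ skewD hq₀) ⊓
    LinearMap.ker (comp n q 1 ∘ₗ skewD hq₀) ⊓
    ⨅ m, LinearMap.eqLocus (comp n q (m + 2) ∘ₗ skewD hq₀) (skewD hq₀ ∘ₗ comp n q m)
  have hp : ∀ b, b ∈ p ↔ (comp n q 0 (skewD hq₀ b) = 0 ∧ comp n q 1 (skewD hq₀ b) = 0 ∧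
      ∀ m, comp n q (m + 2) (skewD hq₀ b) = skewD hq₀ (comp n q m b)) := fun b => by
    simp [p, Submodule.mem_iInf, LinearMap.mem_eqLocus, and_assoc]
  rw [← hp]
  refine mem_of_mul_mem p ?_ (fun j a h => ?_) (fun j a h => ?_) (fun i j a h => ?_) b
  · rw [hp]
    refine ⟨by simp, by simp, ?_⟩
    rintro (_ | m)
    · simp
    · simp [comp_succ_one]
  · rw [hp] at h ⊢
    simp only [skewD_mul, tau_v, skewD_v, zero_mul, add_zero, smul_mul_assoc, map_smul]
    refine ⟨by simp, by rw [comp_succ_v_mul, h.1, mul_zero, smul_zero], ?_⟩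
    rintro (_ | m)
    · rw [comp_succ_v_mul, h.2.1]; simp
    · rw [comp_succ_v_mul, h.2.2, comp_succ_v_mul, skewD_mul]; simp
  · rw [hp] at h ⊢
    simp only [skewD_mul, tau_u, skewD_u, zero_mul, add_zero, smul_mul_assoc, map_smul]
    refine ⟨by simp, by rw [comp_succ_u_mul, h.1, mul_zero, smul_zero], ?_⟩
    rintro (_ | m)
    · rw [comp_succ_u_mul, h.2.1]; simp
    · rw [comp_succ_u_mul, h.2.2, comp_succ_u_mul, skewD_mul]; simp
  · rw [hp] at h ⊢
    simp only [skewD_mul, tau_Y, skewD_Y, smul_mul_assoc, map_smul, map_add, comp_Y_mul,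
      mul_assoc, h.1, h.2.1, h.2.2, comp_succ_v_mul, comp_succ_u_mul, comp_zero_v_mul,
      comp_zero_u_mul]
    exact ⟨by simp, by simp, by simp⟩

/-- Killing the border. -/
def kill (n : ℕ) (q : ℂ) : BorderAlg n q →ₐ[ℂ] OqM n q :=
  lift (fun _ => 0) (fun _ => 0) (OqM.x q)
    ⟨OqM.isQMat n q, by simp, by simp, by simp, by simp, by simp, by simp, by simp, by simp,
      by simp⟩

@[simp] theorem kill_v (j : Fin n) : kill n q (v q j) = 0 := by simp [kill]
@[simp] theorem kill_u (j : Fin n) : kill n q (u q j) = 0 := by simp [kill]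
@[simp] theorem kill_Y (i j : Fin n) : kill n q (Y q i j) = OqM.x q i j := by simp [kill]

/-- The part of border degree `0` is built from the `Y` alone and comes from `O_q(M_n)`; it vanishes
as soon as `kill` does. -/
theorem comp_zero (b : BorderAlg n q) :
    comp n q 0 b = OqM.lift _ (isBordered n q).mat (kill n q b) := by
  have : comp n q 0 = ((OqM.lift _ (isBordered n q).mat).comp (kill n q)).toLinearMap := by
    refine linearMap_ext (by simp) (fun j a h => by simp) (fun j a h => by simp)
      (fun i j a h => ?_)
    simp at h
    simp [h]
  exact LinearMap.congr_fun this b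

@[simp] theorem kill_tau (b : BorderAlg n q) : kill n q (tau n q b) = kill n q b := by
  have : ((kill n q).comp (tau n q)).toLinearMap = (kill n q).toLinearMap := by
    refine linearMap_ext (by simp) (fun j a h => by simp) (fun j a h => by simp)
      (fun i j a h => ?_)
    simp at h
    simp [h]
  exact LinearMap.congr_fun this b

@[simp] theorem kill_skewD (b : BorderAlg n q) : kill n q (skewD hq₀ b) = 0 := by
  have : (kill n q).toLinearMap ∘ₗ skewD hq₀ = 0 := by
    refine linearMap_ext (by simp) (fun j a h => ?_) (fun j a h => ?_) (fun i j a h => ?_)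
    · simp [skewD_mul]
    · simp [skewD_mul]
    · simp at h
      simp [skewD_mul, h]
  exact LinearMap.congr_fun this b

end BorderAlg

/-! ### `O_q(M_{n+1})` in Ore normal form over the bordered algebra. -/

section Ore

open BorderAlg

variable {n : ℕ} {q : ℂ} (hq₀ : q ≠ 0)

instance : AddCommGroup (ℕ →₀ BorderAlg n q) := Finsupp.instAddCommGroup

instance : Ring (Module.End ℂ (ℕ →₀ BorderAlg n q)) := Module.End.instRing

/-- Multiplication by the variable on polynomials with coefficients in the bordered algebra. -/
def oreShift (n : ℕ) (q : ℂ) : Module.End ℂ (ℕ →₀ BorderAlg n q) :=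
  Finsupp.lmapDomain _ ℂ Nat.succ

/-- The action of `x_{00}` on polynomials with coefficients in the bordered algebra:
`b t^k ↦ τ(b) t^{k+1} + D(b) t^k`. -/
def oreOp : Module.End ℂ (ℕ →₀ BorderAlg n q) :=
  oreShift n q ∘ₗ Finsupp.mapRange.linearMap (tau n q).toLinearMap +
    Finsupp.mapRange.linearMap (skewD hq₀)

@[simp] theorem oreShift_single (k : ℕ) (b : BorderAlg n q) :
    oreShift n q (Finsupp.single k b) = Finsupp.single (k + 1) b := by
  simp [oreShift, Finsupp.mapDomain_single]

@[simp] theorem oreOp_single (k : ℕ) (b : BorderAlg n q) : oreOp hq₀ (Finsupp.single k b) =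
    Finsupp.single (k + 1) (tau n q b) + Finsupp.single k (skewD hq₀ b) := by
  simp [oreOp]

theorem oreShift_apply_succ (p : ℕ →₀ BorderAlg n q) (k : ℕ) : oreShift n q p (k + 1) = p k :=
  Finsupp.mapDomain_apply Nat.succ_injective p k

theorem oreOp_apply_succ (p : ℕ →₀ BorderAlg n q) (k : ℕ) :
    oreOp hq₀ p (k + 1) = tau n q (p k) + skewD hq₀ (p (k + 1)) := by
  simp [oreOp, oreShift_apply_succ]

/-- Left multiplication by the bordered algebra. -/
def oreLeft (n : ℕ) (q : ℂ) : BorderAlg n q →ₐ[ℂ] Module.End ℂ (ℕ →₀ BorderAlg n q) :=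
  Algebra.lsmul ℂ ℂ (ℕ →₀ BorderAlg n q)

@[simp] theorem oreLeft_apply (b : BorderAlg n q) (p : ℕ →₀ BorderAlg n q) :
    oreLeft n q b p = b • p := rfl

theorem oreOp_mul_oreLeft (b : BorderAlg n q) : oreOp hq₀ * oreLeft n q b =
    oreLeft n q (tau n q b) * oreOp hq₀ + oreLeft n q (skewD hq₀ b) := by
  refine Finsupp.lhom_ext fun k c => ?_
  simp [skewD_mul, add_assoc, Finsupp.single_add, -Finsupp.single_mul]

/-- The relations involving `x_{00}` are the Ore relation for `b = v_j, u_i, Y_{kl}`, where `D(b)`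
is `0`, `0` and `(q - q⁻¹) v_l u_k`. -/
theorem isQMat_ore : IsQMat q (borderMat (oreOp hq₀) (fun j => oreLeft n q (v q j))
    (fun i => oreLeft n q (u q i)) (fun i j => oreLeft n q (Y q i j))) := by
  refine ((isBordered n q).map (oreLeft n q)).isQMat (fun j => ?_) (fun i => ?_) (fun k l => ?_)
  · rw [oreOp_mul_oreLeft, tau_v, skewD_v, map_smul, map_zero, add_zero, smul_mul_assoc]
  · rw [oreOp_mul_oreLeft, tau_u, skewD_u, map_smul, map_zero, add_zero, smul_mul_assoc]
  · rw [oreOp_mul_oreLeft, tau_Y, skewD_Y, map_smul, map_mul]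

/-- `O_q(M_{n+1})` acting on polynomials in `x_{00}` with coefficients in the bordered algebra. -/
def oreRep : OqM (n + 1) q →ₐ[ℂ] Module.End ℂ (ℕ →₀ BorderAlg n q) :=
  OqM.lift _ (isQMat_ore hq₀)

@[simp] theorem oreRep_x (i j : Fin (n + 1)) : oreRep hq₀ (OqM.x q i j) =
    borderMat (oreOp hq₀) (fun j => oreLeft n q (v q j))
    (fun i => oreLeft n q (u q i)) (fun i j => oreLeft n q (Y q i j)) i j :=
  OqM.lift_x _ _ _ _

/-- A property of elements of `O_q(M_{n+1})` preserved by left multiplication by generators. -/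
theorem OqM.mem_of_border_mul_mem (p : Submodule ℂ (OqM (n + 1) q)) (h1 : 1 ∈ p)
    (ha : ∀ f ∈ p, OqM.x q 0 0 * f ∈ p) (hv : ∀ j : Fin n, ∀ f ∈ p, OqM.x q 0 j.succ * f ∈ p)
    (hu : ∀ i : Fin n, ∀ f ∈ p, OqM.x q i.succ 0 * f ∈ p)
    (hY : ∀ i j : Fin n, ∀ f ∈ p, OqM.x q i.succ j.succ * f ∈ p) (f : OqM (n + 1) q) :
    f ∈ p := by
  refine mem_of_left_mul_mem (OqM.adjoin_x_eq_top (n + 1) q) p h1 ?_ f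
  rintro _ ⟨⟨i, j⟩, rfl⟩
  cases i using Fin.cases with
  | zero =>
    cases j using Fin.cases with
    | zero => exact ha
    | succ j => exact hv j
  | succ i =>
    cases j using Fin.cases with
    | zero => exact hu i
    | succ j => exact hY i j

/-- The bordered algebra maps to `O_q(M_{n+1})`. -/
def borderIncl (n : ℕ) (q : ℂ) : BorderAlg n q →ₐ[ℂ] OqM (n + 1) q :=
  BorderAlg.lift _ _ _ (OqM.isQMat (n + 1) q).isBordered

@[simp] theorem borderIncl_v (j : Fin n) : borderIncl n q (v q j) = OqM.x q 0 j.succ := by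
  simp [borderIncl]
@[simp] theorem borderIncl_u (i : Fin n) : borderIncl n q (u q i) = OqM.x q i.succ 0 := by
  simp [borderIncl]
@[simp] theorem borderIncl_Y (i j : Fin n) :
    borderIncl n q (Y q i j) = OqM.x q i.succ j.succ := by
  simp [borderIncl]

theorem x_mul_borderIncl (b : BorderAlg n q) : OqM.x q 0 0 * borderIncl n q b =
    borderIncl n q (tau n q b) * OqM.x q 0 0 + borderIncl n q (skewD hq₀ b) := by
  have hx := OqM.isQMat (n + 1) q
  let S : BorderAlg n q →ₗ[ℂ] OqM (n + 1) q :=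
    LinearMap.mulLeft ℂ (OqM.x q 0 0) ∘ₗ (borderIncl n q).toLinearMap
  let T : BorderAlg n q →ₗ[ℂ] OqM (n + 1) q :=
    LinearMap.mulRight ℂ (OqM.x q 0 0) ∘ₗ ((borderIncl n q).comp (tau n q)).toLinearMap +
      (borderIncl n q).toLinearMap ∘ₗ skewD hq₀
  have key : ∀ g a, S g = T g → S a = T a → S (g * a) = T (g * a) := by
    intro g a hg ha
    simp only [S, T, LinearMap.comp_apply, LinearMap.mulLeft_apply, LinearMap.add_apply,
      LinearMap.mulRight_apply, AlgHom.toLinearMap_apply, AlgHom.comp_apply, map_mul, skewD_mul,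
      map_add] at hg ha ⊢
    rw [← mul_assoc, hg, add_mul, mul_assoc, ha, mul_add]
    simp only [mul_assoc, add_assoc]
  have : S = T := by
    refine linearMap_ext (by simp [S, T]) (fun j a h => key _ _ ?_ h) (fun i a h => key _ _ ?_ h)
      (fun i j a h => key _ _ ?_ h)
    · simp [S, T, hx.row (Fin.succ_pos j)]
    · simp [S, T, hx.col (Fin.succ_pos i)]
    · simp [S, T, hx.diag (Fin.succ_pos i) (Fin.succ_pos j)]
  exact LinearMap.congr_fun this b

/-- `∑ b_k t^k ↦ ∑ b_k x_{00}^k`. -/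
def oreEval (n : ℕ) (q : ℂ) : (ℕ →₀ BorderAlg n q) →ₗ[ℂ] OqM (n + 1) q :=
  Finsupp.lsum ℂ fun k => LinearMap.mulRight ℂ (OqM.x q 0 0 ^ k) ∘ₗ (borderIncl n q).toLinearMap

@[simp] theorem oreEval_single (k : ℕ) (b : BorderAlg n q) :
    oreEval n q (Finsupp.single k b) = borderIncl n q b * OqM.x q 0 0 ^ k := by
  simp [oreEval]

theorem oreEval_smul (b : BorderAlg n q) (p : ℕ →₀ BorderAlg n q) :
    oreEval n q (b • p) = borderIncl n q b * oreEval n q p := by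
  induction p using Finsupp.induction_linear with
  | zero => simp
  | add f g hf hg => rw [smul_add, map_add, hf, hg, map_add, mul_add]
  | single k c => simp [mul_assoc, -Finsupp.single_mul]

theorem oreEval_oreOp (p : ℕ →₀ BorderAlg n q) :
    oreEval n q (oreOp hq₀ p) = OqM.x q 0 0 * oreEval n q p := by
  induction p using Finsupp.induction_linear with
  | zero => simp
  | add f g hf hg => rw [map_add, map_add, hf, hg, map_add, mul_add]
  | single k c =>
    rw [oreOp_single, map_add, oreEval_single, oreEval_single, oreEval_single, ← mul_assoc,
      x_mul_borderIncl hq₀, add_mul, pow_succ', mul_assoc]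

/-- Evaluation intertwines the Ore action with left multiplication. At `p = 1` it recovers `f` from
its normal form, so an element with zero normal form is zero. -/
theorem oreEval_oreRep (f : OqM (n + 1) q) (p : ℕ →₀ BorderAlg n q) :
    oreEval n q (oreRep hq₀ f p) = f * oreEval n q p := by
  let S : Submodule ℂ (OqM (n + 1) q) := LinearMap.eqLocus
    (LinearMap.compRight ℂ (oreEval n q) ∘ₗ (oreRep hq₀).toLinearMap)
    (LinearMap.lcomp ℂ _ (oreEval n q) ∘ₗ (Algebra.lmul ℂ (OqM (n + 1) q)).toLinearMap)
  have hS : ∀ f, f ∈ S ↔ ∀ p, oreEval n q (oreRep hq₀ f p) = f * oreEval n q p := fun f => by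
    rw [LinearMap.mem_eqLocus, LinearMap.ext_iff]; rfl
  refine (hS f).1 (OqM.mem_of_border_mul_mem S ?_ ?_ ?_ ?_ ?_ f) p
  · rw [hS]; intro p; simp
  · intro f hf
    rw [hS] at hf ⊢
    intro p
    rw [map_mul, Module.End.mul_apply, oreRep_x, borderMat_zero_zero, oreEval_oreOp, hf,
      mul_assoc]
  · intro j f hf
    rw [hS] at hf ⊢
    intro p
    rw [map_mul, Module.End.mul_apply, oreRep_x, borderMat_zero_succ, oreLeft_apply,
      oreEval_smul, hf, borderIncl_v, mul_assoc]
  · intro i f hf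
    rw [hS] at hf ⊢
    intro p
    rw [map_mul, Module.End.mul_apply, oreRep_x, borderMat_succ_zero, oreLeft_apply,
      oreEval_smul, hf, borderIncl_u, mul_assoc]
  · intro i j f hf
    rw [hS] at hf ⊢
    intro p
    rw [map_mul, Module.End.mul_apply, oreRep_x, borderMat_succ_succ, oreLeft_apply,
      oreEval_smul, hf, borderIncl_Y, mul_assoc]

/-- The polynomial in `x_{00}` representing an element of `O_q(M_{n+1})`. -/
def oreForm (f : OqM (n + 1) q) : ℕ →₀ BorderAlg n q := oreRep hq₀ f (Finsupp.single 0 1)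

theorem oreEval_oreForm (f : OqM (n + 1) q) : oreEval n q (oreForm hq₀ f) = f := by
  rw [oreForm, oreEval_oreRep]; simp

theorem oreRep_borderIncl (b : BorderAlg n q) :
    oreRep hq₀ (borderIncl n q b) = oreLeft n q b := by
  have : ((oreRep hq₀).comp (borderIncl n q)).toLinearMap = (oreLeft n q).toLinearMap := by
    refine linearMap_ext (by simp) (fun j a h => ?_) (fun j a h => ?_) (fun i j a h => ?_)
    all_goals
      simp only [AlgHom.toLinearMap_apply, AlgHom.comp_apply] at h
      simp [h]
  exact LinearMap.congr_fun this b

theorem oreRep_eq_sum (f : OqM (n + 1) q) : oreRep hq₀ f =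
    (oreForm hq₀ f).sum fun k b => oreLeft n q b * oreOp hq₀ ^ k := by
  conv_lhs => rw [← oreEval_oreForm hq₀ f]
  change oreRep hq₀ ((oreForm hq₀ f).sum fun k b => borderIncl n q b * OqM.x q 0 0 ^ k) = _
  rw [Finsupp.sum, map_sum, Finsupp.sum]
  refine Finset.sum_congr rfl fun k _ => ?_
  simp [oreRep_borderIncl]

/-- The shift is right multiplication by the variable, so it commutes with all left actions. -/
theorem oreRep_oreShift (f : OqM (n + 1) q) :
    oreRep hq₀ f * oreShift n q = oreShift n q * oreRep hq₀ f := by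
  have hL : ∀ b, oreLeft n q b * oreShift n q = oreShift n q * oreLeft n q b := fun b =>
    Finsupp.lhom_ext fun k c => by simp [-Finsupp.single_mul]
  have hop : oreOp hq₀ * oreShift n q = oreShift n q * oreOp hq₀ :=
    Finsupp.lhom_ext fun k c => by simp [-Finsupp.single_mul]
  have : Algebra.adjoin ℂ (Set.range fun p : Fin (n + 1) × Fin (n + 1) => OqM.x q p.1 p.2) ≤
      (Subalgebra.centralizer ℂ {oreShift n q}).comap (oreRep hq₀) := by
    refine Algebra.adjoin_le ?_
    rintro _ ⟨⟨i, j⟩, rfl⟩ _ rfl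
    rw [AlgHom.coe_toRingHom, oreRep_x]
    cases i using Fin.cases <;> cases j using Fin.cases
    · exact hop.symm
    all_goals exact (hL _).symm
  rw [OqM.adjoin_x_eq_top] at this
  exact (this (x := f) trivial _ rfl).symm

/-- The components of degree `0` in the border under `x_{00}`. -/
theorem comp_zero_oreOp_pow (k : ℕ) (b : BorderAlg n q) (l : ℕ) :
    comp n q 0 ((oreOp hq₀ ^ k) (Finsupp.single 0 b) l) = if l = k then comp n q 0 b else 0 := by
  induction k generalizing l with
  | zero => by_cases h : l = 0 <;> simp [Finsupp.single_apply, h, eq_comm]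
  | succ k ih =>
    rw [pow_succ', Module.End.mul_apply]
    cases l with
    | zero =>
      have : ∀ p : ℕ →₀ BorderAlg n q, oreOp hq₀ p 0 = skewD hq₀ (p 0) := fun p => by
        have : oreShift n q (Finsupp.mapRange.linearMap (tau n q).toLinearMap p) 0 = 0 :=
          Finsupp.mapDomain_of_notMem_range _ _ (by simp)
        rw [oreOp, LinearMap.add_apply, Finsupp.add_apply, LinearMap.comp_apply, this, zero_add]
        simp
      rw [this, (comp_skewD hq₀ _).1, if_neg (by omega)]
    | succ l =>
      rw [oreOp_apply_succ, map_add, comp_tau, (comp_skewD hq₀ _).1, ih]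
      simp

/-- The trace of the lower right block. -/
def borderTrace (n : ℕ) (q : ℂ) : BorderAlg n q := ∑ i, Y q i i

theorem comp_borderTrace_mul (m : ℕ) (b : BorderAlg n q) :
    comp n q m (borderTrace n q * b) = borderTrace n q * comp n q m b := by
  simp [borderTrace, Finset.sum_mul]

theorem comp_zero_borderTrace : comp n q 0 (borderTrace n q) = borderTrace n q := by
  have := comp_borderTrace_mul (n := n) (q := q) 0 1
  simpa using this

theorem oreRep_sigma_one : oreRep hq₀ (OqM.sigma (n + 1) q 1) =
    oreOp hq₀ + oreLeft n q (borderTrace n q) := by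
  rw [OqM.sigma_one, Fin.sum_univ_succ, map_add, map_sum, borderTrace, map_sum]
  simp

theorem sub_one_smul_eq {M : Type*} [AddCommGroup M] [Module ℂ M] {c : ℂ} {a b d : M}
    (h : c • a + b = a + d) : (c - 1) • a = d - b := by
  rw [sub_smul, one_smul, sub_eq_sub_iff_add_eq_add, h, add_comm]

/-- An element commuting with the trace is determined by its part of degree `0` in the border. -/
theorem eq_zero_of_comp_zero_oreForm (hq : ∀ m : ℕ, 1 ≤ m → q ^ m ≠ 1) {f : OqM (n + 1) q}
    (hf : Commute f (OqM.sigma (n + 1) q 1)) (h0 : ∀ k, comp n q 0 (oreForm hq₀ f k) = 0) :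
    f = 0 := by
  set p := oreForm hq₀ f with hp
  suffices h : ∀ m k, comp n q m (p k) = 0 by
    have : p = 0 := Finsupp.ext fun k => eq_zero_of_comp_eq_zero fun m => h m k
    rw [← oreEval_oreForm hq₀ f, ← hp, this, map_zero]
  -- Strong induction on the border degree: all components of the coefficients below `m` may be
  -- assumed zero.
  intro m
  induction m using Nat.strong_induction_on with
  | _ m ih =>
    rcases Nat.eq_zero_or_pos m with rfl | hm
    · exact h0
    -- Only the component of degree `m - 2` could contribute, and it is already zero.
    have hD : ∀ k, comp n q m (skewD hq₀ (p k)) = 0 := by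
      intro k
      obtain ⟨h1, h2, h3⟩ := comp_skewD hq₀ (p k)
      match m, ih with
      | 0, _ => exact h1
      | 1, _ => exact h2
      | m + 2, ih => rw [h3, ih m (by omega), map_zero]
    -- As the lower components of each `p k` vanish, only the degree `0` part of `x_{00}^k · tr`
    -- matters, and there `x_{00}` merely shifts the exponent.
    have hfs : ∀ l, comp n q m (oreRep hq₀ f (Finsupp.single 0 (borderTrace n q)) l) =
        comp n q m (p l) * borderTrace n q := by
      intro l
      rw [oreRep_eq_sum, ← hp, Finsupp.sum, LinearMap.sum_apply, Finsupp.finsetSum_apply, map_sum]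
      have : ∀ k ∈ p.support, comp n q m ((oreLeft n q (p k) * oreOp hq₀ ^ k : Module.End ℂ (ℕ →₀ BorderAlg n q))
          (Finsupp.single 0 (borderTrace n q)) l) =
          if l = k then comp n q m (p k) * borderTrace n q else 0 := by
        intro k _
        rw [Module.End.mul_apply, oreLeft_apply, Finsupp.smul_apply, smul_eq_mul,
          comp_mul_of_lt (fun j hj => ih j hj k), comp_zero_oreOp_pow, comp_zero_borderTrace,
          mul_ite, mul_zero]
      rw [Finset.sum_congr rfl this, Finset.sum_ite_eq]
      split_ifs with h
      · rfl
      · rw [Finsupp.notMem_support_iff.1 h, map_zero, zero_mul]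
    -- The coefficient of `t^{k+1}`, in border degree `m`, of `σ_1 f = f σ_1`: the factor `q^m`
    -- comes from `τ` on the left, the `1` from the plain shift on the right.
    have hrec : ∀ k, (q ^ m - 1) • comp n q m (p k) =
        comp n q m (p (k + 1)) * borderTrace n q - borderTrace n q * comp n q m (p (k + 1)) := by
      intro k
      have hc : oreRep hq₀ (OqM.sigma (n + 1) q 1) p =
          oreRep hq₀ f (oreRep hq₀ (OqM.sigma (n + 1) q 1) (Finsupp.single 0 1)) := by
        rw [hp, oreForm, ← Module.End.mul_apply, ← map_mul, ← hf.eq, map_mul,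
          Module.End.mul_apply]
      have hs : oreRep hq₀ (OqM.sigma (n + 1) q 1) (Finsupp.single 0 1) =
          oreShift n q (Finsupp.single 0 1) + Finsupp.single 0 (borderTrace n q) := by
        rw [oreRep_sigma_one]
        simp
      rw [hs, map_add, ← Module.End.mul_apply, oreRep_oreShift, Module.End.mul_apply,
        oreRep_sigma_one] at hc
      have hk := congrArg (comp n q m) (DFunLike.congr_fun hc (k + 1))
      rw [LinearMap.add_apply, Finsupp.add_apply, Finsupp.add_apply, oreOp_apply_succ,
        oreShift_apply_succ, oreLeft_apply, Finsupp.smul_apply, smul_eq_mul, map_add (comp n q m),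
        map_add (comp n q m), map_add (comp n q m), comp_tau, hD, add_zero, comp_borderTrace_mul, hfs] at hk
      change _ = comp n q m (p k) + _ at hk
      exact sub_one_smul_eq hk
    have hq1 : q ^ m - 1 ≠ 0 := sub_ne_zero.2 (hq m hm)
    obtain ⟨K, hK⟩ : ∃ K, ∀ k, K ≤ k → p k = 0 := by
      refine ⟨p.support.sup id + 1, fun k hk => ?_⟩
      by_contra hne
      have := Finset.le_sup (f := id) (Finsupp.mem_support_iff.2 hne)
      simp only [id] at this
      omega
    -- Descending induction from the top power of `x_{00}`: the recursion expresses `p k` through `p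
    -- (k + 1)`, and `q^m - 1` is invertible.
    have hdesc : ∀ j k, K ≤ k + j → comp n q m (p k) = 0 := by
      intro j
      induction j with
      | zero => intro k hk; rw [hK k hk, map_zero]
      | succ j ihj =>
        intro k hk
        have := hrec k
        rw [ihj (k + 1) (by omega), zero_mul, mul_zero, sub_zero] at this
        exact (smul_eq_zero.1 this).resolve_left hq1
    exact fun k => hdesc K k (by omega)

/-- The quotient of `O_q(M_{n+1})` by the border, `O_q(M_n)[x_{00}]`. -/
def killBorder (n : ℕ) (q : ℂ) : OqM (n + 1) q →ₐ[ℂ] Polynomial (OqM n q) :=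
  OqM.lift (borderMat Polynomial.X (fun _ => 0) (fun _ => 0)
      fun i j => Polynomial.C (OqM.x q i j)) <| by
    refine IsBordered.isQMat ⟨(OqM.isQMat n q).map Polynomial.CAlgHom, ?_, ?_, ?_, ?_, ?_, ?_, ?_,
      ?_, ?_⟩ ?_ ?_ ?_ <;> intros <;> simp

@[simp] theorem killBorder_x (i j : Fin (n + 1)) : killBorder n q (OqM.x q i j) =
    borderMat Polynomial.X (fun _ => 0) (fun _ => 0) (fun i j => Polynomial.C (OqM.x q i j)) i j :=
  OqM.lift_x _ _ _ _

/-- Killing the border in a polynomial with coefficients in the bordered algebra. -/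
def killCoeff (n : ℕ) (q : ℂ) : (ℕ →₀ BorderAlg n q) →ₗ[ℂ] Polynomial (OqM n q) :=
  Finsupp.lsum ℂ fun k => (Polynomial.monomial k).restrictScalars ℂ ∘ₗ (kill n q).toLinearMap

@[simp] theorem killCoeff_single (k : ℕ) (b : BorderAlg n q) :
    killCoeff n q (Finsupp.single k b) = Polynomial.monomial k (kill n q b) := by
  simp [killCoeff]

theorem coeff_killCoeff (p : ℕ →₀ BorderAlg n q) (k : ℕ) :
    (killCoeff n q p).coeff k = kill n q (p k) := by
  induction p using Finsupp.induction_linear with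
  | zero => simp
  | add f g hf hg => simp [hf, hg]
  | single l c =>
    rw [killCoeff_single, Polynomial.coeff_monomial, Finsupp.single_apply, apply_ite (kill n q),
      map_zero]

theorem killCoeff_smul (b : BorderAlg n q) (p : ℕ →₀ BorderAlg n q) :
    killCoeff n q (b • p) = Polynomial.C (kill n q b) * killCoeff n q p := by
  ext k
  simp [coeff_killCoeff]

theorem killCoeff_oreOp (p : ℕ →₀ BorderAlg n q) :
    killCoeff n q (oreOp hq₀ p) = Polynomial.X * killCoeff n q p := by
  induction p using Finsupp.induction_linear with
  | zero => simp
  | add f g hf hg => simp [hf, hg, mul_add]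
  | single l c => simp [Polynomial.X_mul_monomial]

/-- Modulo the border `τ` becomes trivial and `D` zero, so the Ore action turns into multiplication
in `O_q(M_n)[x_{00}]`. -/
theorem killCoeff_oreForm (f : OqM (n + 1) q) :
    killCoeff n q (oreForm hq₀ f) = killBorder n q f := by
  have : killCoeff n q ∘ₗ LinearMap.applyₗ (Finsupp.single 0 1) ∘ₗ (oreRep hq₀).toLinearMap =
      (killBorder n q).toLinearMap := by
    refine LinearMap.ext fun f => ?_
    refine OqM.mem_of_border_mul_mem (LinearMap.eqLocus _ _) ?_ ?_ ?_ ?_ ?_ f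
    · rw [LinearMap.mem_eqLocus]; simp
    · intro f hf
      rw [LinearMap.mem_eqLocus] at hf ⊢
      simp only [LinearMap.comp_apply, AlgHom.toLinearMap_apply, LinearMap.applyₗ_apply_apply]
        at hf ⊢
      rw [map_mul, map_mul, Module.End.mul_apply, oreRep_x, killBorder_x, ← hf]
      exact killCoeff_oreOp hq₀ _
    all_goals
      intros
      rename_i hf
      rw [LinearMap.mem_eqLocus] at hf ⊢
      simp only [LinearMap.comp_apply, AlgHom.toLinearMap_apply, LinearMap.applyₗ_apply_apply]
        at hf ⊢
      rw [map_mul, map_mul, Module.End.mul_apply, oreRep_x, killBorder_x, ← hf]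
      simp [killCoeff_smul]
  exact LinearMap.congr_fun this f

end Ore

/-! ### Injectivity of diagonal restriction on the centralizer. -/

theorem commute_C_of_commute_X_add {R : Type*} [Ring R] {p : Polynomial R} {c : R}
    (h : Commute p (Polynomial.X + Polynomial.C c)) : Commute p (Polynomial.C c) := by
  have := h.eq
  rw [mul_add, add_mul, Polynomial.X_mul] at this
  exact add_left_cancel this

/-- Restriction to the diagonal is injective on the centralizer of the trace. -/
theorem eq_zero_of_diagRestrict_eq_zero {q : ℂ} (hq₀ : q ≠ 0) (hq : ∀ m : ℕ, 1 ≤ m → q ^ m ≠ 1)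
    {n : ℕ} {f : OqM n q} (hf : Commute f (OqM.sigma n q 1)) (h0 : diagRestrict n q f = 0) :
    f = 0 := by
  induction n with
  | zero =>
    obtain ⟨c, rfl⟩ : f ∈ (⊥ : Subalgebra ℂ (OqM 0 q)) := by
      have := OqM.adjoin_x_eq_top 0 q
      rw [Set.range_eq_empty, Algebra.adjoin_empty] at this
      rw [this]; trivial
    rw [AlgHom.toRingHom_eq_coe, RingHom.coe_coe, Algebra.ofId_apply] at h0 ⊢
    rw [AlgHom.commutes, MvPolynomial.algebraMap_eq, MvPolynomial.C_eq_zero] at h0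
    rw [h0, map_zero]
  | succ n ih =>
    have hkill : killBorder n q f = 0 := by
      -- The trace maps to `X` plus the smaller trace, and `X` is central, so each coefficient falls
      -- under the induction hypothesis.
      have hcomm : ∀ k, Commute ((killBorder n q f).coeff k) (OqM.sigma n q 1) := by
        intro k
        have h1 := hf.map (killBorder n q)
        have h2 : killBorder n q (OqM.sigma (n + 1) q 1) =
            Polynomial.X + Polynomial.C (OqM.sigma n q 1) := by
          rw [OqM.sigma_one, OqM.sigma_one, Fin.sum_univ_succ, map_add, map_sum, map_sum]
          simp
        rw [h2] at h1
        have h3 : Commute (killBorder n q f) (Polynomial.C (OqM.sigma n q 1)) :=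
          commute_C_of_commute_X_add h1
        have := congrArg (fun p => Polynomial.coeff p k) h3.eq
        simpa [Commute, SemiconjBy] using this
      -- Diagonal restriction factors through killing the border, the first torus variable becoming
      -- the polynomial variable.
      have hδ : ∀ f, MvPolynomial.finSuccEquiv ℂ n (diagRestrict (n + 1) q f) =
          Polynomial.mapAlgHom (diagRestrict n q) (killBorder n q f) := by
        have : ((MvPolynomial.finSuccEquiv ℂ n).toAlgHom.comp (diagRestrict (n + 1) q)) =
            (Polynomial.mapAlgHom (diagRestrict n q)).comp (killBorder n q) := by
          refine OqM.algHom_ext fun i j => ?_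
          simp only [AlgHom.comp_apply, diagRestrict_x, killBorder_x]
          cases i using Fin.cases <;> cases j using Fin.cases
          · simp [MvPolynomial.finSuccEquiv_X_zero]
          · simp [(Fin.succ_ne_zero _).symm]
          · simp
          · rename_i i j
            by_cases hij : i = j
            · simp [hij, MvPolynomial.finSuccEquiv_X_succ]
            · simp [hij]
        exact fun f => DFunLike.congr_fun this f
      ext k
      refine ih (hcomm k) ?_
      have := hδ f
      rw [h0, map_zero] at this
      have := congrArg (fun p => Polynomial.coeff p k) this
      simpa using this.symm
    refine eq_zero_of_comp_zero_oreForm hq₀ hq hf fun k => ?_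
    rw [BorderAlg.comp_zero, ← coeff_killCoeff, killCoeff_oreForm, hkill]
    simp

/-! ### The quantum exterior algebra and expansion into minors. -/

/-- The relations of the quantum exterior algebra. -/
structure IsQExt (q : ℂ) {n : ℕ} {R : Type*} [Ring R] [Algebra ℂ R] (e : Fin n → R) : Prop where
  sq : ∀ i, e i * e i = 0
  swap : ∀ {j l}, j < l → e l * e j = (-q) • (e j * e l)

/-- The number of inversions of a list. -/
def invCount {n : ℕ} : List (Fin n) → ℕ
  | [] => 0
  | x :: l => l.countP (· < x) + invCount l

/-- The monomial `e_{j_1} ⋯ e_{j_t}` for `J = {j_1 < ⋯ < j_t}`. -/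
def extMonomial {n : ℕ} {R : Type*} [Ring R] (e : Fin n → R) (J : Finset (Fin n)) : R :=
  ((J.sort (· ≤ ·)).map e).prod

section Ext

variable {q : ℂ} {n : ℕ} {R : Type*} [Ring R] [Algebra ℂ R] {e : Fin n → R}

theorem IsQExt.mul_prod_of_mem (h : IsQExt q e) {x : Fin n} {l : List (Fin n)}
    (hl : l.Pairwise (· < ·)) (hx : x ∈ l) : e x * (l.map e).prod = 0 := by
  induction l with
  | nil => simp at hx
  | cons y l ih =>
    rw [List.map_cons, List.prod_cons, ← mul_assoc]
    rcases List.mem_cons.1 hx with rfl | hx'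
    · rw [h.sq, zero_mul]
    · rw [h.swap ((List.pairwise_cons.1 hl).1 x hx'), smul_mul_assoc, mul_assoc,
        ih (List.pairwise_cons.1 hl).2 hx', mul_zero, smul_zero]

theorem IsQExt.mul_prod_of_notMem (h : IsQExt q e) {x : Fin n} {l : List (Fin n)}
    (hl : l.Pairwise (· < ·)) (hx : x ∉ l) : e x * (l.map e).prod =
      (-q) ^ l.countP (· < x) • ((l.orderedInsert (· ≤ ·) x).map e).prod := by
  induction l with
  | nil => simp
  | cons y l ih =>
    obtain ⟨hy, hl'⟩ := List.pairwise_cons.1 hl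
    have hxy : x ≠ y := fun he => hx (he ▸ List.mem_cons_self)
    rcases lt_or_gt_of_ne hxy with hlt | hgt
    · have h0 : (y :: l).countP (· < x) = 0 := by
        rw [List.countP_eq_zero]
        intro z hz
        rcases List.mem_cons.1 hz with rfl | hz'
        · simpa using hlt.le
        · simpa using (hlt.trans (hy z hz')).le
      rw [h0, pow_zero, one_smul, List.orderedInsert, if_pos hlt.le]
      simp
    · rw [List.map_cons, List.prod_cons, ← mul_assoc, h.swap hgt, smul_mul_assoc, mul_assoc,
        ih hl' fun hm => hx (List.mem_cons_of_mem _ hm), List.orderedInsert,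
        if_neg (not_le.2 hgt), List.map_cons, List.prod_cons, List.countP_cons_of_pos (by simpa),
        mul_smul_comm, smul_smul, pow_succ']

theorem insertionSort_eq_sort {l : List (Fin n)} (hl : l.Nodup) :
    l.insertionSort (· ≤ ·) = l.toFinset.sort (· ≤ ·) := by
  refine List.Perm.eq_of_pairwise' (r := (· ≤ ·)) (List.pairwise_insertionSort _ _)
    (Finset.pairwise_sort _ _) ?_
  refine (List.perm_insertionSort _ l).trans ?_
  refine (List.perm_ext_iff_of_nodup hl (Finset.sort_nodup _ _)).2 fun a => ?_
  simp

theorem sort_pairwise_lt (J : Finset (Fin n)) : (J.sort (· ≤ ·)).Pairwise (· < ·) :=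
  (Finset.sortedLT_sort J).pairwise

theorem IsQExt.mul_extMonomial_of_mem (h : IsQExt q e) {x : Fin n} {J : Finset (Fin n)}
    (hx : x ∈ J) : e x * extMonomial e J = 0 :=
  h.mul_prod_of_mem (sort_pairwise_lt J) (by simpa using hx)

theorem IsQExt.mul_extMonomial_of_notMem (h : IsQExt q e) {x : Fin n} {J : Finset (Fin n)}
    (hx : x ∉ J) : e x * extMonomial e J =
      (-q) ^ (J.sort (· ≤ ·)).countP (· < x) • extMonomial e (insert x J) := by
  have hnd : (x :: J.sort (· ≤ ·)).Nodup :=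
    List.nodup_cons.2 ⟨by simpa using hx, Finset.sort_nodup _ _⟩
  rw [extMonomial, h.mul_prod_of_notMem (sort_pairwise_lt J) (by simpa using hx), extMonomial]
  congr 4
  have := insertionSort_eq_sort hnd
  rw [List.insertionSort_cons, insertionSort_eq_sort (Finset.sort_nodup _ _)] at this
  simpa using this

theorem IsQExt.prod_of_nodup (h : IsQExt q e) {l : List (Fin n)} (hl : l.Nodup) :
    (l.map e).prod = (-q) ^ invCount l • extMonomial e l.toFinset := by
  induction l with
  | nil => simp [invCount, extMonomial]
  | cons x l ih =>
    obtain ⟨hx, hl'⟩ := List.nodup_cons.1 hl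
    have hperm : ((l.toFinset).sort (· ≤ ·)).Perm l :=
      (insertionSort_eq_sort hl') ▸ List.perm_insertionSort _ l
    rw [List.map_cons, List.prod_cons, ih hl', mul_smul_comm,
      h.mul_extMonomial_of_notMem (by simpa using hx), smul_smul, ← pow_add, invCount,
      hperm.countP_eq, add_comm, List.toFinset_cons]

theorem IsQExt.prod_of_not_nodup (h : IsQExt q e) {l : List (Fin n)} (hl : ¬ l.Nodup) :
    (l.map e).prod = 0 := by
  induction l with
  | nil => simp at hl
  | cons x l ih =>
    rw [List.map_cons, List.prod_cons]
    by_cases hl' : l.Nodup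
    · have hx : x ∈ l := by
        by_contra hx
        exact hl (List.nodup_cons.2 ⟨hx, hl'⟩)
      rw [h.prod_of_nodup hl', mul_smul_comm, h.mul_extMonomial_of_mem (by simpa using hx),
        smul_zero]
    · rw [ih hl', mul_zero]

theorem countP_ofFn {t : ℕ} {α : Type*} (p : α → Bool) (w : Fin t → α) :
    (List.ofFn w).countP p = ∑ b, if p (w b) then 1 else 0 := by
  induction t with
  | zero => simp
  | succ t ih => rw [List.ofFn_succ, List.countP_cons, ih, Fin.sum_univ_succ, add_comm]

theorem invCount_ofFn {t : ℕ} (w : Fin t → Fin n) :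
    invCount (List.ofFn w) = ∑ a, ∑ b, if a < b ∧ w b < w a then 1 else 0 := by
  induction t with
  | zero => simp [invCount]
  | succ t ih =>
    rw [List.ofFn_succ, invCount, ih, Fin.sum_univ_succ, countP_ofFn, Fin.sum_univ_succ]
    congr 1
    · simp
    · refine Finset.sum_congr rfl fun a _ => ?_
      rw [Fin.sum_univ_succ]
      simp

theorem invCount_ofFn_perm {t : ℕ} (s : Equiv.Perm (Fin t)) {f : Fin t → Fin n}
    (hf : StrictMono f) : invCount (List.ofFn fun a => f (s a)) = permLength s := by
  rw [invCount_ofFn, permLength, Finset.card_filter, Fintype.sum_prod_type]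
  simp [hf.lt_iff_lt]

theorem ofFn_orderEmbOfFin (J : Finset (Fin n)) {t : ℕ} (h : J.card = t) :
    (List.ofFn fun a => J.orderEmbOfFin h a) = J.sort (· ≤ ·) := by
  subst h
  refine List.ext_getElem (by simp) fun i h₁ h₂ => ?_
  simp [Finset.orderEmbOfFin_apply]

theorem prod_ofFn_orderEmbOfFin (J : Finset (Fin n)) {t : ℕ} (h : J.card = t) (e : Fin n → R) :
    (List.ofFn fun a => e (J.orderEmbOfFin h a)).prod = extMonomial e J := by
  rw [extMonomial, ← ofFn_orderEmbOfFin J h, List.map_ofFn]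
  rfl

theorem IsQExt.prod_perm (h : IsQExt q e) {t : ℕ} (J : {J : Finset (Fin n) // J.card = t})
    (s : Equiv.Perm (Fin t)) : (List.ofFn fun a => e (J.1.orderEmbOfFin J.2 (s a))).prod =
      (-q) ^ permLength s • extMonomial e J.1 := by
  have hinj : Function.Injective fun a => J.1.orderEmbOfFin J.2 (s a) :=
    (J.1.orderEmbOfFin J.2).injective.comp s.injective
  have hnd := List.nodup_ofFn.2 hinj
  have := h.prod_of_nodup hnd
  rw [List.map_ofFn, invCount_ofFn_perm s (J.1.orderEmbOfFin J.2).strictMono] at this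
  have hset : (List.ofFn fun a => J.1.orderEmbOfFin J.2 (s a)).toFinset = J.1 := by
    ext x
    rw [List.mem_toFinset, List.mem_ofFn]
    constructor
    · rintro ⟨a, rfl⟩
      exact Finset.orderEmbOfFin_mem _ _ _
    · intro hx
      rw [← Finset.mem_coe, ← Finset.range_orderEmbOfFin J.1 J.2] at hx
      obtain ⟨a, rfl⟩ := hx
      exact ⟨s.symm a, by simp⟩
  rw [hset] at this
  exact this

theorem prod_ofFn_mul {t : ℕ} (f g : Fin t → R) (h : ∀ a b, Commute (f a) (g b)) :
    (List.ofFn fun a => f a * g a).prod = (List.ofFn f).prod * (List.ofFn g).prod := by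
  induction t with
  | zero => simp
  | succ t ih =>
    rw [List.ofFn_succ, List.ofFn_succ, List.ofFn_succ, List.prod_cons, List.prod_cons,
      List.prod_cons, ih _ _ fun a b => h a.succ b.succ]
    have : Commute (List.ofFn fun i : Fin t => f i.succ).prod (g 0) := by
      refine Commute.list_prod_left _ _ fun y hy => ?_
      obtain ⟨a, rfl⟩ := List.mem_ofFn.1 hy
      exact h _ _
    rw [mul_assoc, mul_assoc, ← mul_assoc (g 0), ← this.eq, mul_assoc]

/-- Expansion of a product of `t` linear forms in the quantum exterior algebra into quantum
minors. -/
theorem IsQExt.prod_sum (h : IsQExt q e) {t : ℕ} (x : Fin t → Fin n → R)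
    (hx : ∀ a j k, Commute (x a j) (e k)) :
    (List.ofFn fun a => ∑ j, x a j * e j).prod =
      ∑ J : {J : Finset (Fin n) // J.card = t},
        qDet q (fun a b => x a (J.1.orderEmbOfFin J.2 b)) * extMonomial e J.1 := by
  have h1 := (MultilinearMap.mkPiAlgebraFin ℂ t R).map_sum fun (a : Fin t) (j : Fin n) =>
    x a j * e j
  simp only [MultilinearMap.mkPiAlgebraFin_apply] at h1
  rw [h1]
  simp only [qDet, Finset.sum_mul]
  rw [← Fintype.sum_prod_type']
  symm
  -- The pairs `(J, s)` enumerate the injective index functions; the remaining functions repeat a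
  -- letter and give zero.
  refine Fintype.sum_of_injective (fun p : {J : Finset (Fin n) // J.card = t} ×
    Equiv.Perm (Fin t) => fun a => p.1.1.orderEmbOfFin p.1.2 (p.2 a)) ?_ _ _ ?_ ?_
  · rintro ⟨J, s⟩ ⟨J', s'⟩ heq
    have hJ : J = J' := by
      apply Subtype.ext
      have := congrArg Set.range heq
      simp only at this
      have e1 : ∀ (J : {J : Finset (Fin n) // J.card = t}) (s : Equiv.Perm (Fin t)),
          Set.range (fun a => J.1.orderEmbOfFin J.2 (s a)) = (J.1 : Set (Fin n)) := fun J s => by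
        rw [← Finset.range_orderEmbOfFin J.1 J.2]
        exact s.surjective.range_comp _
      rw [e1, e1] at this
      exact_mod_cast this
    subst hJ
    congr 1
    ext a
    exact congrArg Fin.val ((J.1.orderEmbOfFin J.2).injective (congrFun heq a))
  · intro w hw
    rw [prod_ofFn_mul _ _ fun a b => hx _ _ _]
    have hninj : ¬ Function.Injective w := by
      intro hinj
      apply hw
      have hcard : (Finset.univ.image w).card = t := by
        rw [Finset.card_image_of_injective _ hinj, Finset.card_univ, Fintype.card_fin]
      have hmem : ∀ a, ∃ b, (Finset.univ.image w).orderEmbOfFin hcard b = w a := fun a => by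
        have : w a ∈ (Finset.univ.image w : Finset (Fin n)) := by simp
        rwa [← Finset.mem_coe, ← Finset.range_orderEmbOfFin _ hcard] at this
      choose s hs using hmem
      have hsinj : Function.Injective s := fun a b hab => hinj (by rw [← hs, ← hs, hab])
      refine ⟨(⟨_, hcard⟩, Equiv.ofBijective s (Finite.injective_iff_bijective.1 hsinj)), ?_⟩
      funext a
      exact hs a
    have := h.prod_of_not_nodup (l := List.ofFn w) (fun hnd => hninj (List.nodup_ofFn.1 hnd))
    rw [List.map_ofFn] at this
    have h2 : (List.ofFn fun a => e (w a)).prod = 0 := this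
    rw [h2, mul_zero]
  · rintro ⟨J, s⟩
    simp only
    rw [prod_ofFn_mul _ _ fun a b => hx _ _ _, h.prod_perm J s, mul_smul_comm, smul_mul_assoc]

end Ext

/-! ### Moving a quantum matrix past exterior variables. -/

section ExtMat

variable {q : ℂ} {n : ℕ} {R : Type*} [Ring R] [Algebra ℂ R]

/-- The matrix through which a quantum exterior variable `g k` is moved past the defining
corepresentation of quantum matrices. -/
def extMat (q : ℂ) (g : Fin n → R) (k : Fin n) : Matrix (Fin n) (Fin n) R := fun b a =>
  (if b = a then (if k = a then q⁻¹ else 1) • g k else 0) +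
    if a = k ∧ k < b then (q⁻¹ - q) • g b else 0

theorem extMat_mul_apply (g : Fin n → R) (k : Fin n) (M : Matrix (Fin n) (Fin n) R)
    (b a : Fin n) : (extMat q g k * M) b a =
      (if k = b then q⁻¹ else 1 : ℂ) • (g k * M b a) +
        if k < b then (q⁻¹ - q) • (g b * M k a) else 0 := by
  rw [Matrix.mul_apply]
  simp only [extMat, add_mul, Finset.sum_add_distrib, ite_mul, zero_mul]
  congr 1
  · rw [Finset.sum_ite_eq, if_pos (Finset.mem_univ _), smul_mul_assoc]
  · rw [Finset.sum_eq_single k]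
    · simp
    · intro c _ hc
      rw [if_neg fun h => hc h.1]
    · simp

theorem mul_extMat_apply (g : Fin n → R) (k : Fin n) (M : Matrix (Fin n) (Fin n) R)
    (b a : Fin n) : (M * extMat q g k) b a =
      (if k = a then q⁻¹ else 1 : ℂ) • (M b a * g k) +
        if a = k then ∑ c, if k < c then (q⁻¹ - q) • (M b c * g c) else 0 else 0 := by
  rw [Matrix.mul_apply]
  simp only [extMat, mul_add, Finset.sum_add_distrib, mul_ite, mul_zero]
  congr 1
  · rw [Finset.sum_ite_eq', if_pos (Finset.mem_univ _), mul_smul_comm]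
  · split_ifs with h
    · refine Finset.sum_congr rfl fun c _ => ?_
      simp [h]
    · exact Finset.sum_eq_zero fun c _ => if_neg fun h' => h h'.1

/-- This makes the expansion of products of linear forms into minors available with the matrices
`extMat q g k` in place of the exterior variables. -/
theorem IsQExt.extMat (hq₀ : q ≠ 0) {g : Fin n → R} (hg : IsQExt q g) :
    IsQExt q (extMat q g) where
  sq k := by
    ext b a
    rw [extMat_mul_apply]
    simp only [QuantumMatrices.extMat, Matrix.zero_apply]
    rcases lt_trichotomy k b with hkb | rfl | hkb
    · rcases eq_or_ne b a with rfl | hba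
      · simp [hkb, hkb.ne, hkb.ne', hg.sq]
      · rcases eq_or_ne a k with rfl | hak
        · simp [hkb, hkb.ne, hba, hg.swap hkb, smul_smul, hq₀]
        · simp [hkb.ne, hba, hak, hak.symm]
    · by_cases h : k = a <;> simp [hg.sq, h]
    · rcases eq_or_ne b a with rfl | h
      · simp [hkb.ne', hkb.not_gt, hg.sq]
      · simp [hkb.ne', hkb.not_gt, h]
  swap {j l} hjl := by
    ext b a
    rw [Matrix.smul_apply, extMat_mul_apply, extMat_mul_apply]
    simp only [QuantumMatrices.extMat]
    rcases eq_or_ne b a with rfl | hba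
    · have h1 : ¬ (b = j ∧ j < l ∧ l < b) := by omega
      have h2 : ¬ (b = j ∧ j < b) := by omega
      have h3 : ¬ (b = l ∧ l < b) := by omega
      have h4 : ¬ (b = l ∧ l < j) := by omega
      have e1 : (if l < b then (q⁻¹ - q) • (g b * ((if l = b then (if j = b then q⁻¹ else 1) • g j
          else 0) + if b = j ∧ j < l then (q⁻¹ - q) • g l else 0)) else 0) = 0 := by
        split_ifs <;> first | omega | simp
      have e2 : (if j < b then (q⁻¹ - q) • (g b * ((if j = b then (if l = b then q⁻¹ else 1) • g l
          else 0) + if b = l ∧ l < j then (q⁻¹ - q) • g j else 0)) else 0) = 0 := by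
        split_ifs <;> first | omega | simp
      rw [e1, e2, if_neg h2, if_neg h3]
      simp only [if_true, add_zero, mul_smul_comm, hg.swap hjl, smul_smul]
      congr 1
      ring
    · rcases eq_or_ne a j with rfl | haj
      · rcases lt_or_ge a b with hab | hab
        · rcases lt_trichotomy b l with hbl | rfl | hbl
          · simp [hjl.ne, hjl.ne', hjl, hab, hba, hbl.ne', hbl.not_gt, hg.swap hbl, smul_smul,
              mul_comm]
          · simp [hjl.ne, hjl.ne', hjl, hg.sq]
          · simp only [hjl.ne, hjl.ne', hjl, hab, hba, hbl, hbl.ne, hg.swap hbl, smul_smul,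
              mul_smul_comm, if_true, if_false, and_true, false_and, zero_add, mul_zero,
              smul_zero, add_zero, one_smul]
            match_scalars
            field_simp
            ring
        · simp [hjl.ne, hab.not_gt, hba, (lt_of_le_of_lt hab hjl).not_gt]
      · rcases eq_or_ne a l with rfl | hal
        · rcases lt_or_ge a b with hab | hab
          · simp [hjl.ne, hjl.ne', hjl.not_gt, hab, hba, (hjl.trans hab), (hjl.trans hab).ne,
              hg.swap (hjl.trans hab), smul_smul, mul_comm]
          · simp [hjl.ne, hjl.ne', hjl.not_gt, hab.not_gt, hba]
        · simp [hba, haj, hal, haj.symm, hal.symm]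

theorem IsQExt.sum_sum_mul {e : Fin n → R} (he : IsQExt q e) (f : Fin n → Fin n → R) :
    ∑ j, ∑ l, f j l * (e j * e l) =
      ∑ j, ∑ l, if j < l then (f j l - q • f l j) * (e j * e l) else 0 := by
  have h1 : ∀ j l, f j l * (e j * e l) = (if j < l then f j l * (e j * e l) else 0) +
      if l < j then f j l * (e j * e l) else 0 := fun j l => by
    rcases lt_trichotomy j l with h | rfl | h
    · simp [h, h.not_gt]
    · simp [he.sq]
    · simp [h, h.not_gt]
  rw [Finset.sum_congr rfl fun j _ => (Finset.sum_congr rfl fun l _ => h1 j l).trans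
    Finset.sum_add_distrib, Finset.sum_add_distrib, Finset.sum_comm (f := fun j l => if l < j then f j l * (e j * e l) else 0),
    ← Finset.sum_add_distrib]
  refine Finset.sum_congr rfl fun j _ => ?_
  rw [← Finset.sum_add_distrib]
  refine Finset.sum_congr rfl fun l _ => ?_
  split_ifs with h
  · rw [he.swap h, sub_mul, mul_smul_comm, smul_mul_assoc, neg_smul, sub_eq_add_neg]
  · rw [add_zero]

/-- Linear forms in a quantum exterior algebra with quantum matrix coefficients. -/
theorem IsQMat.isQExt_sum {x : Fin n → Fin n → R} (hx : IsQMat q x) {e : Fin n → R}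
    (he : IsQExt q e) (hxe : ∀ i j k, Commute (x i j) (e k)) (hq₀ : q ≠ 0) :
    IsQExt q fun k => ∑ l, x k l * e l := by
  have key : ∀ k i, (∑ l, x k l * e l) * ∑ l, x i l * e l =
      ∑ j, ∑ l, if j < l then (x k j * x i l - q • (x k l * x i j)) * (e j * e l) else 0 := by
    intro k i
    rw [← he.sum_sum_mul fun j l => x k j * x i l, Finset.sum_mul_sum]
    refine Finset.sum_congr rfl fun j _ => Finset.sum_congr rfl fun l _ => ?_
    rw [mul_assoc, ← mul_assoc (e j), ← (hxe i l j).eq]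
    simp only [mul_assoc]
  constructor
  · intro k
    rw [key]
    refine Finset.sum_eq_zero fun j _ => Finset.sum_eq_zero fun l _ => ?_
    split_ifs with h
    · rw [hx.row h, sub_self, zero_mul]
    · rfl
  · intro i k hik
    rw [key, key, Finset.smul_sum]
    refine Finset.sum_congr rfl fun j _ => ?_
    rw [Finset.smul_sum]
    refine Finset.sum_congr rfl fun l _ => ?_
    split_ifs with h
    · rw [hx.diag hik h, ← hx.anti hik h, ← smul_mul_assoc (-q)]
      congr 1
      match_scalars <;> field_simp
      ring
    · rw [smul_zero]

/-- The R-matrix form of the defining relations: all nine relative positions of two entries obey one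
formula. -/
theorem IsQMat.exchange {x : Fin n → Fin n → R} (hx : IsQMat q x) (hq₀ : q ≠ 0)
    (i a k l : Fin n) :
    (if l = a then q⁻¹ else 1 : ℂ) • (x i a * x k l) +
        (if a < l then (q⁻¹ - q) • (x i l * x k a) else 0) =
      (if k = i then q⁻¹ else 1 : ℂ) • (x k l * x i a) +
        if k < i then (q⁻¹ - q) • (x i l * x k a) else 0 := by
  rcases lt_trichotomy i k with hik | rfl | hik <;> rcases lt_trichotomy a l with hal | rfl | hal
  · simp only [hik.ne', hal.ne', hal, hik.not_gt, if_true, if_false, hx.diag hik hal]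
    module
  · simp only [hik.ne', hik.not_gt, lt_irrefl, if_true, if_false, hx.col hik, smul_smul]
    rw [inv_mul_cancel₀ hq₀]
  · simp only [hal.ne, hal.not_gt, hik.ne', hik.not_gt, if_false, hx.anti hik hal]
  · simp only [hal.ne', hal, lt_irrefl, if_true, if_false, hx.row hal]
    match_scalars
    field_simp
    ring
  · simp
  · simp only [hal.ne, hal.not_gt, lt_irrefl, if_true, if_false, hx.row hal, smul_smul,
      inv_mul_cancel₀ hq₀]
  · simp only [hal, hal.ne', hik.ne, hik, if_true, if_false, hx.anti hik hal]
  · simp only [hik, hik.ne, lt_irrefl, if_true, if_false, hx.col hik]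
    match_scalars
    field_simp
    ring
  · simp only [hal.ne, hal.not_gt, hik, hik.ne, if_true, if_false, hx.diag hik hal]
    rw [hx.anti hik hal]
    module

/-- In each entry, the coefficient of `e l` on the two sides is the exchange relation. -/
theorem IsQMat.mul_extMat {x : Fin n → Fin n → R} (hx : IsQMat q x) {e : Fin n → R}
    (hxe : ∀ i j k, Commute (x i j) (e k)) (hq₀ : q ≠ 0) (k : Fin n) :
    Matrix.of x * ∑ l, Matrix.scalar (Fin n) (x k l) * extMat q e l =
      extMat q (fun k => ∑ l, x k l * e l) k * Matrix.of x := by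
  ext i a
  rw [extMat_mul_apply]
  have h1 : ∀ l, (Matrix.of x * (Matrix.scalar (Fin n) (x k l) * extMat q e l)) i a =
      (if l = a then q⁻¹ else 1 : ℂ) • (x i a * x k l * e l) +
        if a = l then ∑ c, if l < c then (q⁻¹ - q) • (x i c * x k l * e c) else 0 else 0 := by
    intro l
    rw [← mul_assoc, mul_extMat_apply]
    simp [Matrix.scalar_apply, Matrix.mul_diagonal]
  rw [Finset.mul_sum, Matrix.sum_apply]
  simp only [h1, Finset.sum_add_distrib, Finset.sum_ite_eq, Finset.mem_univ, if_true,
    Matrix.of_apply, Finset.sum_mul, Finset.smul_sum]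
  have h2 : ∀ i l a k, x i l * e l * x k a = x i l * x k a * e l := fun i l a k => by
    rw [mul_assoc, ← (hxe k a l).eq, mul_assoc]
  have h3 : (if k < i then ∑ l, (q⁻¹ - q) • (x i l * e l * x k a) else 0) =
      ∑ l, if k < i then (q⁻¹ - q) • (x i l * e l * x k a) else 0 := by
    split_ifs <;> simp
  rw [h3, ← Finset.sum_add_distrib, ← Finset.sum_add_distrib]
  refine Finset.sum_congr rfl fun l _ => ?_
  have := congrArg (· * e l) (hx.exchange hq₀ i a k l)
  simpa only [add_mul, ite_mul, zero_mul, smul_mul_assoc, h2] using this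

theorem prod_extMat_apply_of_lt (g : Fin n → R) (l : List (Fin n)) {b a : Fin n} (hba : b < a) :
    (l.map (extMat q g)).prod b a = 0 := by
  induction l generalizing b with
  | nil => exact Matrix.one_apply_ne hba.ne
  | cons k l ih =>
    rw [List.map_cons, List.prod_cons, extMat_mul_apply, ih hba, mul_zero, smul_zero, zero_add]
    split_ifs with h
    · rw [ih (h.trans hba), mul_zero, smul_zero]
    · rfl

theorem prod_extMat_apply_self (g : Fin n → R) (l : List (Fin n)) (a : Fin n) :
    (l.map (extMat q g)).prod a a =
      (l.map fun k => if k = a then q⁻¹ else 1).prod • (l.map g).prod := by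
  induction l with
  | nil => simp
  | cons k l ih =>
    rw [List.map_cons, List.prod_cons, extMat_mul_apply, ih, List.map_cons, List.prod_cons,
      List.map_cons, List.prod_cons, mul_smul_comm, smul_smul, add_eq_left]
    split_ifs with h
    · rw [prod_extMat_apply_of_lt g l h, mul_zero, smul_zero]
    · rfl

theorem prod_extMat_apply_of_notMem (g : Fin n → R) (l : List (Fin n)) {b a : Fin n}
    (hba : b ≠ a) (ha : a ∉ l) : (l.map (extMat q g)).prod b a = 0 := by
  induction l generalizing b with
  | nil => exact Matrix.one_apply_ne hba
  | cons k l ih =>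
    have ha' : a ∉ l := fun h => ha (List.mem_cons_of_mem _ h)
    have hk : k ≠ a := fun h => ha (h ▸ List.mem_cons_self)
    rw [List.map_cons, List.prod_cons, extMat_mul_apply, ih hba ha', ih hk ha', mul_zero,
      mul_zero, smul_zero, smul_zero, ite_self, add_zero]

/-- Leaving row `b` means emitting `g b` at some letter `k < b`. As the list increases, the letter
`b` is still to come, and `g b` occurs twice. For the full index set this kills all entries below
the diagonal. -/
theorem prod_extMat_apply_of_mem {g : Fin n → R} (hg : IsQExt q g) {l : List (Fin n)}
    (hl : l.Pairwise (· < ·)) {b a : Fin n} (hab : a < b) (hb : b ∈ l) :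
    (l.map (extMat q g)).prod b a = 0 := by
  induction l with
  | nil => simp at hb
  | cons k l ih =>
    obtain ⟨hk, hl'⟩ := List.pairwise_cons.1 hl
    rw [List.map_cons, List.prod_cons, extMat_mul_apply]
    rcases List.mem_cons.1 hb with rfl | hb'
    · rw [if_neg (lt_irrefl b), prod_extMat_apply_of_notMem g l hab.ne'
        fun h => (hk a h).not_gt hab, mul_zero, smul_zero, zero_add]
    · rw [ih hl' hb', mul_zero, smul_zero, zero_add, if_pos (hk b hb')]
      rcases lt_trichotomy k a with hka | rfl | hka
      · rw [prod_extMat_apply_of_lt g l hka, mul_zero, smul_zero]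
      · rw [prod_extMat_apply_self, mul_smul_comm, hg.mul_prod_of_mem hl' hb', smul_zero,
          smul_zero]
      · rw [prod_extMat_apply_of_notMem g l hka.ne' fun h => (hk a h).not_gt hka, mul_zero,
          smul_zero]

/-- The functions of an exterior family `g` that are combinations of the monomials of degree
`m` in `g`. -/
def extSpan (q : ℂ) (n : ℕ) (R : Type*) [Ring R] [Algebra ℂ R] (m : ℕ) :
    Submodule ℂ ({g : Fin n → R // IsQExt q g} → R) :=
  Submodule.span ℂ (Set.range fun (K : {K : Finset (Fin n) // K.card = m})
    (g : {g : Fin n → R // IsQExt q g}) => extMonomial g.1 K.1)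

theorem mul_mem_extSpan {m : ℕ} {F : {g : Fin n → R // IsQExt q g} → R}
    (hF : F ∈ extSpan q n R m) (x : Fin n) :
    (fun g => g.1 x * F g) ∈ extSpan q n R (m + 1) := by
  induction hF using Submodule.span_induction with
  | mem F hF =>
    obtain ⟨K, rfl⟩ := hF
    by_cases hx : x ∈ K.1
    · convert (extSpan q n R (m + 1)).zero_mem with g
      exact g.2.mul_extMonomial_of_mem hx
    · convert (extSpan q n R (m + 1)).smul_mem ((-q) ^ (K.1.sort (· ≤ ·)).countP (· < x))
        (Submodule.subset_span ⟨⟨insert x K.1, by rw [Finset.card_insert_of_notMem hx, K.2]⟩, rfl⟩)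
        with g
      exact g.2.mul_extMonomial_of_notMem hx
  | zero =>
    convert (extSpan q n R (m + 1)).zero_mem with g
    exact mul_zero _
  | add F G _ _ hF hG =>
    convert (extSpan q n R (m + 1)).add_mem hF hG with g
    exact mul_add _ _ _
  | smul c F _ hF =>
    convert (extSpan q n R (m + 1)).smul_mem c hF with g
    exact mul_smul_comm _ _ _

theorem prod_extMat_mem_extSpan (l : List (Fin n)) (b a : Fin n) :
    (fun g : {g : Fin n → R // IsQExt q g} => (l.map (extMat q g.1)).prod b a) ∈
      extSpan q n R l.length := by
  induction l generalizing b with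
  | nil =>
    have : (1 : {g : Fin n → R // IsQExt q g} → R) ∈ extSpan q n R 0 :=
      Submodule.subset_span ⟨⟨∅, rfl⟩, funext fun g => by simp [extMonomial]⟩
    refine (congrArg (· ∈ extSpan q n R 0) (funext fun g => ?_)).mpr
      ((extSpan q n R 0).smul_mem (if b = a then 1 else 0) this)
    by_cases h : b = a <;> simp [h]
  | cons k l ih =>
    have h1 := (extSpan q n R (l.length + 1)).smul_mem (if k = b then q⁻¹ else 1)
      (mul_mem_extSpan (ih b) k)
    have h2 := (extSpan q n R (l.length + 1)).smul_mem (if k < b then q⁻¹ - q else 0)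
      (mul_mem_extSpan (ih k) b)
    refine (congrArg (· ∈ extSpan q n R (l.length + 1)) (funext fun g => ?_)).mpr
      ((extSpan q n R (l.length + 1)).add_mem h1 h2)
    rw [List.map_cons, List.prod_cons, extMat_mul_apply]
    by_cases h : k < b <;> by_cases h' : k = b <;> simp [h, h']

/-- The coefficients of the entries of a product of the matrices `extMat q g k` with respect to
the monomials in `g` do not depend on `g`. -/
theorem exists_prod_extMat_coeff (q : ℂ) (n : ℕ) (R : Type*) [Ring R] [Algebra ℂ R]
    (l : List (Fin n)) {t : ℕ} (ht : l.length = t) (b a : Fin n) :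
    ∃ ν : {K : Finset (Fin n) // K.card = t} → ℂ, ∀ g : Fin n → R, IsQExt q g →
      (l.map (extMat q g)).prod b a = ∑ K, ν K • extMonomial g K.1 := by
  subst ht
  obtain ⟨ν, hν⟩ := (Submodule.mem_span_range_iff_exists_fun ℂ).1
    (prod_extMat_mem_extSpan (q := q) (R := R) l b a)
  refine ⟨ν, fun g hg => ?_⟩
  have := congrFun hν ⟨g, hg⟩
  simpa using this.symm

end ExtMat

/-! ### A faithful model of the exterior algebra by creation operators. -/

section Fermion

variable {n : ℕ} {A : Type*} [Ring A] [Algebra ℂ A]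

/-- The operator of left multiplication by the `i`-th generator on the quantum exterior algebra
with coefficients in `A`, whose elements are identified with functions on subsets. -/
def creation (A : Type*) [Ring A] [Algebra ℂ A] (q : ℂ) (i : Fin n) :
    Module.End ℂ (Finset (Fin n) → A) where
  toFun f L := if i ∈ L then (-q) ^ (L.filter (· < i)).card • f (L.erase i) else 0
  map_add' f g := by
    funext L
    by_cases h : i ∈ L <;> simp [h]
  map_smul' c f := by
    funext L
    by_cases h : i ∈ L <;> simp [h, smul_comm c]

theorem creation_apply (q : ℂ) (i : Fin n) (f : Finset (Fin n) → A) (L : Finset (Fin n)) :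
    creation A q i f L =
      if i ∈ L then (-q) ^ (L.filter (· < i)).card • f (L.erase i) else 0 := rfl

theorem isQExt_creation (q : ℂ) : IsQExt q (creation (n := n) A q) where
  sq i := by
    refine LinearMap.ext fun f => funext fun L => ?_
    simp [Module.End.mul_apply, creation_apply]
  swap {j l} hjl := by
    refine LinearMap.ext fun f => funext fun L => ?_
    rw [Module.End.mul_apply, LinearMap.smul_apply, Pi.smul_apply, Module.End.mul_apply]
    simp only [creation_apply, Finset.mem_erase]
    by_cases hj : j ∈ L <;> by_cases hl : l ∈ L <;> simp only [hj, hl, hjl.ne, hjl.ne', and_true,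
      and_false, if_true, if_false, ne_eq, not_false_eq_true, smul_zero]
    have h1 : (L.erase l).filter (· < j) = L.filter (· < j) := by
      ext s
      simp only [Finset.mem_filter, Finset.mem_erase]
      constructor
      · exact fun h => ⟨h.1.2, h.2⟩
      · exact fun h => ⟨⟨(h.2.trans hjl).ne, h.1⟩, h.2⟩
    have h2 : (L.filter (· < l)).card = ((L.erase j).filter (· < l)).card + 1 := by
      rw [Finset.filter_erase, Finset.card_erase_add_one]
      simp [hj, hjl]
    rw [h1, h2, Finset.erase_right_comm, smul_smul, smul_smul, smul_smul]
    congr 1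
    ring

/-- Each operator creates an index below all those present, so no power of `-q` appears. Distinct
monomials send the vacuum to distinct basis vectors, so coefficients can be read off. -/
theorem creation_prod_vacuum (q : ℂ) {l : List (Fin n)} (hl : l.Pairwise (· < ·)) :
    (l.map (creation A q)).prod (Pi.single ∅ 1) = Pi.single l.toFinset 1 := by
  induction l with
  | nil => simp
  | cons k l ih =>
    obtain ⟨hk, hl'⟩ := List.pairwise_cons.1 hl
    have hkl : k ∉ l.toFinset := fun h => (hk k (by simpa using h)).false
    rw [List.map_cons, List.prod_cons, Module.End.mul_apply, ih hl']
    funext L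
    rw [creation_apply, List.toFinset_cons]
    by_cases hL : L = insert k l.toFinset
    · have h0 : (insert k l.toFinset).filter (· < k) = ∅ := by
        rw [Finset.filter_eq_empty_iff]
        intro x hx
        rcases Finset.mem_insert.1 hx with rfl | hx
        · exact lt_irrefl _
        · exact (hk x (by simpa using hx)).not_gt
      rw [hL, h0, if_pos (Finset.mem_insert_self _ _), Finset.erase_insert hkl]
      simp
    · rw [Pi.single_eq_of_ne hL]
      split_ifs with h
      · rw [Pi.single_eq_of_ne, smul_zero]
        rintro he
        exact hL (by rw [← he, Finset.insert_erase h])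
      · rfl

/-- The coefficient of the monomial indexed by `L` in the image of the vacuum. -/
def extCoeff (L : Finset (Fin n)) : Module.End ℂ (Finset (Fin n) → A) →ₗ[ℂ] A :=
  LinearMap.proj L ∘ₗ LinearMap.applyₗ (Pi.single ∅ 1)

theorem extCoeff_apply (L : Finset (Fin n)) (T : Module.End ℂ (Finset (Fin n) → A)) :
    extCoeff L T = T (Pi.single ∅ 1) L := rfl

theorem extCoeff_extMonomial (q : ℂ) (K L : Finset (Fin n)) :
    extCoeff L (extMonomial (creation A q) K) = if L = K then 1 else 0 := by
  rw [extCoeff_apply, extMonomial, creation_prod_vacuum q (sort_pairwise_lt K),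
    Finset.sort_toFinset, Pi.single_apply]

/-- Coefficients acting on the quantum exterior algebra. -/
abbrev coeffMul (n : ℕ) (A : Type*) [Ring A] [Algebra ℂ A] :
    A →ₐ[ℂ] Module.End ℂ (Finset (Fin n) → A) :=
  Algebra.lsmul ℂ ℂ (Finset (Fin n) → A)

theorem extCoeff_coeffMul_mul (L : Finset (Fin n)) (a : A)
    (T : Module.End ℂ (Finset (Fin n) → A)) :
    extCoeff L (coeffMul n A a * T) = a * extCoeff L T := rfl

theorem commute_coeffMul_creation (q : ℂ) (a : A) (i : Fin n) :
    Commute (coeffMul n A a) (creation A q i) := by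
  refine LinearMap.ext fun f => funext fun L => ?_
  by_cases h : i ∈ L <;> simp [creation_apply, h]

theorem commute_coeffMul_extMonomial (q : ℂ) (a : A) (K : Finset (Fin n)) :
    Commute (coeffMul n A a) (extMonomial (creation A q) K) := by
  refine Commute.list_prod_right _ _ fun y hy => ?_
  obtain ⟨i, -, rfl⟩ := List.mem_map.1 hy
  exact commute_coeffMul_creation q a i

end Fermion

/-! ### Commutation of the trace with the `σ_k`, and centrality of the determinant. -/

section Commute

variable {q : ℂ} {n : ℕ} {A : Type*} [Ring A] [Algebra ℂ A]

theorem semiconjBy_list_prod {M ι : Type*} [Monoid M] {a : M} {f g : ι → M}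
    (h : ∀ i, SemiconjBy a (f i) (g i)) (l : List ι) :
    SemiconjBy a (l.map f).prod (l.map g).prod := by
  induction l with
  | nil => simp
  | cons i l ih => simpa using (h i).mul_right ih

theorem extMonomial_sum {x : Fin n → Fin n → A} {R : Type*} [Ring R] [Algebra ℂ R]
    (φ : A →ₐ[ℂ] R) {e : Fin n → R} (he : IsQExt q e) (hφ : ∀ a k, Commute (φ a) (e k)) {t : ℕ}
    (I : {I : Finset (Fin n) // I.card = t}) :
    extMonomial (fun k => ∑ l, φ (x k l) * e l) I.1 =
      ∑ J, φ (qMinor q x I J) * extMonomial e J.1 := by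
  rw [← prod_ofFn_orderEmbOfFin I.1 I.2, he.prod_sum _ fun _ _ _ => hφ _ _]
  simp only [qMinor, map_qDet]

/-- The exchange relations between entries and minors of a quantum matrix. -/
theorem exists_minor_exchange [Nontrivial A] (hq₀ : q ≠ 0) {x : Fin n → Fin n → A}
    (hx : IsQMat q x) (t : ℕ) :
    ∃ ν : {I : Finset (Fin n) // I.card = t} → Fin n → Fin n →
        {I : Finset (Fin n) // I.card = t} → ℂ,
      (∀ I b a K, b < a → ν I b a K = 0) ∧
      (∀ I a K, ν I a a K =
        if K = I then ((I.1.sort (· ≤ ·)).map fun k => if k = a then q⁻¹ else 1).prod else 0) ∧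
      (∀ I b a K, a < b → b ∈ I.1 → ν I b a K = 0) ∧
      ∀ I i a L, ∑ b, ∑ J, x i b * qMinor q x I J * algebraMap ℂ A (ν J b a L) =
        ∑ b, ∑ K, algebraMap ℂ A (ν I i b K) * (qMinor q x K L * x b a) := by
  let R := Module.End ℂ (Finset (Fin n) → A)
  let E : Fin n → R := creation A q
  have hE : IsQExt q E := isQExt_creation q
  -- These coefficients are independent of the exterior family, so the same `ν` serves for `E` and
  -- for the linear forms `y` below.
  choose ν hν using fun (I : {I : Finset (Fin n) // I.card = t}) (b a : Fin n) =>
    exists_prod_extMat_coeff q n R (I.1.sort (· ≤ ·)) ((Finset.length_sort _).trans I.2) b a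
  have hcoeff : ∀ I b a (K : {I : Finset (Fin n) // I.card = t}),
      extCoeff K.1 (((I.1.sort (· ≤ ·)).map (extMat q E)).prod b a) =
        algebraMap ℂ A (ν I b a K) := by
    intro I b a K
    rw [hν I b a E hE, map_sum, Finset.sum_eq_single K]
    · rw [map_smul, extCoeff_extMonomial, if_pos rfl, Algebra.algebraMap_eq_smul_one]
    · intro K' _ hK
      rw [map_smul, extCoeff_extMonomial, if_neg fun h => hK (Subtype.ext h.symm), smul_zero]
    · simp
  have hinj := FaithfulSMul.algebraMap_injective ℂ A
  refine ⟨ν, fun I b a K h => hinj ?_, fun I a K => hinj ?_, fun I b a K h hb => hinj ?_,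
    fun I i a L => ?_⟩
  · rw [← hcoeff, prod_extMat_apply_of_lt _ _ h, map_zero, map_zero]
  · rw [← hcoeff, prod_extMat_apply_self, map_smul]
    have := extCoeff_extMonomial (A := A) q I.1 K.1
    rw [extMonomial] at this
    rw [this]
    by_cases h : K = I
    · rw [if_pos h, if_pos (congrArg _ h), Algebra.algebraMap_eq_smul_one]
    · rw [if_neg h, if_neg fun h' => h (Subtype.ext h'), smul_zero, map_zero]
  · rw [← hcoeff, prod_extMat_apply_of_mem hE (sort_pairwise_lt _) h (by simpa using hb), map_zero,
      map_zero]
  · let X : Fin n → Fin n → R := fun i j => coeffMul n A (x i j)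
    have hX : IsQMat q X := hx.map (coeffMul n A)
    have hXE : ∀ i j k, Commute (X i j) (E k) := fun i j k => commute_coeffMul_creation q _ _
    let y : Fin n → R := fun k => ∑ l, X k l * E l
    have hy : IsQExt q y := hX.isQExt_sum hE hXE hq₀
    let φ : A →ₐ[ℂ] Matrix (Fin n) (Fin n) R := (Matrix.scalarAlgHom (Fin n) ℂ).comp (coeffMul n A)
    -- The two monomials are expanded in opposite orders: on the left into minors first and then by
    -- `ν`, on the right by `ν` first and then into minors. The coefficients of the monomial `L`
    -- give the exchange identity.
    have h1 : SemiconjBy (Matrix.of X)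
        (extMonomial (fun k => ∑ l, φ (x k l) * extMat q E l) I.1)
        (extMonomial (extMat q y) I.1) :=
      semiconjBy_list_prod (fun k => hX.mul_extMat hXE hq₀ k) _
    rw [extMonomial_sum φ (hE.extMat hq₀)] at h1
    · have h2 := congrArg (fun M : Matrix (Fin n) (Fin n) R => extCoeff L.1 (M i a)) h1.eq
      simp only [Matrix.mul_apply, map_sum] at h2
      convert h2 using 2 with b _ b _
      · rw [Matrix.sum_apply, Finset.mul_sum, map_sum]
        refine Finset.sum_congr rfl fun J _ => ?_
        have h3 : (φ (qMinor q x I J) * extMonomial (extMat q E) J.1) b a =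
            coeffMul n A (qMinor q x I J) * extMonomial (extMat q E) J.1 b a :=
          Matrix.diagonal_mul _ _ _ _
        rw [h3, Matrix.of_apply, extCoeff_coeffMul_mul, extCoeff_coeffMul_mul, mul_assoc,
          ← hcoeff]
        rfl
      · rw [extMonomial, hν I i b y hy, Finset.sum_mul, map_sum]
        refine Finset.sum_congr rfl fun K _ => ?_
        rw [extMonomial_sum (coeffMul n A) hE fun a k => commute_coeffMul_creation q a k,
          smul_mul_assoc, map_smul, ← Algebra.smul_def, Finset.sum_mul, map_sum,
          Finset.sum_eq_single L]
        · rw [Matrix.of_apply, mul_assoc, ← (commute_coeffMul_extMonomial q _ _).eq,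
            extCoeff_coeffMul_mul, extCoeff_coeffMul_mul, extCoeff_extMonomial, if_pos rfl,
            mul_one]
        · intro J _ hJ
          rw [Matrix.of_apply, mul_assoc, ← (commute_coeffMul_extMonomial q _ _).eq,
            extCoeff_coeffMul_mul, extCoeff_coeffMul_mul, extCoeff_extMonomial,
            if_neg fun h => hJ (Subtype.ext h.symm), mul_zero, mul_zero]
        · simp
    · intro r k
      rw [Commute, SemiconjBy]
      refine Matrix.ext fun b a => ?_
      have h3 : (φ r * extMat q E k) b a = coeffMul n A r * extMat q E k b a :=
        Matrix.diagonal_mul _ _ _ _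
      have h4 : (extMat q E k * φ r) b a = extMat q E k b a * coeffMul n A r :=
        Matrix.mul_diagonal _ _ _ _
      rw [h3, h4]
      have hc := fun k => commute_coeffMul_creation (n := n) q r k
      change Commute (coeffMul n A r) (extMat q E k b a)
      rw [extMat]
      refine Commute.add_right ?_ ?_
      · split_ifs
        exacts [(hc k).smul_right _, (hc k).smul_right _, Commute.zero_right _]
      · split_ifs
        exacts [(hc b).smul_right _, Commute.zero_right _]

theorem trace_map_mul_comm {ι : Type*} [Fintype ι] (M : Matrix ι ι ℂ) (W : Matrix ι ι A) :
    (M.map (algebraMap ℂ A) * W).trace = (W * M.map (algebraMap ℂ A)).trace := by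
  simp only [Matrix.trace, Matrix.diag, Matrix.mul_apply, Matrix.map_apply]
  rw [Finset.sum_comm]
  simp only [Algebra.commutes]

/-- Over a noncommutative ring traces are not cyclic in general, but they are when one factor has
scalar entries. -/
theorem trace_eq_of_mul_map_eq {ι : Type*} [Fintype ι] [DecidableEq ι] {M : Matrix ι ι ℂ}
    (hM : M.det ≠ 0) {U V : Matrix ι ι A}
    (h : U * M.map (algebraMap ℂ A) = M.map (algebraMap ℂ A) * V) : U.trace = V.trace := by
  have h1 : M.map (algebraMap ℂ A) * M⁻¹.map (algebraMap ℂ A) = 1 := by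
    rw [← Matrix.map_mul, Matrix.mul_nonsing_inv _ (isUnit_iff_ne_zero.2 hM)]
    simp
  have h2 : M⁻¹.map (algebraMap ℂ A) * M.map (algebraMap ℂ A) = 1 := by
    rw [← Matrix.map_mul, Matrix.nonsing_inv_mul _ (isUnit_iff_ne_zero.2 hM)]
    simp
  calc U.trace = (U * M.map (algebraMap ℂ A) * M⁻¹.map (algebraMap ℂ A)).trace := by
        rw [mul_assoc, h1, mul_one]
    _ = V.trace := by rw [h, ← trace_map_mul_comm, ← mul_assoc, h2, one_mul]

/-- The trace of a quantum matrix commutes with the sums of its principal minors. -/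
theorem IsQMat.commute_trace_qSigma [Nontrivial A] (hq₀ : q ≠ 0) {x : Fin n → Fin n → A}
    (hx : IsQMat q x) (t : ℕ) : Commute (∑ i, x i i) (qSigma q x t) := by
  obtain ⟨ν, hlt, hself, -, hν⟩ := exists_minor_exchange hq₀ hx t
  let S := {I : Finset (Fin n) // I.card = t}
  let M : Matrix (Fin n × S) (Fin n × S) ℂ := fun p r => ν p.2 p.1 r.1 r.2
  -- Ordered by the first index, `M` is block triangular, and its diagonal blocks are diagonal
  -- matrices of products of `1` and `q⁻¹`.
  have hM : M.det ≠ 0 := by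
    have hb : M.transpose.BlockTriangular Prod.fst := fun p r h => hlt _ _ _ _ h
    rw [← Matrix.det_transpose, hb.det_fintype, Finset.prod_ne_zero_iff]
    intro a _
    have : M.transpose.toSquareBlock Prod.fst a = Matrix.diagonal fun p =>
        ((p.1.2.1.sort (· ≤ ·)).map fun k => if k = a then q⁻¹ else 1).prod := by
      ext ⟨⟨b, I⟩, rfl⟩ ⟨⟨c, J⟩, hc⟩
      obtain rfl : c = b := hc
      rw [Matrix.toSquareBlock_def, Matrix.of_apply, Matrix.diagonal_apply]
      refine (hself J c I).trans ?_
      by_cases h : I = J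
      · subst h; simp
      · rw [if_neg h, if_neg]
        simpa using h
    rw [this, Matrix.det_diagonal, Finset.prod_ne_zero_iff]
    intro p _
    refine List.prod_ne_zero fun h => ?_
    obtain ⟨k, -, hk⟩ := List.mem_map.1 h
    split_ifs at hk
    · exact inv_ne_zero hq₀ hk
    · exact one_ne_zero hk
  let U : Matrix (Fin n × S) (Fin n × S) A := fun p r => x p.1 r.1 * qMinor q x p.2 r.2
  let V : Matrix (Fin n × S) (Fin n × S) A := fun p r => qMinor q x p.2 r.2 * x p.1 r.1
  have hUV : U * M.map (algebraMap ℂ A) = M.map (algebraMap ℂ A) * V := by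
    ext ⟨i, I⟩ ⟨a, L⟩
    rw [Matrix.mul_apply, Matrix.mul_apply, Fintype.sum_prod_type, Fintype.sum_prod_type]
    exact hν I i a L
  have := trace_eq_of_mul_map_eq hM hUV
  simp only [Matrix.trace, Matrix.diag, Fintype.sum_prod_type] at this
  rw [Finset.sum_comm (f := fun i I => V (i, I) (i, I))] at this
  rw [Commute, SemiconjBy, qSigma, Finset.sum_mul_sum, Finset.sum_mul_sum]
  exact this

/-- The quantum determinant commutes with the entries of a quantum matrix. -/
theorem IsQMat.commute_qSigma_self [Nontrivial A] (hq₀ : q ≠ 0) {x : Fin n → Fin n → A}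
    (hx : IsQMat q x) (i a : Fin n) : Commute (x i a) (qSigma q x n) := by
  obtain ⟨ν, hlt, hself, hgt, hν⟩ := exists_minor_exchange hq₀ hx n
  let I : {I : Finset (Fin n) // I.card = n} := ⟨Finset.univ, by simp⟩
  have huniq : ∀ J : {I : Finset (Fin n) // I.card = n}, J = I := fun J =>
    Subtype.ext (Finset.eq_univ_of_card _ (by simpa using J.2))
  have hsum : ∀ f : {I : Finset (Fin n) // I.card = n} → A, ∑ J, f J = f I := fun f =>
    Fintype.sum_eq_single I fun J hJ => absurd (huniq J) hJ
  -- For the full index set each `a` occurs exactly once, so the coefficient matrix is `q⁻¹` times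
  -- the identity and the exchange relation becomes commutation.
  have hdiag : ∀ a, ν I a a I = q⁻¹ := fun a => by
    rw [hself, if_pos rfl, ← List.prod_toFinset _ (Finset.sort_nodup _ _)]
    simp [I]
  have hne : ∀ b a, b ≠ a → ν I b a I = 0 := fun b a h => by
    rcases lt_or_gt_of_ne h with h | h
    · exact hlt _ _ _ _ h
    · exact hgt _ _ _ _ h (Finset.mem_univ _)
  have := hν I i a I
  simp only [hsum] at this
  rw [Finset.sum_eq_single a, Finset.sum_eq_single i, hdiag, hdiag, ← Algebra.commutes,
    ← Algebra.smul_def, ← Algebra.smul_def] at this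
  · rw [qSigma, hsum]
    exact smul_right_injective A (inv_ne_zero hq₀) this
  · intro b _ hb
    rw [hne _ _ hb.symm, map_zero, zero_mul]
  · simp
  · intro b _ hb
    rw [hne _ _ hb, map_zero, mul_zero]
  · simp

end Commute

instance nontrivial_oqM (n : ℕ) (q : ℂ) : Nontrivial (OqM n q) :=
  (diagRestrict n q).toRingHom.domain_nontrivial

theorem OqM.commute_sigma_one_sigma {q : ℂ} (hq₀ : q ≠ 0) (n k : ℕ) :
    Commute (OqM.sigma n q 1) (OqM.sigma n q k) := by
  rw [OqM.sigma_one]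
  exact (OqM.isQMat n q).commute_trace_qSigma hq₀ k

/-- The quantum determinant is central. -/
theorem OqM.commute_det {q : ℂ} (hq₀ : q ≠ 0) (n : ℕ) (f : OqM n q) :
    Commute (OqM.det n q) f := by
  have h : Algebra.adjoin ℂ (Set.range fun p : Fin n × Fin n => OqM.x q p.1 p.2) ≤
      Subalgebra.centralizer ℂ {OqM.det n q} := by
    refine Algebra.adjoin_le ?_
    rintro _ ⟨p, rfl⟩
    rw [SetLike.mem_coe, Subalgebra.mem_centralizer_iff]
    rintro _ rfl
    rw [← OqM.sigma_self]
    exact ((OqM.isQMat n q).commute_qSigma_self hq₀ p.1 p.2).eq.symm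
  rw [OqM.adjoin_x_eq_top] at h
  exact (Subalgebra.mem_centralizer_iff ℂ).1 (h (Algebra.mem_top (x := f))) _ rfl

/-! ### The centralizer in `O_q(M_n)`. -/

section Mat

variable {q : ℂ}

theorem qMinor_diagonal {n t : ℕ} {A : Type*} [CommRing A] [Algebra ℂ A] (d : Fin n → A)
    (I : {I : Finset (Fin n) // I.card = t}) :
    qMinor q (fun i j => if i = j then d i else 0) I I = ∏ i ∈ I.1, d i := by
  have hlen : permLength (1 : Equiv.Perm (Fin t)) = 0 := by
    rw [permLength, Finset.card_eq_zero, Finset.filter_eq_empty_iff]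
    exact fun p _ h => h.1.not_gt h.2
  rw [qMinor, qDet, Finset.sum_eq_single 1]
  · rw [hlen, pow_zero, one_smul, List.prod_ofFn]
    simp only [Equiv.Perm.coe_one, id, if_true]
    exact (Finset.prod_map Finset.univ (I.1.orderEmbOfFin I.2).toEmbedding d).symm.trans
      (by simp)
  · intro s _ hs
    obtain ⟨a, ha⟩ : ∃ a, a ≠ s a := by
      by_contra! h
      exact hs (Equiv.ext fun a => (h a).symm)
    rw [List.prod_ofFn, Finset.prod_eq_zero (Finset.mem_univ a), smul_zero]
    rw [if_neg]
    exact fun h => ha ((I.1.orderEmbOfFin I.2).injective h)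
  · simp

theorem diagRestrict_sigma (n : ℕ) (q : ℂ) (k : ℕ) :
    diagRestrict n q (OqM.sigma n q k) = MvPolynomial.esymm (Fin n) ℂ k := by
  rw [OqM.sigma, qSigma, map_sum, MvPolynomial.esymm,
    Finset.sum_subtype (p := fun I => I.card = k) (Finset.powersetCard k Finset.univ) (by simp)
      fun I => ∏ i ∈ I, (MvPolynomial.X i : MvPolynomial (Fin n) ℂ)]
  refine Finset.sum_congr rfl fun I _ => ?_
  rw [← qMinor_diagonal (q := q), qMinor, map_qDet]
  simp only [diagRestrict_x]
  rfl

/-- The centralizer of the trace in `O_q(M_n)`. -/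
theorem OqM.centralizer_sigma_one (hq₀ : q ≠ 0) (hq : ∀ m : ℕ, 1 ≤ m → q ^ m ≠ 1) (n : ℕ) :
    Subalgebra.centralizer ℂ {OqM.sigma n q 1} =
      Algebra.adjoin ℂ (OqM.sigma n q '' Set.Icc 1 n) := by
  have hle : Algebra.adjoin ℂ (OqM.sigma n q '' Set.Icc 1 n) ≤
      Subalgebra.centralizer ℂ {OqM.sigma n q 1} := by
    refine Algebra.adjoin_le ?_
    rintro _ ⟨k, -, rfl⟩
    rw [SetLike.mem_coe, Subalgebra.mem_centralizer_iff]
    rintro _ rfl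
    exact (OqM.commute_sigma_one_sigma hq₀ n k).eq
  refine le_antisymm (fun f hf => ?_) hle
  have hf' : Commute f (OqM.sigma n q 1) :=
    ((Subalgebra.mem_centralizer_iff ℂ).1 hf _ rfl).symm
  -- The fundamental theorem of symmetric polynomials.
  obtain ⟨p, hp⟩ := MvPolynomial.esymmAlgHom_fin_surjective ℂ (le_refl n)
    ⟨diagRestrict n q f, diagRestrict_isSymmetric hq₀ hq hf'⟩
  have hp' := congrArg Subtype.val hp
  rw [MvPolynomial.esymmAlgHom_apply] at hp'
  have hmem : diagRestrict n q f ∈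
      (Algebra.adjoin ℂ (OqM.sigma n q '' Set.Icc 1 n)).map (diagRestrict n q) := by
    rw [AlgHom.map_adjoin]
    have h1 : diagRestrict n q f ∈
        Algebra.adjoin ℂ (Set.range fun i : Fin n => MvPolynomial.esymm (Fin n) ℂ (i + 1)) := by
      rw [Algebra.adjoin_range_eq_range_aeval]
      exact ⟨p, hp'⟩
    refine Algebra.adjoin_mono ?_ h1
    rintro _ ⟨i, rfl⟩
    exact ⟨_, ⟨i + 1, ⟨by omega, by omega⟩, rfl⟩, diagRestrict_sigma _ _ _⟩
  obtain ⟨g, hg, hgf⟩ := hmem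
  have hg' : Commute g (OqM.sigma n q 1) :=
    ((Subalgebra.mem_centralizer_iff ℂ).1 (hle hg) _ rfl).symm
  have h0 : f - g = 0 := by
    refine eq_zero_of_diagRestrict_eq_zero hq₀ hq (hf'.sub_left hg') ?_
    rw [map_sub, sub_eq_zero]
    exact hgf.symm
  rw [sub_eq_zero.1 h0]
  exact hg

end Mat

/-! ### Central localization and the centralizer in `O_q(GL_n)`. -/

section Localization

universe u in
/-- Inverting a central element kills only its torsion. -/
theorem exists_central_localization {A : Type u} [Ring A] [Algebra ℂ A] {D : A}
    (hD : ∀ a, Commute D a) : ∃ (B : Type u) (_ : Ring B) (_ : Algebra ℂ B) (φ : A →ₐ[ℂ] B) (u : B),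
      φ D * u = 1 ∧ u * φ D = 1 ∧ ∀ h, φ h = 0 → ∃ m : ℕ, D ^ m * h = 0 := by
  let S := Submonoid.powers D
  have hS : ∀ (s : S) (a : A), (s : A) * a = a * s := by
    rintro ⟨_, m, rfl⟩ a
    exact ((hD a).pow_left m).eq
  let : OreLocalization.OreSet S :=
    { ore_right_cancel := fun r₁ r₂ s h => ⟨s, by rw [hS, hS, h]⟩
      oreNum := fun r _ => r
      oreDenom := fun _ s => s
      ore_eq := fun r s => hS s r }
  let φ : A →ₐ[ℂ] OreLocalization S A :=
    { OreLocalization.numeratorRingHom with commutes' := fun c => rfl }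
  let s : S := ⟨D, Submonoid.mem_powers D⟩
  refine ⟨OreLocalization S A, inferInstance, inferInstance, φ, OreLocalization.oreDiv (1 : A) s,
    ?_, ?_, fun h hh => ?_⟩
  · exact OreLocalization.mul_inv s 1
  · exact OreLocalization.mul_inv 1 s
  · have h1 : OreLocalization.oreDiv h (1 : S) = OreLocalization.oreDiv 0 1 :=
      hh.trans OreLocalization.zero_def
    obtain ⟨u, v, h2, h3⟩ := OreLocalization.oreDiv_eq_iff.1 h1
    obtain ⟨m, hm⟩ := u.2
    refine ⟨m, ?_⟩
    have h4 : v = u := by simpa using h3.symm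
    have h5 : v * h = 0 := by simpa using h2.symm
    rw [show D ^ m = v from hm.trans h4.symm, h5]

end Localization

section GeneralLinear

variable {n : ℕ} {q : ℂ}

theorem OqGL.mk_x (i j : Fin n) : OqGL.mk n q (OqM.x q i j) =
    RingQuot.mkAlgHom ℂ (GLRel n q) (FreeAlgebra.ι ℂ (some (i, j))) := by
  rw [OqM.x, OqGL.mk, RingQuot.liftAlgHom_mkAlgHom_apply]
  simp [freeX, freeIncl]

theorem OqGL.exists_lift {B : Type*} [Ring B] [Algebra ℂ B] (φ : OqM n q →ₐ[ℂ] B) {u : B}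
    (h₁ : φ (OqM.det n q) * u = 1) (h₂ : u * φ (OqM.det n q) = 1) :
    ∃ ψ : OqGL n q →ₐ[ℂ] B, ∀ f, ψ (OqGL.mk n q f) = φ f := by
  let ψ₀ : FreeGL n →ₐ[ℂ] B := FreeAlgebra.lift ℂ fun o => o.elim u fun p => φ (OqM.x q p.1 p.2)
  have hψ₀ : ∀ a, ψ₀ (freeIncl n a) = φ (RingQuot.mkAlgHom ℂ (MatRel n q) a) := by
    have : ψ₀.comp (freeIncl n) = φ.comp (RingQuot.mkAlgHom ℂ (MatRel n q)) := by
      refine FreeAlgebra.hom_ext (funext fun p => ?_)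
      simp [ψ₀, freeIncl, OqM.x, freeX]
    exact fun a => DFunLike.congr_fun this a
  have hdet : ψ₀ (freeIncl n (qDet q freeX)) = φ (OqM.det n q) := by
    rw [hψ₀, map_qDet (RingQuot.mkAlgHom ℂ (MatRel n q))]
    rfl
  have hnone : ψ₀ (FreeAlgebra.ι ℂ none) = u := by simp [ψ₀]
  refine ⟨RingQuot.liftAlgHom ℂ ⟨ψ₀, fun a b hab => ?_⟩, fun f => ?_⟩
  · cases hab with
    | mat h => rw [hψ₀, hψ₀, RingQuot.mkAlgHom_rel ℂ h]
    | det_mul_inv => rw [map_mul, hdet, hnone, h₁, map_one]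
    | inv_mul_det => rw [map_mul, hdet, hnone, h₂, map_one]
  · obtain ⟨a, rfl⟩ := RingQuot.mkAlgHom_surjective ℂ (MatRel n q) f
    rw [OqGL.mk, RingQuot.liftAlgHom_mkAlgHom_apply, AlgHom.comp_apply,
      RingQuot.liftAlgHom_mkAlgHom_apply, hψ₀]

/-- `O_q(GL_n)` maps to the Ore localization at the central determinant, so whatever dies in it is
determinant torsion. That `O_q(M_n)` is a domain is never needed. -/
theorem OqGL.exists_pow_det_mul_eq_zero (hq₀ : q ≠ 0) {f : OqM n q} (hf : OqGL.mk n q f = 0) :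
    ∃ m : ℕ, OqM.det n q ^ m * f = 0 := by
  obtain ⟨B, _, _, φ, u, h₁, h₂, hker⟩ := exists_central_localization (OqM.commute_det hq₀ n)
  obtain ⟨ψ, hψ⟩ := OqGL.exists_lift φ h₁ h₂
  refine hker f ?_
  rw [← hψ, hf, map_zero]

/-- The determinant commutes with the image of `O_q(M_n)`, so every letter `det⁻¹` can be absorbed
into one power on the right. -/
theorem OqGL.exists_mul_pow_eq_mk (hq₀ : q ≠ 0) (F : OqGL n q) :
    ∃ (m : ℕ) (g : OqM n q), F * OqGL.mk n q (OqM.det n q) ^ m = OqGL.mk n q g := by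
  have hcomm : ∀ g, OqGL.mk n q (OqM.det n q) * OqGL.mk n q g =
      OqGL.mk n q g * OqGL.mk n q (OqM.det n q) := fun g =>
    ((OqM.commute_det hq₀ n g).map (OqGL.mk n q)).eq
  let p : Submodule ℂ (OqGL n q) :=
    { carrier := {F | ∃ (m : ℕ) (g : OqM n q),
        F * OqGL.mk n q (OqM.det n q) ^ m = OqGL.mk n q g}
      zero_mem' := ⟨0, 0, by rw [zero_mul, map_zero]⟩
      add_mem' := by
        rintro F G ⟨m, g, hg⟩ ⟨k, h, hh⟩
        refine ⟨m + k, g * OqM.det n q ^ k + h * OqM.det n q ^ m, ?_⟩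
        rw [map_add, map_mul, map_mul, ← hg, ← hh, map_pow, map_pow, mul_assoc, mul_assoc,
          ← pow_add, ← pow_add, add_comm k m, add_mul]
      smul_mem' := by
        rintro c F ⟨m, g, hg⟩
        exact ⟨m, c • g, by rw [map_smul, ← hg, smul_mul_assoc]⟩ }
  refine mem_of_left_mul_mem (adjoin_ringQuot_eq_top (GLRel n q)) p ⟨0, 1, by simp⟩ ?_ F
  rintro _ ⟨o, rfl⟩ G ⟨m, g, hg⟩
  cases o with
  | none =>
    refine ⟨m + 1, g, ?_⟩
    rw [pow_succ, ← mul_assoc, mul_assoc _ G, hg, mul_assoc, ← hcomm, ← mul_assoc]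
    have := OqGL.detInv_mul_sigma n q
    rw [OqGL.sigma, OqM.sigma_self] at this
    refine (congrArg (· * OqGL.mk n q g) this).trans (one_mul _)
  | some r =>
    refine ⟨m, OqM.x q r.1 r.2 * g, ?_⟩
    rw [mul_assoc, hg, map_mul, OqGL.mk_x]

/-- The centralizer of the trace in `O_q(GL_n)`. -/
theorem OqGL.centralizer_sigma_one (hq₀ : q ≠ 0) (hq : ∀ m : ℕ, 1 ≤ m → q ^ m ≠ 1) :
    Subalgebra.centralizer ℂ {OqGL.sigma n q 1} =
      Algebra.adjoin ℂ (OqGL.sigma n q '' Set.Icc 1 n ∪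
        {((OqGL.sigmaUnit n q)⁻¹ : (OqGL n q)ˣ).val}) := by
  have hcomm : ∀ k, Commute (OqGL.sigma n q 1) (OqGL.sigma n q k) := fun k =>
    (OqM.commute_sigma_one_sigma hq₀ n k).map (OqGL.mk n q)
  apply le_antisymm
  · intro F hF
    have hF' : OqGL.sigma n q 1 * F = F * OqGL.sigma n q 1 :=
      (Subalgebra.mem_centralizer_iff ℂ).1 hF _ rfl
    obtain ⟨m, g, hg⟩ := OqGL.exists_mul_pow_eq_mk hq₀ F
    have hD : ∀ g, Commute (OqGL.mk n q (OqM.det n q)) (OqGL.mk n q g) := fun g =>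
      (OqM.commute_det hq₀ n g).map (OqGL.mk n q)
    have h1 : OqGL.mk n q (OqM.sigma n q 1 * g - g * OqM.sigma n q 1) = 0 := by
      rw [map_sub, map_mul, map_mul, ← hg, sub_eq_zero, mul_assoc,
        ((hD (OqM.sigma n q 1)).pow_left m).eq, ← mul_assoc, ← mul_assoc]
      exact congrArg (· * _) hF'
    -- The numerator commutes with `σ_1` only up to torsion; multiplying it by `det^k` makes it
    -- commute in `O_q(M_n)` itself.
    obtain ⟨k, hk⟩ := OqGL.exists_pow_det_mul_eq_zero hq₀ h1
    have h2 : OqM.det n q ^ k * g ∈ Subalgebra.centralizer ℂ {OqM.sigma n q 1} := by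
      rw [Subalgebra.mem_centralizer_iff]
      rintro _ rfl
      rw [mul_sub, sub_eq_zero] at hk
      rw [← mul_assoc, ← ((OqM.commute_det hq₀ n _).pow_left k).eq, mul_assoc, hk, mul_assoc]
    rw [OqM.centralizer_sigma_one hq₀ hq] at h2
    have h3 : OqGL.mk n q (OqM.det n q ^ k * g) ∈
        Algebra.adjoin ℂ (OqGL.sigma n q '' Set.Icc 1 n) := by
      have : OqGL.mk n q (OqM.det n q ^ k * g) ∈
        (Algebra.adjoin ℂ (OqM.sigma n q '' Set.Icc 1 n)).map (OqGL.mk n q) := ⟨_, h2, rfl⟩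
      rw [AlgHom.map_adjoin, ← Set.image_comp] at this
      exact this
    have hunit : OqGL.mk n q (OqM.det n q) = (OqGL.sigmaUnit n q).val := by
      rw [← OqM.sigma_self]; rfl
    have h4 : F = OqGL.mk n q (OqM.det n q ^ k * g) *
        ((OqGL.sigmaUnit n q)⁻¹ : (OqGL n q)ˣ).val ^ (k + m) := by
      rw [← Units.val_pow_eq_pow_val, inv_pow, Units.eq_mul_inv_iff_mul_eq, map_mul, map_pow,
        ((hD g).pow_left k).eq, ← hg, hunit, mul_assoc, ← pow_add, add_comm,
        Units.val_pow_eq_pow_val]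
    rw [h4]
    refine Subalgebra.mul_mem _ ?_ (Subalgebra.pow_mem _
      (Algebra.subset_adjoin (Set.mem_union_right _ (Set.mem_singleton _))) _)
    exact Algebra.adjoin_mono (s := OqGL.sigma n q '' Set.Icc 1 n) Set.subset_union_left h3
  · refine Algebra.adjoin_le ?_
    rintro F (⟨k, -, rfl⟩ | rfl) <;>
    · rw [SetLike.mem_coe, Subalgebra.mem_centralizer_iff]
      rintro _ rfl
      first
        | exact (hcomm k).eq
        | exact (Commute.units_inv_right (u := OqGL.sigmaUnit n q) (hcomm n)).eq

end GeneralLinear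

/-! ### Homogenization modulo `n` and the centralizer in `O_q(SL_n)`. -/

section SpecialLinear

theorem sum_range_sum_range_add_mul {M : Type*} [AddCommMonoid M] (a : ℕ → M) (n K : ℕ) :
    ∑ c ∈ Finset.range n, ∑ j ∈ Finset.range K, a (c + j * n) =
      ∑ d ∈ Finset.range (K * n), a d := by
  induction K with
  | zero => simp
  | succ K ih =>
    rw [add_mul, one_mul, Finset.sum_range_add, ← ih, ← Finset.sum_add_distrib]
    refine Finset.sum_congr rfl fun c _ => ?_
    rw [Finset.sum_range_succ, add_comm c]

open Polynomial in
/-- If `f` commutes with an element `s` of degree `1` up to a multiple of `D - 1` for a central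
element `D` of degree `n`, then the combinations of its homogeneous components whose degrees are
congruent modulo `n`, made homogeneous with powers of `D`, commute with `s`. -/
theorem exists_commute_sum_coeff {R : Type*} [Ring R] (γ : R →+* R[X]) {n : ℕ} (hn : 1 ≤ n)
    {D s : R} (hD : ∀ a, Commute D a) (hγD : γ D = C D * X ^ n) (hγs : γ s = C s * X)
    {f g : R} (h : f * s - s * f = g * (D - 1)) :
    ∃ K, (γ f).natDegree < K * n ∧ ∀ c < n,
      Commute (∑ j ∈ Finset.range K, D ^ (K - 1 - j) * (γ f).coeff (c + j * n)) s := by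
  have h1 := congrArg γ h
  rw [map_sub, map_mul, map_mul, map_mul, map_sub, map_one, hγD, hγs] at h1
  -- The part of degree `i + 1` of the hypothesis reads `[f_i, s] = g_{i+1-n} D - g_{i+1}`. The
  -- factor `X^n` shifts indices so that no subtraction is needed.
  have hP : ∀ i, (γ f).coeff i * s - s * (γ f).coeff i =
      (γ g * X ^ n).coeff (i + 1) * D - (γ g * X ^ n).coeff (i + 1 + n) := by
    intro i
    have h2 := congrArg (fun p => coeff p (i + 1)) h1
    rw [coeff_mul_X_pow]
    have e1 : γ f * (C s * X) = γ f * C s * X := (mul_assoc _ _ _).symm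
    have e2 : C s * X * γ f = C s * γ f * X := by rw [mul_assoc, X_mul, mul_assoc]
    have e3 : γ g * (C D * X ^ n - 1) = γ g * X ^ n * C D - γ g := by
      rw [mul_sub, mul_one, mul_assoc, X_pow_mul]
    rw [e1, e2, e3] at h2
    simpa only [coeff_sub, coeff_mul_X, coeff_mul_C, coeff_C_mul] using h2
  have hg0 : (γ g).coeff 0 = 0 := by
    have h2 := congrArg (fun p => coeff p 0) h1
    have e1 : γ f * (C s * X) = γ f * C s * X := (mul_assoc _ _ _).symm
    have e2 : C s * X * γ f = C s * γ f * X := by rw [mul_assoc, X_mul, mul_assoc]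
    have e3 : γ g * (C D * X ^ n - 1) = γ g * C D * X ^ n - γ g := by
      rw [mul_sub, mul_one, mul_assoc]
    rw [e1, e2, e3] at h2
    simp only [coeff_sub, mul_coeff_zero, coeff_X_zero, mul_zero, coeff_X_pow,
      (show (0 : ℕ) ≠ n by omega), if_false, zero_sub, sub_zero] at h2
    simpa using h2.symm
  let P : R[X] := γ g * X ^ n
  -- The lower end of the telescoping sum: only `c + 1 = n` reaches a coefficient of `g`, namely the
  -- constant one, which vanishes.
  have hlow : ∀ c < n, P.coeff (c + 1) = 0 := by
    intro c hc
    rcases Nat.lt_or_ge (c + 1) n with h2 | h2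
    · rw [coeff_mul_X_pow', if_neg (by omega)]
    · rw [coeff_mul_X_pow', if_pos h2, show c + 1 - n = 0 by omega, hg0]
  -- `K` exceeds both degrees, so that all of `f` is covered and the upper end `T K` vanishes.
  refine ⟨(γ f).natDegree + P.natDegree + 1, by nlinarith, fun c hc => ?_⟩
  set K := (γ f).natDegree + P.natDegree + 1 with hK
  -- Weighting the commutators of the components `f_{c+jn}` by `D^{K-1-j}` turns them into
  -- differences of consecutive `T j`.
  let T : ℕ → R := fun j => D ^ (K - j) * P.coeff (c + 1 + j * n)
  have hT : ∀ j < K, D ^ (K - 1 - j) * ((γ f).coeff (c + j * n) * s -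
      s * (γ f).coeff (c + j * n)) = T j - T (j + 1) := by
    intro j hj
    rw [hP, mul_sub]
    congr 1
    · rw [← (hD _).eq, ← mul_assoc, ← pow_succ, show K - 1 - j + 1 = K - j by omega,
        show c + j * n + 1 = c + 1 + j * n by omega]
    · rw [show K - 1 - j = K - (j + 1) by omega,
        show c + j * n + 1 + n = c + 1 + (j + 1) * n by ring]
  rw [Commute, SemiconjBy, ← sub_eq_zero, Finset.sum_mul, Finset.mul_sum,
    ← Finset.sum_sub_distrib]
  have h3 : ∑ j ∈ Finset.range K, (D ^ (K - 1 - j) * (γ f).coeff (c + j * n) * s -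
      s * (D ^ (K - 1 - j) * (γ f).coeff (c + j * n))) =
      ∑ j ∈ Finset.range K, (T j - T (j + 1)) := by
    refine Finset.sum_congr rfl fun j hj => ?_
    rw [← hT j (Finset.mem_range.1 hj), mul_sub, mul_assoc, ← mul_assoc s,
      ← ((hD s).pow_left _).eq, mul_assoc]
  rw [h3, Finset.sum_range_sub']
  have hT0 : T 0 = 0 := by
    simp only [T, zero_mul, add_zero, hlow c hc, mul_zero]
  have hTK : T K = 0 := by
    have : P.coeff (c + 1 + K * n) = 0 := coeff_eq_zero_of_natDegree_lt (by nlinarith)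
    simp only [T, this, mul_zero]
  rw [hT0, hTK, sub_zero]

variable {n : ℕ} {q : ℂ}

/-- Since `det_q` is central, the left ideal generated by `det_q - 1` is two-sided, hence is the
whole kernel. -/
theorem OqSL.exists_eq_mul_sub_one (hq₀ : q ≠ 0) {h : OqM n q} (hh : OqSL.mk n q h = 0) :
    ∃ g, h = g * (OqM.det n q - 1) := by
  let I : Ideal (OqM n q) := Ideal.span {OqM.det n q - 1}
  have : I.IsTwoSided := ⟨fun {a} b ha => by
    obtain ⟨c, rfl⟩ := Ideal.mem_span_singleton'.1 ha
    refine Ideal.mem_span_singleton'.2 ⟨c * b, ?_⟩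
    rw [mul_assoc, mul_assoc]
    congr 1
    exact ((Commute.sub_left (OqM.commute_det hq₀ n b) (Commute.one_left b)).eq).symm⟩
  let ψ : OqSL n q →+* OqM n q ⧸ I := RingQuot.lift ⟨Ideal.Quotient.mk I, fun a b hab => by
    cases hab
    rw [Ideal.Quotient.mk_eq_mk_iff_sub_mem]
    exact Ideal.mem_span_singleton_self _⟩
  have h1 : Ideal.Quotient.mk I h = 0 := by
    have h2 : ψ (OqSL.mk n q h) = Ideal.Quotient.mk I h := by
      have h3 : OqSL.mk n q h = RingQuot.mkRingHom (SLRel n q) h := by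
        rw [← RingQuot.mkAlgHom_coe ℂ]
        rfl
      rw [h3]
      exact RingQuot.lift_mkRingHom_apply _ _ _
    rw [← h2, hh, map_zero]
  obtain ⟨g, hg⟩ := Ideal.mem_span_singleton'.1 (Ideal.Quotient.eq_zero_iff_mem.1 h1)
  exact ⟨g, hg.symm⟩

theorem qDet_mul_central {A : Type*} [Ring A] [Algebra ℂ A] {t : ℕ} (y : Fin t → Fin t → A)
    {z : A} (hz : ∀ a, Commute a z) :
    qDet q (fun i j => y i j * z) = qDet q y * z ^ t := by
  rw [qDet, qDet, Finset.sum_mul]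
  refine Finset.sum_congr rfl fun s _ => ?_
  rw [prod_ofFn_mul (fun a => y a (s a)) (fun _ => z) fun _ _ => hz _, smul_mul_assoc,
    List.ofFn_const, List.prod_replicate]

open Polynomial in
theorem map_qDet_of_map_eq_C_mul_X {A : Type*} [Ring A] [Algebra ℂ A] (γ : A →ₐ[ℂ] A[X]) {t : ℕ}
    {y : Fin t → Fin t → A} (h : ∀ i j, γ (y i j) = C (y i j) * X) :
    γ (qDet q y) = C (qDet q y) * X ^ t := by
  have h1 : C (qDet q y) = qDet q fun i j => C (y i j) := map_qDet (CAlgHom (R := ℂ)) q y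
  rw [map_qDet, h1, ← qDet_mul_central _ fun p => (commute_X p).symm]
  simp only [h]

variable (n q) in
/-- The grading of `O_q(M_n)` by degree, as a coaction of the polynomial ring. -/
def gradingHom : OqM n q →ₐ[ℂ] Polynomial (OqM n q) :=
  OqM.lift (fun i j => Polynomial.CAlgHom (R := ℂ) (OqM.x q i j) * Polynomial.X)
    (((OqM.isQMat n q).map Polynomial.CAlgHom).scale fun _ => Polynomial.X_mul)

theorem gradingHom_x (i j : Fin n) : gradingHom n q (OqM.x q i j) =
    Polynomial.C (OqM.x q i j) * Polynomial.X :=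
  OqM.lift_x _ _ i j

theorem gradingHom_det : gradingHom n q (OqM.det n q) =
    Polynomial.C (OqM.det n q) * Polynomial.X ^ n :=
  map_qDet_of_map_eq_C_mul_X (gradingHom n q) gradingHom_x

theorem gradingHom_sigma_one : gradingHom n q (OqM.sigma n q 1) =
    Polynomial.C (OqM.sigma n q 1) * Polynomial.X := by
  rw [OqM.sigma_one, map_sum, map_sum, Finset.sum_mul]
  simp only [gradingHom_x]

theorem eval_one_gradingHom (f : OqM n q) : (gradingHom n q f).eval 1 = f := by
  let ev : Polynomial (OqM n q) →ₐ[ℂ] OqM n q :=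
    Polynomial.eval₂AlgHom (AlgHom.id ℂ _) 1 fun a => Commute.one_right a
  have : ev.comp (gradingHom n q) = AlgHom.id ℂ _ := by
    refine OqM.algHom_ext fun i j => ?_
    rw [AlgHom.comp_apply, gradingHom_x]
    exact (Polynomial.eval_mul_X (p := Polynomial.C (OqM.x q i j)) (x := 1)).trans (by simp)
  exact DFunLike.congr_fun this f

theorem OqSL.mk_det : OqSL.mk n q (OqM.det n q) = 1 := by
  rw [OqSL.mk, RingQuot.mkAlgHom_rel ℂ SLRel.det_eq_one, map_one]

theorem OqSL.adjoin_sigma_le (hn : 1 ≤ n) :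
    (Algebra.adjoin ℂ (OqM.sigma n q '' Set.Icc 1 n)).map (OqSL.mk n q) ≤
      Algebra.adjoin ℂ (OqSL.sigma n q '' Set.Icc 1 (n - 1)) := by
  rw [AlgHom.map_adjoin]
  refine Algebra.adjoin_le ?_
  rintro _ ⟨_, ⟨k, hk, rfl⟩, rfl⟩
  rcases Nat.lt_or_ge k n with hkn | hkn
  · exact Algebra.subset_adjoin ⟨k, ⟨hk.1, by omega⟩, rfl⟩
  · obtain rfl : k = n := le_antisymm hk.2 hkn
    rw [OqM.sigma_self, OqSL.mk_det]
    exact Subalgebra.one_mem _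

/-- The centralizer of the trace in `O_q(SL_n)`. -/
theorem OqSL.centralizer_sigma_one (hn : 1 ≤ n) (hq₀ : q ≠ 0)
    (hq : ∀ m : ℕ, 1 ≤ m → q ^ m ≠ 1) :
    Subalgebra.centralizer ℂ {OqSL.sigma n q 1} =
      Algebra.adjoin ℂ (OqSL.sigma n q '' Set.Icc 1 (n - 1)) := by
  apply le_antisymm
  · intro F hF
    obtain ⟨f, rfl⟩ : ∃ f, OqSL.mk n q f = F := RingQuot.mkAlgHom_surjective ℂ (SLRel n q) F
    have h1 : OqSL.mk n q (f * OqM.sigma n q 1 - OqM.sigma n q 1 * f) = 0 := by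
      rw [map_sub, map_mul, map_mul, sub_eq_zero]
      exact ((Subalgebra.mem_centralizer_iff ℂ).1 hF _ rfl).symm
    obtain ⟨g, hg⟩ := OqSL.exists_eq_mul_sub_one hq₀ h1
    obtain ⟨K, hK, hcomm⟩ := exists_commute_sum_coeff (gradingHom n q).toRingHom hn
      (OqM.commute_det hq₀ n) gradingHom_det gradingHom_sigma_one hg
    have h2 : f = ∑ d ∈ Finset.range (K * n), (gradingHom n q f).coeff d := by
      have := Polynomial.eval_eq_sum_range' hK 1
      simp only [one_pow, mul_one] at this
      exact (eval_one_gradingHom f).symm.trans this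
    -- The components of `f` are grouped by degree modulo `n`. As `det_q` becomes `1`, each group
    -- has the same image as its homogenized version, which lies in the centralizer in `O_q(M_n)`.
    rw [h2, map_sum, ← sum_range_sum_range_add_mul]
    refine Subalgebra.sum_mem _ fun c hc => ?_
    have h3 := hcomm c (Finset.mem_range.1 hc)
    have h4 : ∑ j ∈ Finset.range K, OqM.det n q ^ (K - 1 - j) *
        (gradingHom n q f).coeff (c + j * n) ∈ Subalgebra.centralizer ℂ {OqM.sigma n q 1} := by
      rw [Subalgebra.mem_centralizer_iff]
      rintro _ rfl
      exact h3.eq.symm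
    rw [OqM.centralizer_sigma_one hq₀ hq] at h4
    have h5 := OqSL.adjoin_sigma_le hn ⟨_, h4, rfl⟩
    convert h5 using 1
    refine Eq.trans ?_ (map_sum (OqSL.mk n q) _ _).symm
    refine Finset.sum_congr rfl fun j _ => ?_
    rw [map_mul, map_pow, OqSL.mk_det, one_pow, one_mul]
  · refine Algebra.adjoin_le ?_
    rintro _ ⟨k, -, rfl⟩
    rw [SetLike.mem_coe, Subalgebra.mem_centralizer_iff]
    rintro _ rfl
    exact ((OqM.commute_sigma_one_sigma hq₀ n k).map (OqSL.mk n q)).eq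

end SpecialLinear

end QuantumMatrices

end

theorem theorem2 (n : ℕ) (hn : 1 ≤ n) (q : ℂ) (hq₀ : q ≠ 0)
    (hq : ∀ m : ℕ, 1 ≤ m → q ^ m ≠ 1) :
    Subalgebra.centralizer ℂ {QuantumMatrices.OqM.sigma n q 1} =
        Algebra.adjoin ℂ (QuantumMatrices.OqM.sigma n q '' Set.Icc 1 n) ∧
      Subalgebra.centralizer ℂ {QuantumMatrices.OqGL.sigma n q 1} =
        Algebra.adjoin ℂ (QuantumMatrices.OqGL.sigma n q '' Set.Icc 1 n ∪
          {((QuantumMatrices.OqGL.sigmaUnit n q)⁻¹ : (QuantumMatrices.OqGL n q)ˣ).val}) ∧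
      Subalgebra.centralizer ℂ {QuantumMatrices.OqSL.sigma n q 1} =
        Algebra.adjoin ℂ (QuantumMatrices.OqSL.sigma n q '' Set.Icc 1 (n - 1)) := by
  exact ⟨QuantumMatrices.OqM.centralizer_sigma_one hq₀ hq n,
    QuantumMatrices.OqGL.centralizer_sigma_one hq₀ hq,
    QuantumMatrices.OqSL.centralizer_sigma_one hn hq₀ hq⟩
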